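/- For finite alphabets $\Sigma,\Delta$, let $F(\Sigma),F(\Delta)$ be the free groups on them. An instance is a quadruple $I=(\Sigma,\Delta,g,h)$, where $g,h:F(\Sigma)\to F(\Delta)$ are homomorphisms, given by the words $g(a),h(a)$, $a\in\Sigma$; let $\mathrm{Eq}(g,h)=\{x\in F(\Sigma): g(x)=h(x)\}$. Call $I$ injective if at least one of $g,h$ is injective, and conjugacy inequivalent if there are no $u\in F(\Delta)$ and $x\in F(\Sigma)\setminus\{1\}$ with $g(x)=u^{-1}h(x)u$. Consider the following algorithmic problems. - $\mathrm{PCP}$: given $I$, decide whether there is $x\in F(\Sigma)\setminus\{1\}$ with $g(x)=h(x)$. - $\mathrm{BP}$ (Basis Problem): given an injective $I$, output a (finite) basis of the free group $\mathrm{Eq}(g,h)$. - $\mathrm{RP}$ (Rank Problem): given an injective $I$, output the number of elements of a basis of $\mathrm{Eq}(g,h)$. - $\mathrm{PCP}^{\mathrm{inj}}_{\mathcal R}$: given an injective $I$ and a rational set $\mathcal R\subseteq F(\Sigma)$ (the image in $F(\Sigma)$ of the language of a given finite automaton over $\Sigma\cup\Sigma^{-1}$), decide whether there is $x\in\mathcal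 R$, $x\ne1$, with $g(x)=h(x)$. - $\mathrm{GPCP}^{\mathrm{inj}}$: given an injective $I$ and $u_1,u_2,v_1,v_2\in F(\Delta)$, decide whether there is $x\in F(\Sigma)\setminus\{1\}$ with $u_1g(x)u_2=v_1h(x)v_2$. - $\mathrm{GPCP}^{\mathrm{inj+CI}}$: the problem $\mathrm{GPCP}^{\mathrm{inj}}$ for those inputs whose $I$ is moreover conjugacy inequivalent. For a problem $P$ with stated conditions on its inputs, $P$ is solvable if some algorithm halts with a correct answer on every input satisfying them. For $n\ge 0$ let $P(n)$ be the problem restricted to instances with $|\Sigma|=n$ ($\Delta$ being arbitrary). Write $P\Rightarrow Q$ for "if $P$ is solvable then $Q$ is solvable". **Theorem A.** The following implications hold: $$\mathrm{RP}\Leftrightarrow\mathrm{BP},\qquad \mathrm{BP}\Rightarrow\mathrm{PCP}^{\mathrm{inj}}_{\mathcal R},\qquad \mathrm{BP}\Rightarrow\mathrm{GPCP}^{\mathrm{inj}}\Rightarrow\mathrm{PCP}\Rightarrow\mathrm{GPCP}^{\mathrm{inj+CI}}.$$ Moreover, for every $n\ge 0$, $$\mathrm{RP}(n)\Leftrightarrow\mathrm{BP}(n),\qquad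 \mathrm{BP}(n)\Rightarrow\mathrm{PCP}^{\mathrm{inj}}_{\mathcal R}(n),\qquad \mathrm{BP}(n+2)\Rightarrow\mathrm{GPCP}^{\mathrm{inj}}(n)\Rightarrow\mathrm{PCP}(n),\qquad \mathrm{PCP}(n+2)\Rightarrow\mathrm{GPCP}^{\mathrm{inj+CI}}(n).$$ The implications for each $n$ hold both when $\Delta$ is part of the input, and when $\Delta$ is also fixed, solvability of $P(n)$ then meaning that for every $m\ge 0$ some algorithm solves the problem for $|\Sigma|=n$ and $|\Delta|=m$. -/

import Mathlib

/-! ### Algorithmic problems -/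

/-- The algorithmic problem with inputs the `a : α` satisfying `dom a`, for which an output `b` is
correct on input `a` when `ans a b`, is solvable: there is an algorithm which on every such input
halts with a correct output (nothing is required on other elements of `α`). -/
def Solvable {α β : Type} [Primcodable α] [Primcodable β]
    (dom : α → Prop) (ans : α → β → Prop) : Prop :=
  ∃ f : α →. β, Partrec f ∧ ∀ a, dom a → ∃ b ∈ f a, ans a b

/-- The decision problem "given `a` with `dom a`, does `P a` hold?" is decidable. -/
def DecidableOn {α : Type} [Primcodable α] (dom P : α → Prop) : Prop :=
  Solvable (β := Bool) dom fun a b => (b = true ↔ P a)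

/-! ### Words and homomorphisms as finite data

The alphabet with `k` letters is `Fin k`, and its free group is `FreeGroup (Fin k)`. -/

/-- A word: the letter `(i, true)` is the `i`-th generator, `(i, false)` is its inverse. -/
abbrev Word := List (ℕ × Bool)

/-- The word over `Fin k` given by a `Word`; letters outside of the alphabet are skipped. -/
def Word.restrict (k : ℕ) (w : Word) : List (Fin k × Bool) :=
  w.filterMap fun p => if h : p.1 < k then some (⟨p.1, h⟩, p.2) else none

/-- The element of the free group on `k` letters represented by a word. -/
def Word.toFree (k : ℕ) (w : Word) : FreeGroup (Fin k) :=
  FreeGroup.mk (Word.restrict k w)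

/-- The homomorphism that sends the `i`-th generator to the element represented by the `i`-th
word of the list (words missing from the list are empty, surplus words are ignored). -/
def homOfWords (n m : ℕ) (L : List Word) : FreeGroup (Fin n) →* FreeGroup (Fin m) :=
  FreeGroup.lift fun i : Fin n => Word.toFree m (L.getD i [])

/-! ### Instances of the Post correspondence problem -/

/-- An instance `(Σ, Δ, g, h)`: the sizes `|Σ|` and `|Δ|`, the images of the letters of `Σ` under
`g`, and their images under `h`. -/
abbrev PCPInstance := (ℕ × ℕ) × List Word × List Word

namespace PCPInstance

/-- The pair `(|Σ|, |Δ|)`. -/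
abbrev size (I : PCPInstance) : ℕ × ℕ := I.1

/-- The size of `Σ`. -/
abbrev src (I : PCPInstance) : ℕ := I.1.1

/-- The size of `Δ`. -/
abbrev tgt (I : PCPInstance) : ℕ := I.1.2

/-- The homomorphism `g : F(Σ) → F(Δ)`. -/
def g (I : PCPInstance) : FreeGroup (Fin I.src) →* FreeGroup (Fin I.tgt) :=
  homOfWords I.src I.tgt I.2.1

/-- The homomorphism `h : F(Σ) → F(Δ)`. -/
def h (I : PCPInstance) : FreeGroup (Fin I.src) →* FreeGroup (Fin I.tgt) :=
  homOfWords I.src I.tgt I.2.2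

/-- The equaliser `Eq(g, h) = {x ∈ F(Σ) | g(x) = h(x)}`. -/
def equaliser (I : PCPInstance) : Subgroup (FreeGroup (Fin I.src)) :=
  I.g.eqLocus I.h

/-- At least one of the two maps is injective. -/
def IsInj (I : PCPInstance) : Prop :=
  Function.Injective I.g ∨ Function.Injective I.h

/-- The two maps are conjugacy inequivalent. -/
def IsCI (I : PCPInstance) : Prop :=
  ∀ u : FreeGroup (Fin I.tgt), ¬ ∃ x : FreeGroup (Fin I.src), x ≠ 1 ∧ I.g x = u⁻¹ * I.h x * u

end PCPInstance

/-- An instance `(Σ, Δ, g, h, u₁, u₂, v₁, v₂)` of the generalised problem. -/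
abbrev GPCPInstance := PCPInstance × Word × Word × Word × Word

/-- There is `x ≠ 1` in `F(Σ)` with `u₁ g(x) u₂ = v₁ h(x) v₂`. -/
def GPCPInstance.HasSolution (J : GPCPInstance) : Prop :=
  ∃ x : FreeGroup (Fin J.1.src), x ≠ 1 ∧
    Word.toFree J.1.tgt J.2.1 * J.1.g x * Word.toFree J.1.tgt J.2.2.1 =
      Word.toFree J.1.tgt J.2.2.2.1 * J.1.h x * Word.toFree J.1.tgt J.2.2.2.2

/-! ### Rational sets -/

/-- A finite automaton reading letters of `Σ ∪ Σ⁻¹`: the number of states, the list of transitions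
`(p, a, q)` (from state `p` to state `q` reading the letter `a`), the list of initial states and
the list of accepting states. -/
abbrev AutomatonCode := ℕ × List (ℕ × (ℕ × Bool) × ℕ) × List ℕ × List ℕ

/-- The nondeterministic automaton given by its code. -/
def AutomatonCode.toNFA (A : AutomatonCode) (n : ℕ) : NFA (Fin n × Bool) (Fin A.1) where
  step p a := {q | ((p : ℕ), ((a.1 : ℕ), a.2), (q : ℕ)) ∈ A.2.1}
  start := {q | (q : ℕ) ∈ A.2.2.1}
  accept := {q | (q : ℕ) ∈ A.2.2.2}

/-- The rational subset of the free group on `n` letters given by an automaton: the image of the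
accepted language under the projection from words to the free group. -/
def AutomatonCode.rationalSet (A : AutomatonCode) (n : ℕ) : Set (FreeGroup (Fin n)) :=
  FreeGroup.mk '' {w : List (Fin n × Bool) | w ∈ (A.toNFA n).accepts}

/-! ### The problems

In each of them `S` is the set of pairs of alphabet sizes `(|Σ|, |Δ|)` that are allowed in the
input. -/

/-- The words in the list `B` form a basis of the subgroup `H` of the free group on `n` letters. -/
def IsBasisList {n : ℕ} (H : Subgroup (FreeGroup (Fin n))) (B : List Word) : Prop :=
  ∃ b : FreeGroupBasis (Fin B.length) H,
    ∀ i, ((b i : H) : FreeGroup (Fin n)) = Word.toFree n (B.get i)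

/-- `BP`: given `g, h`, at least one of them injective, output a basis of `Eq(g, h)`. -/
def BP (S : Set (ℕ × ℕ)) : Prop :=
  Solvable (α := PCPInstance) (β := List Word)
    (fun I => I.size ∈ S ∧ I.IsInj) fun I B => IsBasisList I.equaliser B

/-- `RP`: given `g, h`, at least one of them injective, output the number of elements of a basis
of `Eq(g, h)`. -/
def RP (S : Set (ℕ × ℕ)) : Prop :=
  Solvable (α := PCPInstance) (β := ℕ)
    (fun I => I.size ∈ S ∧ I.IsInj) fun I r => Nonempty (FreeGroupBasis (Fin r) I.equaliser)

/-- `PCP`: given `g, h`, is there `x ≠ 1` with `g(x) = h(x)`? -/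
def PCP (S : Set (ℕ × ℕ)) : Prop :=
  DecidableOn (α := PCPInstance) (fun I => I.size ∈ S)
    fun I => ∃ x : FreeGroup (Fin I.src), x ≠ 1 ∧ I.g x = I.h x

/-- `PCP_R^inj`: given `g, h`, at least one of them injective, and a rational set `R ⊆ F(Σ)`, is
there `x ≠ 1` in `R` with `g(x) = h(x)`? -/
def PCPRinj (S : Set (ℕ × ℕ)) : Prop :=
  DecidableOn (α := PCPInstance × AutomatonCode) (fun J => J.1.size ∈ S ∧ J.1.IsInj)
    fun J => ∃ x ∈ J.2.rationalSet J.1.src, x ≠ 1 ∧ J.1.g x = J.1.h x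

/-- `GPCP^inj`: the generalised problem when at least one of `g, h` is injective. -/
def GPCPinj (S : Set (ℕ × ℕ)) : Prop :=
  DecidableOn (α := GPCPInstance) (fun J => J.1.size ∈ S ∧ J.1.IsInj) fun J => J.HasSolution

/-- `GPCP^{inj+CI}`: the generalised problem when at least one of `g, h` is injective and `g, h`
are conjugacy inequivalent. -/
def GPCPinjCI (S : Set (ℕ × ℕ)) : Prop :=
  DecidableOn (α := GPCPInstance) (fun J => J.1.size ∈ S ∧ J.1.IsInj ∧ J.1.IsCI)
    fun J => J.HasSolution

/-- All alphabets `Σ` and `Δ`. -/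
abbrev allSizes : Set (ℕ × ℕ) := Set.univ

/-- The alphabet `Σ` has `n` letters, the alphabet `Δ` is arbitrary. -/
abbrev srcSize (n : ℕ) : Set (ℕ × ℕ) := {s | s.1 = n}

/-- The alphabets `Σ` and `Δ` are fixed, with `n` and `m` letters. -/
abbrev fixedSizes (n m : ℕ) : Set (ℕ × ℕ) := {(n, m)}

/-! ### Solvable problems -/

section Solvability

variable {α β γ δ ε : Type} [Primcodable α] [Primcodable β] [Primcodable γ] [Primcodable δ]
  [Primcodable ε]

/-! Every implication is either a search for a finite certificate or an effective change of
instance.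

RP to BP. `F(Σ)` acts on the set `F(Δ)` by `x • u = g(x) u h(x)⁻¹`, and `Eq(g, h)` is the stabiliser
of `1`. A homomorphism from a stabiliser to a free group is the same as a labelling of the edges of
the Schreier graph, up to the choice of labelling: any labels give a homomorphism (`output`) and
every homomorphism arises (`exists_labels`). Its value on a given word involves finitely many edges.
So if the rank is `r`, a finite list of labels can witness that some `ρ : Eq(g, h) → F_r` sends
words `w_1, …, w_r` to the free generators. Such a `ρ` is onto between free groups of rank `r`,
hence an isomorphism because these groups are Hopfian, and the `w_j` form a basis. Certificates
exist, are checkable, and can be searched for.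

GPCP^inj to PCP. If both maps have a kernel, the two kernels are nontrivial normal subgroups of a
free group and meet nontrivially, so a solution exists. If one map is injective, a left inverse on
its image, again coded by a finite transducer, proves it. Searching for both kinds of evidence in
parallel either answers the question or allows the algorithm for injective instances to be run with
`u_i = v_i = 1`.

BP to PCP_R^inj. From a basis `B` of the equaliser and an automaton for `R`, a finite graph is built
whose paths read a word of `R` followed by a nonempty reduced word in `B^{±1}`. A nontrivial element
of `R ∩ Eq(g, h)` exists iff some such path has trivial label. This is decidable
(`decidableOn_hasPath_one`): by cutting off the farthest vertex of a path, every path with short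
label is composed of short pieces with short intermediate labels, so a finite closed set of triples
certifies nonexistence.

BP to GPCP^inj. New letters `B`, `E` with images `u_1⁻¹β`, `v_1⁻¹β` and `u_2ε`, `v_2ε` preserve
injectivity and turn the generalised equation into equality of the images of `B⁻¹ x E`. This is an
instance of the rational problem with two more letters on each side. When `u_1u_2 = v_1v_2`, the
word `B⁻¹ x B` is used instead, to exclude `x = 1`.

PCP to GPCP^{inj+CI}. After conjugating `h`, the equation is `g(x) p = h(x) q`. A letter `T` is sent
to `pt` and `qt` with `t` new. Comparing normal forms in the free product with `⟨t⟩`, a solution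
involving `T` contains a solution of the equation in its first syllables; conjugacy inequivalence
rules out the other possibilities (`exists_solution_of_injective`). A further letter with two
distinct new images pads the source without changing the equaliser. -/

theorem Solvable.of_computable {dom : α → Prop} {ans : α → β → Prop} {f : α → β}
    (hf : Computable f) (h : ∀ a, dom a → ans a (f a)) : Solvable dom ans :=
  ⟨fun a => Part.some (f a), hf, fun a ha => ⟨f a, Part.mem_some _, h a ha⟩⟩

/-- The second algorithm also sees the original input, and only has to halt on pairs whose second
entry is a correct answer of the first. -/
theorem Solvable.bind {dom : α → Prop} {ans : α → β → Prop} {dom' : α × β → Prop}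
    {ans' : α × β → γ → Prop} {ans'' : α → γ → Prop} (hA : Solvable dom ans)
    (hB : Solvable dom' ans')
    (h : ∀ a, dom a → ∀ b, ans a b → dom' (a, b) ∧ ∀ c, ans' (a, b) c → ans'' a c) :
    Solvable dom ans'' := by
  obtain ⟨f, hf, hf'⟩ := hA
  obtain ⟨k, hk, hk'⟩ := hB
  refine ⟨fun a => (f a).bind fun b => k (a, b), hf.bind (hk.comp Computable.id), fun a ha => ?_⟩
  obtain ⟨b, hb, hab⟩ := hf' a ha
  obtain ⟨hd, hc⟩ := h a ha b hab
  obtain ⟨c, hc', hac⟩ := hk' (a, b) hd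
  exact ⟨c, Part.mem_bind hb hc', hc c hac⟩

theorem Solvable.comp {dom : δ → Prop} {ans : δ → γ → Prop} {dom' : α → Prop}
    {ans' : α → γ → Prop} (hB : Solvable dom ans) {t : α → δ} (ht : Computable t)
    (h : ∀ a, dom' a → dom (t a) ∧ ∀ c, ans (t a) c → ans' a c) : Solvable dom' ans' := by
  obtain ⟨k, hk, hk'⟩ := hB
  refine ⟨fun a => k (t a), hk.comp ht, fun a ha => ?_⟩
  obtain ⟨hd, hc⟩ := h a ha
  obtain ⟨c, hc', hac⟩ := hk' (t a) hd
  exact ⟨c, hc', hc c hac⟩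

/-- A problem whose answers are certified by a decidable relation is solvable by exhaustive
search. -/
theorem Solvable.search {dom : α → Prop} {ans : α → β → Prop} {check : α → γ → Prop}
    (hcheck : PrimrecRel check) {out : α → γ → β} (hout : Primrec₂ out)
    (h : ∀ a, dom a → (∃ c, check a c) ∧ ∀ c, check a c → ans a (out a c)) :
    Solvable dom ans := by
  classical
  let f : α → ℕ → Option β := fun a n =>
    (Encodable.decode n : Option γ).bind fun c => if check a c then some (out a c) else none
  have hf : Primrec₂ f := by
    refine Primrec.option_bind (Primrec.decode.comp Primrec.snd) ?_
    refine Primrec.ite (c := fun p : (α × ℕ) × γ => check p.1.1 p.2) ?_ ?_ (Primrec.const none)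
    · exact hcheck.comp (Primrec.fst.comp Primrec.fst) Primrec.snd
    · exact Primrec.option_some.comp (hout.comp (Primrec.fst.comp Primrec.fst) Primrec.snd)
  refine ⟨fun a => Nat.rfindOpt (f a), Partrec.rfindOpt hf.to_comp, fun a ha => ?_⟩
  obtain ⟨⟨c, hc⟩, hall⟩ := h a ha
  have hdom : (Nat.rfindOpt (f a)).Dom := Nat.rfindOpt_dom.2
    ⟨Encodable.encode c, out a c, by simp [f, hc]⟩
  refine ⟨(Nat.rfindOpt (f a)).get hdom, Part.get_mem _, ?_⟩
  obtain ⟨n, hn⟩ := Nat.rfindOpt_spec (Part.get_mem hdom)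
  simp only [f, Option.mem_def, Option.bind_eq_some_iff] at hn
  obtain ⟨c', -, hc'⟩ := hn
  split_ifs at hc' with h'
  simp only [Option.some.injEq] at hc'
  rw [← hc']
  exact hall c' h'

/-- A property such that it and its negation are both certified is decidable. -/
theorem DecidableOn.of_certificates {dom P : α → Prop} {yes : α → β → Prop} {no : α → γ → Prop}
    (hyes : PrimrecRel yes) (hno : PrimrecRel no)
    (yes_sound : ∀ a, dom a → ∀ c, yes a c → P a) (yes_complete : ∀ a, dom a → P a → ∃ c, yes a c)
    (no_sound : ∀ a, dom a → ∀ c, no a c → ¬ P a)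
    (no_complete : ∀ a, dom a → ¬ P a → ∃ c, no a c) : DecidableOn dom P := by
  classical
  let check : α → β ⊕ γ → Prop := fun a c => Sum.casesOn c (yes a) (no a)
  have hcheck : PrimrecRel check := by
    have : Primrec fun p : α × (β ⊕ γ) =>
        (Sum.casesOn p.2 (fun b => decide (yes p.1 b)) (fun c => decide (no p.1 c)) : Bool) :=
      Primrec.sumCasesOn Primrec.snd
        (hyes.comp (Primrec.fst.comp Primrec.fst) Primrec.snd).decide
        (hno.comp (Primrec.fst.comp Primrec.fst) Primrec.snd).decide
    refine ⟨fun _ => Classical.propDecidable _, this.of_eq ?_⟩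
    rintro ⟨a, b | c⟩ <;> exact decide_eq_decide.2 Iff.rfl
  let out : α → β ⊕ γ → Bool := fun _ c => Sum.casesOn c (fun _ => true) (fun _ => false)
  have hout : Primrec₂ out :=
    Primrec.sumCasesOn Primrec.snd (Primrec.const true).to₂ (Primrec.const false).to₂
  refine Solvable.search hcheck hout fun a ha => ⟨?_, ?_⟩
  · by_cases hP : P a
    · obtain ⟨c, hc⟩ := yes_complete a ha hP
      exact ⟨Sum.inl c, hc⟩
    · obtain ⟨c, hc⟩ := no_complete a ha hP
      exact ⟨Sum.inr c, hc⟩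
  · rintro (c | c) hc
    · exact iff_of_true rfl (yes_sound a ha c hc)
    · exact iff_of_false Bool.false_ne_true (no_sound a ha c hc)

theorem PrimrecPred.of_iff {p q : α → Prop} (hp : PrimrecPred p) (h : ∀ a, q a ↔ p a) :
    PrimrecPred q :=
  hp.of_eq fun a => (h a).symm

theorem PrimrecPred.imp {p q : α → Prop} (hp : PrimrecPred p) (hq : PrimrecPred q) :
    PrimrecPred fun a => p a → q a :=
  (hp.not.or hq).of_iff fun _ => by tauto

theorem PrimrecPred.ball_list {f : α → List β} {p : α → β → Prop} (hf : Primrec f)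
    (hp : PrimrecRel p) : PrimrecPred fun a => ∀ b ∈ f a, p a b :=
  (PrimrecRel.forall_mem_list (hp.swap)).comp hf Primrec.id

theorem PrimrecPred.ball_lt {f : α → ℕ} {p : α → ℕ → Prop} (hf : Primrec f)
    (hp : PrimrecRel p) : PrimrecPred fun a => ∀ b < f a, p a b :=
  (PrimrecPred.ball_list (Primrec.list_range.comp hf) hp).of_iff fun a => by simp

theorem PrimrecPred.bex_list {f : α → List β} {p : α → β → Prop} (hf : Primrec f)
    (hp : PrimrecRel p) : PrimrecPred fun a => ∃ b ∈ f a, p a b :=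
  (PrimrecRel.exists_mem_list (hp.swap)).comp hf Primrec.id

theorem PrimrecPred.mem_list {f : α → List β} {k : α → β} (hf : Primrec f)
    (hk : Primrec k) : PrimrecPred fun a => k a ∈ f a :=
  (PrimrecPred.bex_list (p := fun a b => b = k a) hf
    (Primrec.eq.comp Primrec.snd (hk.comp Primrec.fst))).of_iff fun a => by simp

theorem PrimrecPred.eq_comp {f k : α → β} (hf : Primrec f) (hk : Primrec k) :
    PrimrecPred fun a => f a = k a :=
  Primrec.eq.comp hf hk

theorem Primrec.list_filter {f : α → List β} {p : α → β → Prop} [DecidableRel p] (hf : Primrec f)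
    (hp : PrimrecRel p) : Primrec fun a => (f a).filter fun b => p a b := by
  refine (Primrec.list_flatMap (g := fun a b => if p a b then [b] else []) hf ?_).of_eq ?_
  · exact Primrec.ite (c := fun x : α × β => p x.1 x.2) hp
      (Primrec.list_cons.comp Primrec.snd (Primrec.const [])) (Primrec.const [])
  · intro a
    induction f a with
    | nil => rfl
    | cons b l ih => by_cases h : p a b <;> simp [h, ih]

end Solvability

/-! ### Words -/

namespace Word

open FreeGroup

/-- Remove the letters outside of the alphabet with `k` letters. -/
def clip (k : ℕ) (w : Word) : Word := w.filter fun p => p.1 < k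

/-- The reduced word of the element of the free group on `k` letters represented by a word. -/
def red (k : ℕ) (w : Word) : Word := reduce (clip k w)

/-- The image of a word under the homomorphism given by a list of words. -/
def subst (n : ℕ) (L : List Word) (w : Word) : Word :=
  w.flatMap fun p => if p.1 < n then
    (if p.2 = true then L.getD p.1 [] else invRev (L.getD p.1 [])) else []

/-- The reduced word of an element of a free group. -/
def canon {k : ℕ} (x : FreeGroup (Fin k)) : Word := (FreeGroup.map Fin.val x).toWord

@[simp] theorem toFree_nil (k : ℕ) : toFree k [] = 1 := rfl

theorem restrict_append (k : ℕ) (v w : Word) :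
    restrict k (v ++ w) = restrict k v ++ restrict k w := List.filterMap_append

@[simp] theorem toFree_append (k : ℕ) (v w : Word) :
    toFree k (v ++ w) = toFree k v * toFree k w := by
  simp [toFree, restrict_append, mul_mk]

theorem toFree_cons (k : ℕ) (p : ℕ × Bool) (w : Word) :
    toFree k (p :: w) = toFree k [p] * toFree k w := toFree_append k [p] w

theorem map_val_toFree (k : ℕ) (w : Word) :
    FreeGroup.map Fin.val (toFree k w) = FreeGroup.mk (clip k w) := by
  rw [toFree, map.mk]
  congr 1
  induction w with
  | nil => rfl
  | cons p w ih =>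
    by_cases h : p.1 < k
    · simpa [restrict, clip, h] using ih
    · simpa [restrict, clip, h] using ih

theorem map_val_injective (k : ℕ) :
    Function.Injective (FreeGroup.map (Fin.val : Fin k → ℕ)) :=
  map_injective Fin.val_injective

theorem canon_injective {k : ℕ} : Function.Injective (canon : FreeGroup (Fin k) → Word) :=
  fun _ _ h => map_val_injective k (toWord_injective h)

theorem canon_toFree (k : ℕ) (w : Word) : canon (toFree k w) = red k w := by
  rw [canon, map_val_toFree, toWord_mk, red]

/-- All alphabets embed in `ℕ`, so equality in each free group becomes equality of reduced words of
one type, a primitive recursive test. -/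
theorem red_eq_iff {k : ℕ} {v w : Word} : red k v = red k w ↔ toFree k v = toFree k w := by
  rw [← canon_toFree, ← canon_toFree]
  exact canon_injective.eq_iff

theorem restrict_map (k : ℕ) (l : List (Fin k × Bool)) :
    restrict k (l.map fun p => ((p.1 : ℕ), p.2)) = l := by
  induction l with
  | nil => rfl
  | cons p l ih => simp [restrict]

theorem toFree_map (k : ℕ) (l : List (Fin k × Bool)) :
    toFree k (l.map fun p => ((p.1 : ℕ), p.2)) = FreeGroup.mk l := by
  rw [toFree, restrict_map]

theorem toFree_surjective (k : ℕ) : Function.Surjective (toFree k) := fun x =>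
  ⟨x.toWord.map fun p => ((p.1 : ℕ), p.2), by rw [toFree_map, mk_toWord]⟩

@[simp] theorem toFree_canon {k : ℕ} (x : FreeGroup (Fin k)) : toFree k (canon x) = x := by
  obtain ⟨w, rfl⟩ := toFree_surjective k x
  have h : toFree k (clip k w) = toFree k w := by
    apply map_val_injective
    simp [map_val_toFree, clip]
  apply map_val_injective
  rw [canon_toFree, map_val_toFree, map_val_toFree, red]
  have : clip k (reduce (clip k w)) = reduce (clip k w) := by
    refine List.filter_eq_self.2 fun p hp => ?_
    have := (reduce.red (L := clip k w)).sublist.subset hp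
    exact (List.mem_filter.1 this).2
  rw [this, reduce.self]

@[simp] theorem toFree_invRev (k : ℕ) (w : Word) : toFree k (invRev w) = (toFree k w)⁻¹ := by
  apply map_val_injective
  rw [_root_.map_inv, map_val_toFree, map_val_toFree, inv_mk]
  congr 1
  simp [clip, invRev, List.filter_reverse, List.filter_map, Function.comp_def]

theorem toFree_singleton_true {k : ℕ} (i : Fin k) : toFree k [((i : ℕ), true)] = of i := by
  simp [toFree, restrict, of]

theorem toFree_singleton_false {k : ℕ} (i : Fin k) :
    toFree k [((i : ℕ), false)] = (of i)⁻¹ := by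
  rw [← toFree_singleton_true, ← toFree_invRev]; rfl

theorem toFree_singleton_of_le {k i : ℕ} (h : k ≤ i) (b : Bool) : toFree k [(i, b)] = 1 := by
  simp [toFree, restrict, Nat.not_lt.2 h, one_eq_mk]

theorem toFree_subst (n m : ℕ) (L : List Word) (w : Word) :
    toFree m (subst n L w) = homOfWords n m L (toFree n w) := by
  induction w with
  | nil => rw [toFree_nil, _root_.map_one]; rfl
  | cons p w ih =>
    have hs : subst n L (p :: w) = subst n L [p] ++ subst n L w := by simp [subst]
    rw [hs, toFree_append, ih, toFree_cons n p w, _root_.map_mul]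
    congr 1
    obtain ⟨i, b⟩ := p
    by_cases h : i < n
    · cases b
      · have := toFree_singleton_false ⟨i, h⟩
        simp only at this
        rw [this, _root_.map_inv]
        simp [subst, h, homOfWords]
      · have := toFree_singleton_true ⟨i, h⟩
        simp only at this
        rw [this]
        simp [subst, h, homOfWords]
    · rw [toFree_singleton_of_le (Nat.not_lt.1 h), _root_.map_one]
      simp [subst, h]

/-! ### Primitive recursive operations on words -/

variable {α : Type} [Primcodable α]

/-- Put a letter in front of a reduced word and cancel. -/
def consReduce (p : ℕ × Bool) (r : Word) : Word :=
  List.casesOn r [p] fun q t => if p.1 = q.1 ∧ p.2 = !q.2 then t else p :: q :: t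

theorem primrec_consReduce : Primrec₂ consReduce := by
  refine Primrec.list_casesOn (f := fun x : (ℕ × Bool) × Word => x.2)
    (h := fun x y => if x.1.1 = y.1.1 ∧ x.1.2 = !y.1.2 then y.2 else x.1 :: y.1 :: y.2)
    Primrec.snd (Primrec.list_cons.comp Primrec.fst (Primrec.const ([] : Word))) ?_
  have hp : Primrec fun x : ((ℕ × Bool) × Word) × (ℕ × Bool) × Word => x.1.1 :=
    Primrec.fst.comp Primrec.fst
  have hq : Primrec fun x : ((ℕ × Bool) × Word) × (ℕ × Bool) × Word => x.2.1 :=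
    Primrec.fst.comp Primrec.snd
  refine Primrec.ite (PrimrecPred.and ?_ ?_) (Primrec.snd.comp Primrec.snd) ?_
  · exact Primrec.eq.comp (Primrec.fst.comp hp) (Primrec.fst.comp hq)
  · exact Primrec.eq.comp (Primrec.snd.comp hp) (Primrec.not.comp (Primrec.snd.comp hq))
  · exact Primrec.list_cons.comp hp (Primrec.list_cons.comp hq (Primrec.snd.comp Primrec.snd))

theorem primrec_reduce : Primrec (reduce : Word → Word) := by
  have h : Primrec fun w : Word => w.foldr consReduce ([] : Word) :=
    Primrec.list_foldr (h := fun _ x => consReduce x.1 x.2) Primrec.id (Primrec.const _)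
      (primrec_consReduce.comp (Primrec.fst.comp Primrec.snd) (Primrec.snd.comp Primrec.snd))
  refine h.of_eq fun w => ?_
  induction w with
  | nil => rfl
  | cons p w ih => rw [List.foldr_cons, ih, reduce.cons]; rfl

theorem primrec_invRev : Primrec (invRev : Word → Word) :=
  Primrec.list_reverse.comp (Primrec.list_map Primrec.id
    (Primrec.pair (Primrec.fst.comp Primrec.snd)
      (Primrec.not.comp (Primrec.snd.comp Primrec.snd))).to₂)

theorem primrec_clip : Primrec₂ clip :=
  Primrec.list_filter (f := fun x : ℕ × Word => x.2) (p := fun x p => p.1 < x.1) Primrec.snd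
    (Primrec.nat_lt.comp (Primrec.fst.comp Primrec.snd) (Primrec.fst.comp Primrec.fst))

theorem primrec_red : Primrec₂ red := primrec_reduce.comp primrec_clip

theorem primrec_getD {f : α → List Word} {i : α → ℕ} (hf : Primrec f) (hi : Primrec i) :
    Primrec fun a => (f a).getD (i a) [] :=
  (Primrec.list_getD ([] : Word)).comp hf hi

theorem primrec_subst {n : α → ℕ} {L : α → List Word} {w : α → Word} (hn : Primrec n)
    (hL : Primrec L) (hw : Primrec w) : Primrec fun a => subst (n a) (L a) (w a) := by
  have hi : Primrec fun x : α × ℕ × Bool => x.2.1 := Primrec.fst.comp Primrec.snd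
  have hg : Primrec fun x : α × ℕ × Bool => (L x.1).getD x.2.1 [] :=
    primrec_getD (hL.comp Primrec.fst) hi
  refine Primrec.list_flatMap hw (Primrec.ite (c := fun x : α × ℕ × Bool => x.2.1 < n x.1) ?_
    (Primrec.ite (c := fun x : α × ℕ × Bool => x.2.2 = true) ?_ hg (primrec_invRev.comp hg))
    (Primrec.const []))
  · exact Primrec.nat_lt.comp hi (hn.comp Primrec.fst)
  · exact Primrec.eq.comp (Primrec.snd.comp Primrec.snd) (Primrec.const true)

end Word

/-! ### Transducers

A transducer is given by permutations `σ a` of a set of states and by labels `l a s` in a group,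
for the letters `a` and the states `s`. Words act on pairs of a state and an element of the group,
the label of each transition being multiplied to the second component from the left. -/

namespace Transducer

open FreeGroup

variable {α S S' G : Type*} [Group G]

/-- The permutation of the pairs of a state and a group element given by one letter. -/
def letterPerm (σ : Equiv.Perm S) (l : S → G) : Equiv.Perm (S × G) where
  toFun p := (σ p.1, l p.1 * p.2)
  invFun p := (σ.symm p.1, (l (σ.symm p.1))⁻¹ * p.2)
  left_inv p := by simp
  right_inv p := by simp

/-- The action of the free group given by a transducer. -/
def act (σ : α → Equiv.Perm S) (l : α → S → G) : FreeGroup α →* Equiv.Perm (S × G) :=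
  FreeGroup.lift fun a => letterPerm (σ a) (l a)

variable (σ : α → Equiv.Perm S) (l : α → S → G)

theorem act_of (a : α) (p : S × G) : act σ l (of a) p = (σ a p.1, l a p.1 * p.2) := by
  simp [act, letterPerm]

theorem act_of_inv (a : α) (p : S × G) :
    act σ l (of a)⁻¹ p = ((σ a).symm p.1, (l a ((σ a).symm p.1))⁻¹ * p.2) := by
  rw [_root_.map_inv, Equiv.Perm.inv_eq_iff_eq, act_of]
  simp

/-- Labels are multiplied on the left, so the action commutes with right translations of the group
component. This makes the output multiplicative on a stabiliser. -/
theorem act_mul_right (x : FreeGroup α) :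
    ∀ (s : S) (y z : G), act σ l x (s, z * y) = ((act σ l x (s, z)).1, (act σ l x (s, z)).2 * y) := by
  induction x using FreeGroup.induction_on with
  | C1 => simp
  | of a => intro s y z; simp only [act_of, mul_assoc]
  | inv_of a _ => intro s y z; simp only [act_of_inv, mul_assoc]
  | mul x x' ih ih' => intro s y z; simp only [_root_.map_mul, Equiv.Perm.mul_apply, ih', ih]

theorem act_fst (x : FreeGroup α) : ∀ p : S × G, (act σ l x p).1 = FreeGroup.lift σ x p.1 := by
  induction x using FreeGroup.induction_on with
  | C1 => simp
  | of a => intro p; simp [act_of]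
  | inv_of a _ => intro p; rw [act_of_inv, _root_.map_inv, lift_apply_of]; rfl
  | mul x x' ih ih' => intro p; simp only [_root_.map_mul, Equiv.Perm.mul_apply, ih', ih]

/-- The homomorphism on the stabiliser of a state given by a transducer. -/
def output (s₀ : S) (H : Subgroup (FreeGroup α)) (hH : ∀ x ∈ H, FreeGroup.lift σ x s₀ = s₀) :
    H →* G where
  toFun x := (act σ l x (s₀, 1)).2
  map_one' := by simp
  map_mul' x y := by
    have hy : act σ l (y : FreeGroup α) (s₀, 1) = (s₀, 1 * (act σ l (y : FreeGroup α) (s₀, 1)).2) :=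
      Prod.ext (by rw [act_fst, hH _ y.2]) (by simp)
    rw [Subgroup.coe_mul, _root_.map_mul, Equiv.Perm.mul_apply, hy, act_mul_right]
    simp

/-- Every homomorphism on the stabiliser of a state is the output of a transducer. -/
theorem exists_labels (s₀ : S) (H : Subgroup (FreeGroup α))
    (hH : ∀ x, x ∈ H ↔ FreeGroup.lift σ x s₀ = s₀) (ρ : H →* G) :
    ∃ l : α → S → G, ∀ x : H, act σ l x (s₀, 1) = (s₀, ρ x) := by
  classical
  -- A transversal of the orbit of `s₀`, normalised at `s₀`; states off the orbit get the irrelevant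
  -- value `1`.
  have ht : ∃ t : S → FreeGroup α, t s₀ = 1 ∧
      ∀ x, FreeGroup.lift σ (t (FreeGroup.lift σ x s₀)) s₀ = FreeGroup.lift σ x s₀ := by
    refine ⟨fun s => if s = s₀ then 1 else
      if h : ∃ x, FreeGroup.lift σ x s₀ = s then h.choose else 1, by simp, fun x => ?_⟩
    by_cases h : FreeGroup.lift σ x s₀ = s₀
    · simp [h]
    · have h' : ∃ y, FreeGroup.lift σ y s₀ = FreeGroup.lift σ x s₀ := ⟨x, rfl⟩
      simp only [h, if_false, dif_pos h']
      exact h'.choose_spec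
  obtain ⟨t, ht₀, ht⟩ := ht
  -- `ρ` is extended by `1` outside `H`, so that labels are defined at every state; multiplicativity
  -- is only needed on `H`.
  let R : FreeGroup α → G := fun x => if h : x ∈ H then ρ ⟨x, h⟩ else 1
  have hR : ∀ x y, x ∈ H → y ∈ H → R (x * y) = R x * R y := by
    intro x y hx hy
    simp only [R, dif_pos hx, dif_pos hy, dif_pos (H.mul_mem hx hy)]
    rw [← _root_.map_mul]; rfl
  -- The label of an edge is the value of `ρ` at its Schreier generator, and `pt y` below is the
  -- result that `y` should give from `(s₀, 1)`.
  let L : α → S → G := fun a s => R ((t (σ a s))⁻¹ * of a * t s)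
  let pt : FreeGroup α → S × G := fun y =>
    (FreeGroup.lift σ y s₀, R ((t (FreeGroup.lift σ y s₀))⁻¹ * y))
  have hmem : ∀ y, (t (FreeGroup.lift σ y s₀))⁻¹ * y ∈ H := by
    intro y
    rw [hH, _root_.map_mul, _root_.map_inv, Equiv.Perm.mul_apply, Equiv.Perm.inv_eq_iff_eq, ht]
  have key : ∀ x y, act σ L x (pt y) = pt (x * y) := by
    intro x
    induction x using FreeGroup.induction_on with
    | C1 => simp
    | of a =>
      intro y
      rw [act_of]
      have h1 : σ a (FreeGroup.lift σ y s₀) = FreeGroup.lift σ (of a * y) s₀ := by simp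
      refine Prod.ext h1 ?_
      change R ((t (σ a (FreeGroup.lift σ y s₀)))⁻¹ * of a * t (FreeGroup.lift σ y s₀)) *
        R ((t (FreeGroup.lift σ y s₀))⁻¹ * y) = R ((t (FreeGroup.lift σ (of a * y) s₀))⁻¹ * (of a * y))
      rw [h1, ← hR _ _ ?_ (hmem y)]
      · congr 1; group
      · have := H.mul_mem (hmem (of a * y)) (H.inv_mem (hmem y))
        convert this using 1; group
    | inv_of a ih =>
      intro y
      rw [_root_.map_inv, Equiv.Perm.inv_eq_iff_eq, ih]
      simp
    | mul x x' ih ih' =>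
      intro y
      rw [_root_.map_mul, Equiv.Perm.mul_apply, ih', ih, mul_assoc]
  refine ⟨L, fun x => ?_⟩
  have h1 : pt 1 = (s₀, 1) := by
    have : R 1 = 1 := by
      simp only [R, dif_pos H.one_mem]
      exact ρ.map_one
    simp [pt, ht₀, this]
  have hx : FreeGroup.lift σ (x : FreeGroup α) s₀ = s₀ := (hH _).1 x.2
  rw [← h1, key, mul_one]
  simp [pt, hx, ht₀, R]

/-- The action of a word on a state depends only on finitely many transitions. -/
theorem exists_finite_support (w : List (α × Bool)) : ∀ (s : S) (z : G), ∃ V : List (α × S),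
    ∀ (enc : S → S') (σ' : α → Equiv.Perm S') (l' : α → S' → G),
      (∀ p ∈ V, σ' p.1 (enc p.2) = enc (σ p.1 p.2) ∧ l' p.1 (enc p.2) = l p.1 p.2) →
      act σ' l' (FreeGroup.mk w) (enc s, z) =
        (enc (act σ l (FreeGroup.mk w) (s, z)).1, (act σ l (FreeGroup.mk w) (s, z)).2) := by
  induction w with
  | nil => intro s z; exact ⟨[], fun enc σ' l' _ => by simp [← one_eq_mk]⟩
  | cons p w ih =>
    intro s z
    obtain ⟨V, hV⟩ := ih s z
    obtain ⟨a, b⟩ := p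
    set q := act σ l (FreeGroup.mk w) (s, z) with hq
    have hcons : ∀ b, (FreeGroup.mk ((a, b) :: w) : FreeGroup α) =
        (if b then of a else (of a)⁻¹) * FreeGroup.mk w := by
      intro b
      cases b
      · rw [of, inv_mk, if_neg Bool.false_ne_true, mul_mk]; rfl
      · rw [of, if_pos rfl, mul_mk]; rfl
    cases b
    -- An inverse letter traverses an edge backwards, so the edge is recorded under the state that
    -- is reached.
    · refine ⟨(a, (σ a).symm q.1) :: V, fun enc σ' l' h => ?_⟩
      have h1 := h _ List.mem_cons_self
      have h2 := hV enc σ' l' fun p hp => h p (List.mem_cons_of_mem _ hp)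
      simp only [hcons, Bool.false_eq_true, if_false, _root_.map_mul, Equiv.Perm.mul_apply, h2,
        ← hq, act_of_inv]
      simp only [Equiv.apply_symm_apply] at h1
      have h3 : (σ' a).symm (enc q.1) = enc ((σ a).symm q.1) := by
        rw [Equiv.symm_apply_eq, h1.1]
      rw [h3, h1.2]
    · refine ⟨(a, q.1) :: V, fun enc σ' l' h => ?_⟩
      have h1 := h _ List.mem_cons_self
      have h2 := hV enc σ' l' fun p hp => h p (List.mem_cons_of_mem _ hp)
      simp only [hcons, if_true, _root_.map_mul, Equiv.Perm.mul_apply, h2, ← hq, act_of]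
      rw [h1.1, h1.2]

/-! ### Running transducers on words -/

/-- One step of the computation of a transducer with states and labels coded by words. -/
def step (k : ℕ) (sp : ℕ × Bool → Word → Word) (lab : ℕ → Word → Word) (p : ℕ × Bool)
    (c : Word × Word) : Word × Word :=
  if p.1 < k then
    (sp p c.1, (if p.2 = true then lab p.1 c.1 else invRev (lab p.1 (sp p c.1))) ++ c.2)
  else c

/-- The computation of a transducer with states and labels coded by words. -/
def run (k : ℕ) (sp : ℕ × Bool → Word → Word) (lab : ℕ → Word → Word) (w : Word)
    (c : Word × Word) : Word × Word :=
  w.foldr (step k sp lab) c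

/-- Words act from the left, hence the fold from the right in `run`: the last letter is read first.
Only the images of `enc` matter, so `sp` and `lab` may be arbitrary on other words. -/
theorem run_spec {S : Type*} {k r : ℕ} {σ : Fin k → Equiv.Perm S}
    {l : Fin k → S → FreeGroup (Fin r)}
    {enc : S → Word} {sp : ℕ × Bool → Word → Word} {lab : ℕ → Word → Word}
    (hpos : ∀ (a : Fin k) s, sp (a, true) (enc s) = enc (σ a s))
    (hneg : ∀ (a : Fin k) s, sp (a, false) (enc s) = enc ((σ a).symm s))
    (hlab : ∀ (a : Fin k) s, Word.toFree r (lab a (enc s)) = l a s) (w : Word) (s : S)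
    (z : Word) :
    (run k sp lab w (enc s, z)).1 = enc (act σ l (Word.toFree k w) (s, Word.toFree r z)).1 ∧
      Word.toFree r (run k sp lab w (enc s, z)).2 =
        (act σ l (Word.toFree k w) (s, Word.toFree r z)).2 := by
  induction w with
  | nil => simp [run]
  | cons p w ih =>
    obtain ⟨ih1, ih2⟩ := ih
    have hrun : run k sp lab (p :: w) (enc s, z) =
      step k sp lab p (run k sp lab w (enc s, z)) := rfl
    rw [hrun, Word.toFree_cons, _root_.map_mul, Equiv.Perm.mul_apply]
    generalize run k sp lab w (enc s, z) = c at *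
    generalize act σ l (Word.toFree k w) (s, Word.toFree r z) = q at *
    obtain ⟨c1, c2⟩ := c
    obtain ⟨q1, q2⟩ := q
    obtain ⟨a, b⟩ := p
    simp only at ih1 ih2
    subst ih1 ih2
    by_cases h : a < k
    · cases b
      · have h1 := hneg ⟨a, h⟩ q1
        have h2 := hlab ⟨a, h⟩ ((σ ⟨a, h⟩).symm q1)
        have h3 := Word.toFree_singleton_false ⟨a, h⟩
        simp only at h1 h2 h3
        rw [h3, act_of_inv]
        simp [step, h, h1, h2]
      · have h1 := hpos ⟨a, h⟩ q1
        have h2 := hlab ⟨a, h⟩ q1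
        have h3 := Word.toFree_singleton_true ⟨a, h⟩
        simp only at h1 h2 h3
        rw [h3, act_of]
        simp [step, h, h1, h2]
    · rw [Word.toFree_singleton_of_le (Nat.not_lt.1 h)]
      simp [step, h]

/-- The label found in a list of labels. -/
def labelOf (Λ : List ((ℕ × Word) × Word)) (a : ℕ) (u : Word) : Word :=
  Λ.flatMap fun e => if e.1 = (a, u) then e.2 else []

/-- The first conjunct keeps the induction going: it shows that a new edge has no earlier entry in
the list. -/
theorem exists_labelOf {S : Type*} {k r : ℕ} {enc : S → Word} (henc : Function.Injective enc)
    (l : Fin k → S → FreeGroup (Fin r)) (V : List (Fin k × S)) :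
    ∃ Λ : List ((ℕ × Word) × Word), (∀ e ∈ Λ, ∃ p ∈ V, e.1 = ((p.1 : ℕ), enc p.2)) ∧
      ∀ p ∈ V, Word.toFree r (labelOf Λ p.1 (enc p.2)) = l p.1 p.2 := by
  classical
  induction V with
  | nil => exact ⟨[], by simp, by simp⟩
  | cons p V ih =>
    obtain ⟨Λ, h1, h2⟩ := ih
    -- A repeated edge must not be entered twice, because `labelOf` concatenates all matching
    -- entries.
    by_cases hp : p ∈ V
    · refine ⟨Λ, fun e he => ?_, fun q hq => ?_⟩
      · obtain ⟨q, hq, he⟩ := h1 e he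
        exact ⟨q, List.mem_cons_of_mem _ hq, he⟩
      · rcases List.mem_cons.1 hq with rfl | hq
        exacts [h2 _ hp, h2 _ hq]
    · refine ⟨(((p.1 : ℕ), enc p.2), Word.canon (l p.1 p.2)) :: Λ, fun e he => ?_, fun q hq => ?_⟩
      · rcases List.mem_cons.1 he with rfl | he
        · exact ⟨p, List.mem_cons_self, rfl⟩
        · obtain ⟨q, hq, he⟩ := h1 e he
          exact ⟨q, List.mem_cons_of_mem _ hq, he⟩
      · have hinj : ∀ q : Fin k × S, ((p.1 : ℕ), enc p.2) = ((q.1 : ℕ), enc q.2) → p = q := by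
          rintro ⟨a, s⟩ h
          simp only [Prod.mk.injEq] at h
          exact Prod.ext (Fin.ext h.1) (henc h.2)
        rcases List.mem_cons.1 hq with rfl | hq
        · have : labelOf Λ q.1 (enc q.2) = [] := by
            refine List.flatMap_eq_nil_iff.2 fun e he => if_neg fun h => ?_
            obtain ⟨p', hp', he'⟩ := h1 e he
            rw [he'] at h
            exact hp (hinj _ h.symm ▸ hp')
          have h' : labelOf ((((q.1 : ℕ), enc q.2), Word.canon (l q.1 q.2)) :: Λ) q.1 (enc q.2) =
            Word.canon (l q.1 q.2) ++ labelOf Λ q.1 (enc q.2) := by simp [labelOf]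
          rw [h', this]; simp
        · have hne : ((p.1 : ℕ), enc p.2) ≠ ((q.1 : ℕ), enc q.2) := fun h => hp (hinj _ h ▸ hq)
          have h' : labelOf ((((p.1 : ℕ), enc p.2), Word.canon (l p.1 p.2)) :: Λ) q.1 (enc q.2) =
            labelOf Λ q.1 (enc q.2) := by simp only [labelOf, List.flatMap_cons, if_neg hne]; rfl
          rw [h', h2 _ hq]

section

variable {α : Type} [Primcodable α]

theorem primrec_labelOf {Λ : α → List ((ℕ × Word) × Word)} {a : α → ℕ} {u : α → Word}
    (hΛ : Primrec Λ) (ha : Primrec a) (hu : Primrec u) :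
    Primrec fun x => labelOf (Λ x) (a x) (u x) := by
  refine Primrec.list_flatMap hΛ (Primrec.ite
    (c := fun y : α × ((ℕ × Word) × Word) => y.2.1 = (a y.1, u y.1)) ?_
    (Primrec.snd.comp Primrec.snd) (Primrec.const []))
  exact Primrec.eq.comp (Primrec.fst.comp Primrec.snd)
    ((ha.comp Primrec.fst).pair (hu.comp Primrec.fst))

theorem primrec_run {k : α → ℕ} {sp : α → ℕ × Bool → Word → Word} {lab : α → ℕ → Word → Word}
    {w : α → Word} {c : α → Word × Word} (hk : Primrec k)
    (hsp : Primrec fun x : α × (ℕ × Bool) × Word => sp x.1 x.2.1 x.2.2)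
    (hlab : Primrec fun x : α × ℕ × Word => lab x.1 x.2.1 x.2.2) (hw : Primrec w)
    (hc : Primrec c) : Primrec fun x => run (k x) (sp x) (lab x) (w x) (c x) := by
  refine Primrec.list_foldr (h := fun x y => step (k x) (sp x) (lab x) y.1 y.2) hw hc ?_
  have hp : Primrec fun x : α × (ℕ × Bool) × Word × Word => x.2.1 :=
    Primrec.fst.comp Primrec.snd
  have hu : Primrec fun x : α × (ℕ × Bool) × Word × Word => x.2.2.1 :=
    Primrec.fst.comp (Primrec.snd.comp Primrec.snd)
  have hz : Primrec fun x : α × (ℕ × Bool) × Word × Word => x.2.2.2 :=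
    Primrec.snd.comp (Primrec.snd.comp Primrec.snd)
  have hs : Primrec fun x : α × (ℕ × Bool) × Word × Word => sp x.1 x.2.1 x.2.2.1 :=
    hsp.comp (Primrec.fst.pair (hp.pair hu))
  refine Primrec.ite (c := fun x : α × (ℕ × Bool) × Word × Word => x.2.1.1 < k x.1) ?_
    (hs.pair (Primrec.list_append.comp (Primrec.ite
      (c := fun x : α × (ℕ × Bool) × Word × Word => x.2.1.2 = true) ?_ ?_ ?_) hz))
    (Primrec.snd.comp Primrec.snd)
  · exact Primrec.nat_lt.comp (Primrec.fst.comp hp) (hk.comp Primrec.fst)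
  · exact Primrec.eq.comp (Primrec.snd.comp hp) (Primrec.const true)
  · exact hlab.comp (Primrec.fst.pair ((Primrec.fst.comp hp).pair hu))
  · exact Word.primrec_invRev.comp
      (hlab.comp (Primrec.fst.pair ((Primrec.fst.comp hp).pair hs)))

end

end Transducer

/-! ### Extending partial injections to permutations -/

/-- The product of the transpositions in a list. -/
def swapProd {X : Type*} [DecidableEq X] (s : List (X × X)) : Equiv.Perm X :=
  (s.map fun p => Equiv.swap p.1 p.2).prod

/-- The first pair is repaired by one more transposition. It fixes the targets already reached: they
differ from `p.2` since the pairs form a partial injection, and from `swapProd s p.1` by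
injectivity. -/
theorem exists_swapProd {X : Type*} [DecidableEq X] (P : List (X × X))
    (hP : ∀ p ∈ P, ∀ q ∈ P, p.1 = q.1 ↔ p.2 = q.2) :
    ∃ s : List (X × X), ∀ p ∈ P, swapProd s p.1 = p.2 := by
  induction P with
  | nil => exact ⟨[], by simp⟩
  | cons p P ih =>
    obtain ⟨s, hs⟩ := ih fun a ha b hb =>
      hP a (List.mem_cons_of_mem _ ha) b (List.mem_cons_of_mem _ hb)
    have hs' : swapProd ((swapProd s p.1, p.2) :: s) =
        Equiv.swap (swapProd s p.1) p.2 * swapProd s := by simp [swapProd]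
    refine ⟨(swapProd s p.1, p.2) :: s, fun q hq => ?_⟩
    rw [hs', Equiv.Perm.mul_apply]
    rcases List.mem_cons.1 hq with rfl | hq'
    · exact Equiv.swap_apply_left _ _
    · by_cases h : p.1 = q.1
      · rw [h, Equiv.swap_apply_left]
        exact (hP p List.mem_cons_self q hq).1 h
      · rw [hs q hq', Equiv.swap_apply_of_ne_of_ne]
        · rw [← hs q hq']
          exact fun h' => h ((swapProd s).injective h').symm
        · exact fun h' => h ((hP p List.mem_cons_self q hq).2 h'.symm)

/-! ### Free groups of finite rank are Hopfian -/

namespace FreeGroup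

/-- Residual finiteness: the reduced word is written along a line of `length + 1` points, each
generator acts on it as a partial injection, and any extension to permutations makes the word move
the last point to the first. -/
theorem exists_perm_ne_one {α : Type*} [DecidableEq α] {x : FreeGroup α} (hx : x ≠ 1) :
    ∃ (N : ℕ) (ψ : FreeGroup α →* Equiv.Perm (Fin N)), ψ x ≠ 1 := by
  classical
  let w := x.toWord
  have hw : w ≠ [] := fun h => hx (toWord_eq_nil_iff.1 h)
  have hred : ∀ (i : ℕ) (hi : i + 1 < w.length), w[i].1 = w[i + 1].1 → w[i].2 = w[i + 1].2 := by
    have : IsReduced w := isReduced_toWord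
    intro i hi
    exact List.isChain_iff_getElem.1 this i hi
  -- The letter in position `i` has to move `i + 1` to `i`; a negative letter prescribes the
  -- opposite move for its generator.
  let pr : Fin w.length → Fin (w.length + 1) × Fin (w.length + 1) := fun i =>
    if (w[i]).2 = true then (i.succ, i.castSucc) else (i.castSucc, i.succ)
  have hex : ∀ a : α, ∃ π : Equiv.Perm (Fin (w.length + 1)),
      ∀ i : Fin w.length, (w[i]).1 = a → π (pr i).1 = (pr i).2 := by
    intro a
    obtain ⟨s, hs⟩ := exists_swapProd
      ((Finset.univ.filter fun i : Fin w.length => (w[i]).1 = a).toList.map pr) (by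
        simp only [List.mem_map, Finset.mem_toList, Finset.mem_filter, Finset.mem_univ, true_and]
        rintro _ ⟨i, hi, rfl⟩ _ ⟨j, hj, rfl⟩
        have h1 := hred i
        have h2 := hred j
        simp only [Fin.getElem_fin] at hi hj
        -- A clash between prescribed moves can only come from adjacent positions with the same
        -- generator and opposite signs, which reducedness forbids.
        have hij : (i : ℕ) + 1 = j → (w[i]).2 = (w[j]).2 := fun h => by
          have := h1 (by omega) (by simp only [h, hi, hj])
          simpa only [h, Fin.getElem_fin] using this
        have hji : (j : ℕ) + 1 = i → (w[j]).2 = (w[i]).2 := fun h => by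
          have := h2 (by omega) (by simp only [h, hi, hj])
          simpa only [h, Fin.getElem_fin] using this
        by_cases b1 : (w[i]).2 = true <;> by_cases b2 : (w[j]).2 = true
        · simp only [pr, b1, b2, if_true, Fin.succ_inj, Fin.castSucc_inj]
        · simp only [pr, b1, b2, Fin.ext_iff, if_true, Fin.val_succ, Fin.val_castSucc] at hij hji ⊢
          simp only [Bool.false_eq_true, if_false, Fin.val_castSucc, Fin.val_succ]
          simp only [eq_comm, imp_false, Bool.false_eq_true] at hij hji
          omega
        · simp only [pr, b1, b2, Fin.ext_iff, if_true, Fin.val_succ, Fin.val_castSucc] at hij hji ⊢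
          simp only [Bool.false_eq_true, if_false, Fin.val_castSucc, Fin.val_succ]
          simp only [eq_comm, imp_false, Bool.false_eq_true] at hij hji
          omega
        · simp only [pr, b1, b2, Bool.false_eq_true, if_false, Fin.succ_inj, Fin.castSucc_inj])
    refine ⟨swapProd s, fun i hi => hs _ (List.mem_map.2 ⟨i, by simpa using hi, rfl⟩)⟩
  choose π hπ using hex
  refine ⟨w.length + 1, FreeGroup.lift π, fun h => ?_⟩
  have key : ∀ k (hk : k ≤ w.length), FreeGroup.lift π (FreeGroup.mk (w.drop (w.length - k)))
      (Fin.last w.length) = ⟨w.length - k, by omega⟩ := by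
    intro k
    induction k with
    | zero =>
      intro _
      simp [Fin.last]
    | succ k ih =>
      intro hk
      set i : Fin w.length := ⟨w.length - (k + 1), by omega⟩ with hi
      have hd : w.drop (w.length - (k + 1)) = w[i] :: w.drop (w.length - k) := by
        rw [List.drop_eq_getElem_cons (by omega)]
        congr 2
        omega
      have hm : (FreeGroup.mk (w.drop (w.length - (k + 1))) : FreeGroup α) =
          FreeGroup.mk [w[i]] * FreeGroup.mk (w.drop (w.length - k)) := by
        rw [hd, mul_mk]; rfl
      rw [hm, _root_.map_mul, Equiv.Perm.mul_apply, ih (by omega)]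
      have hs : (⟨w.length - k, by omega⟩ : Fin (w.length + 1)) = i.succ := by
        ext; simp [hi]; omega
      have hc : (⟨w.length - (k + 1), by omega⟩ : Fin (w.length + 1)) = i.castSucc := by
        ext; simp [hi]
      rw [hs, hc, lift_mk]
      have := hπ _ i rfl
      by_cases b : (w[i]).2 = true
      · simp only [pr, b, if_true] at this
        simp only [List.map_cons, b, List.map_nil, List.prod_cons, List.prod_nil, mul_one, cond_true]
        exact this
      · simp only [pr, b] at this
        simp only [Bool.not_eq_true] at b
        simp only [List.map_cons, b, List.map_nil, List.prod_cons, List.prod_nil, mul_one, cond_false]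
        rw [Equiv.Perm.inv_eq_iff_eq]
        simpa using this.symm
  have h1 := key w.length le_rfl
  have hpos := List.length_pos_iff.2 hw
  have h2 : FreeGroup.mk w = x := mk_toWord
  simp only [Nat.sub_self, List.drop_zero, h2, h, Equiv.Perm.one_apply, Fin.ext_iff,
    Fin.val_last] at h1
  omega

/-- Malcev's argument: precomposition with the surjection is injective on the finite set `Hom(F_r,
S_N)`, hence onto. Every `ψ` into a finite symmetric group thus factors through `φ` and kills its
kernel, against residual finiteness. -/
theorem injective_of_surjective {r : ℕ} (φ : FreeGroup (Fin r) →* FreeGroup (Fin r))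
    (hφ : Function.Surjective φ) : Function.Injective φ := by
  refine (injective_iff_map_eq_one φ).2 fun x hx => by_contra fun hne => ?_
  obtain ⟨N, ψ, hψ⟩ := exists_perm_ne_one hne
  have : Finite (FreeGroup (Fin r) →* Equiv.Perm (Fin N)) :=
    Finite.of_equiv _ (FreeGroup.lift (α := Fin r) (β := Equiv.Perm (Fin N)))
  have hinj : Function.Injective fun θ : FreeGroup (Fin r) →* Equiv.Perm (Fin N) => θ.comp φ :=
    fun θ θ' h => (MonoidHom.cancel_right hφ).1 h
  obtain ⟨θ, hθ⟩ := Finite.surjective_of_injective hinj ψ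
  apply hψ
  rw [← hθ]
  simp [hx]

end FreeGroup

/-! ### The rank problem and the basis problem -/

namespace PCPInstance

open FreeGroup Transducer

variable (I : PCPInstance)

theorem mem_equaliser {x : FreeGroup (Fin I.src)} : x ∈ I.equaliser ↔ I.g x = I.h x := Iff.rfl

/-- The permutations `u ↦ g(a) u h(a)⁻¹`. -/
def twist (a : Fin I.src) : Equiv.Perm (FreeGroup (Fin I.tgt)) :=
  (Equiv.mulLeft (I.g (of a))).trans (Equiv.mulRight (I.h (of a))⁻¹)

theorem lift_twist (x : FreeGroup (Fin I.src)) :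
    ∀ u, FreeGroup.lift I.twist x u = I.g x * u * (I.h x)⁻¹ := by
  induction x using FreeGroup.induction_on with
  | C1 => simp
  | of a => intro u; simp [twist]
  | inv_of a _ =>
    intro u
    rw [_root_.map_inv, Equiv.Perm.inv_eq_iff_eq]
    simp [twist, mul_assoc]
  | mul x y ihx ihy =>
    intro u
    simp only [_root_.map_mul, Equiv.Perm.mul_apply, ihy, ihx, mul_inv_rev, mul_assoc]

theorem mem_equaliser_iff_twist {x : FreeGroup (Fin I.src)} :
    x ∈ I.equaliser ↔ FreeGroup.lift I.twist x 1 = 1 := by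
  rw [mem_equaliser, lift_twist, mul_one, mul_inv_eq_one]

/-- The permutations `twist` on words. -/
def twistWord (p : ℕ × Bool) (u : Word) : Word :=
  Word.red I.tgt (Word.subst I.src I.2.1 [p] ++ u ++ invRev (Word.subst I.src I.2.2 [p]))

theorem twistWord_canon (p : ℕ × Bool) (u : FreeGroup (Fin I.tgt)) :
    I.twistWord p (Word.canon u) = Word.canon
      (I.g (Word.toFree I.src [p]) * u * (I.h (Word.toFree I.src [p]))⁻¹) := by
  rw [twistWord, ← Word.canon_toFree]
  simp [Word.toFree_subst, g, h, mul_assoc]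

theorem twistWord_true (a : Fin I.src) (u : FreeGroup (Fin I.tgt)) :
    I.twistWord (a, true) (Word.canon u) = Word.canon (I.twist a u) := by
  rw [twistWord_canon, Word.toFree_singleton_true]
  rfl

theorem twistWord_false (a : Fin I.src) (u : FreeGroup (Fin I.tgt)) :
    I.twistWord (a, false) (Word.canon u) = Word.canon ((I.twist a).symm u) := by
  rw [twistWord_canon, Word.toFree_singleton_false]
  congr 1
  rw [Equiv.eq_symm_apply]
  simp [twist, mul_assoc]

/-- The computation of a list of words, and of a list of labels that witnesses that these words
form a basis of a retract of the equaliser. -/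
def runTwist (Λ : List ((ℕ × Word) × Word)) (w : Word) : Word × Word :=
  run I.src I.twistWord (labelOf Λ) w ([], [])

/-- A certificate for a basis with `r` elements of the equaliser of rank `r`. -/
def IsRetractCertificate (r : ℕ) (c : List Word × List ((ℕ × Word) × Word)) : Prop :=
  c.1.length = r ∧ ∀ j < r, (I.runTwist c.2 (c.1.getD j [])).1 = [] ∧
    Word.red r (I.runTwist c.2 (c.1.getD j [])).2 = [(j, true)]

theorem canon_one (k : ℕ) : Word.canon (1 : FreeGroup (Fin k)) = [] := by
  simp [Word.canon]

theorem canon_of {k : ℕ} (j : Fin k) : Word.canon (of j) = [((j : ℕ), true)] := by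
  simp [Word.canon]

theorem runTwist_spec (r : ℕ) (Λ : List ((ℕ × Word) × Word)) (w : Word) :
    let q := act I.twist (fun a u => Word.toFree r (labelOf Λ a (Word.canon u)))
      (Word.toFree I.src w) (1, 1)
    (I.runTwist Λ w).1 = Word.canon q.1 ∧ Word.toFree r (I.runTwist Λ w).2 = q.2 := by
  have := run_spec (σ := I.twist) (enc := Word.canon) (lab := labelOf Λ)
    (l := fun a u => Word.toFree r (labelOf Λ a (Word.canon u))) I.twistWord_true I.twistWord_false
    (fun _ _ => rfl) w 1 []
  rw [canon_one] at this
  exact this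

/-- The labels define `ρ` on the equaliser, and the checks say that it sends the listed words to the
free generators. Composed with the isomorphism from `b₀` it is a surjective endomorphism of `F_r`,
so `ρ` is an isomorphism and the words are the preimages of the generators. The given basis `b₀`
enters only through its size. -/
theorem IsRetractCertificate.isBasisList {r : ℕ} {c : List Word × List ((ℕ × Word) × Word)}
    (hc : I.IsRetractCertificate r c) (b₀ : FreeGroupBasis (Fin r) I.equaliser) :
    IsBasisList I.equaliser c.1 := by
  obtain ⟨B, Λ⟩ := c
  obtain ⟨rfl, hB⟩ := hc
  simp only at hB b₀ ⊢
  set l : Fin I.src → FreeGroup (Fin I.tgt) → FreeGroup (Fin B.length) :=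
    fun a u => Word.toFree B.length (labelOf Λ a (Word.canon u)) with hl
  have hH : ∀ x ∈ I.equaliser, FreeGroup.lift I.twist x 1 = 1 := fun x hx =>
    I.mem_equaliser_iff_twist.1 hx
  let ρ : I.equaliser →* FreeGroup (Fin B.length) := output I.twist l 1 I.equaliser hH
  have hact : ∀ j : Fin B.length,
      act I.twist l (Word.toFree I.src (B.get j)) (1, 1) = (1, of j) := by
    intro j
    obtain ⟨h1, h2⟩ := hB j j.2
    obtain ⟨h3, h4⟩ := I.runTwist_spec B.length Λ (B.getD j [])
    have hj : B.getD j [] = B.get j := by simp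
    rw [hj] at h1 h2 h3 h4
    rw [h1, ← canon_one] at h3
    rw [← Word.canon_toFree, h4, ← canon_of] at h2
    exact Prod.ext (Word.canon_injective h3).symm (Word.canon_injective h2)
  have hmem : ∀ j : Fin B.length, Word.toFree I.src (B.get j) ∈ I.equaliser := by
    intro j
    rw [mem_equaliser_iff_twist, ← act_fst I.twist l _ (1, 1), hact]
  have hρ : ∀ j : Fin B.length, ρ ⟨_, hmem j⟩ = of j := fun j => by
    change (act I.twist l (Word.toFree I.src (B.get j)) (1, 1)).2 = of j
    rw [hact]
  have hsurj : Function.Surjective ρ := by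
    rw [← MonoidHom.range_eq_top, eq_top_iff, ← closure_range_of, Subgroup.closure_le]
    rintro _ ⟨j, rfl⟩
    exact ⟨_, hρ j⟩
  have hinj : Function.Injective ρ := by
    have h1 := injective_of_surjective (ρ.comp b₀.repr.symm.toMonoidHom)
      (hsurj.comp b₀.repr.symm.surjective)
    intro x y hxy
    have := @h1 (b₀.repr x) (b₀.repr y) (by simpa using hxy)
    exact b₀.repr.injective this
  let e := MulEquiv.ofBijective ρ ⟨hinj, hsurj⟩
  refine ⟨FreeGroupBasis.ofRepr e, fun i => ?_⟩
  have : (FreeGroupBasis.ofRepr e) i = (⟨_, hmem i⟩ : I.equaliser) :=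
    e.symm_apply_eq.2 (hρ i).symm
  rw [this]

/-- The coordinate isomorphism of `b₀` is labelled by `exists_labels`, and the labels are kept on
the finitely many edges that the basis words traverse. -/
theorem exists_isRetractCertificate {r : ℕ} (b₀ : FreeGroupBasis (Fin r) I.equaliser) :
    ∃ c, I.IsRetractCertificate r c := by
  classical
  let B : List Word := List.ofFn fun j => Word.canon (b₀ j : FreeGroup (Fin I.src))
  obtain ⟨l, hl⟩ := exists_labels I.twist 1 I.equaliser (fun x => I.mem_equaliser_iff_twist)
    b₀.repr.toMonoidHom
  choose V hV using fun w : List (Fin I.src × Bool) =>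
    exists_finite_support (S' := FreeGroup (Fin I.tgt)) I.twist l w 1 1
  obtain ⟨Λ, -, hΛ⟩ := exists_labelOf Word.canon_injective l
    (List.ofFn fun j : Fin r => V (b₀ j : FreeGroup (Fin I.src)).toWord).flatten
  refine ⟨(B, Λ), by simp [B], fun j hj => ?_⟩
  have hBj : B.getD j [] = Word.canon (b₀ ⟨j, hj⟩ : FreeGroup (Fin I.src)) := by
    simp [B, hj]
  obtain ⟨h1, h2⟩ := I.runTwist_spec r Λ (B.getD j [])
  have hact := hV (b₀ ⟨j, hj⟩ : FreeGroup (Fin I.src)).toWord id I.twist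
    (fun a u => Word.toFree r (labelOf Λ a (Word.canon u))) (fun p hp => ⟨rfl, hΛ p
      (List.mem_flatten.2 ⟨_, (List.mem_ofFn' _ _).2 ⟨⟨j, hj⟩, rfl⟩, hp⟩)⟩)
  rw [mk_toWord, hl] at hact
  simp only [hBj, Word.toFree_canon] at h1 h2 ⊢
  simp only [id] at hact
  rw [hact] at h1 h2
  refine ⟨h1.trans (canon_one _), ?_⟩
  rw [← Word.canon_toFree, h2, ← canon_of ⟨j, hj⟩]
  exact congrArg Word.canon (b₀.repr_apply_coe _)

section

variable {α : Type} [Primcodable α] {I : α → PCPInstance}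

theorem primrec_twistWord {p : α → ℕ × Bool} {u : α → Word} (hI : Primrec I) (hp : Primrec p)
    (hu : Primrec u) : Primrec fun x => (I x).twistWord (p x) (u x) := by
  have hn : Primrec fun x => (I x).src := Primrec.fst.comp (Primrec.fst.comp hI)
  have hm : Primrec fun x => (I x).tgt := Primrec.snd.comp (Primrec.fst.comp hI)
  have hg : Primrec fun x => (I x).2.1 := Primrec.fst.comp (Primrec.snd.comp hI)
  have hh : Primrec fun x => (I x).2.2 := Primrec.snd.comp (Primrec.snd.comp hI)
  have hp' : Primrec fun x => [p x] := Primrec.list_cons.comp hp (Primrec.const [])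
  exact Word.primrec_red.comp hm (Primrec.list_append.comp (Primrec.list_append.comp
    (Word.primrec_subst hn hg hp') hu) (Word.primrec_invRev.comp (Word.primrec_subst hn hh hp')))

theorem primrec_runTwist {Λ : α → List ((ℕ × Word) × Word)} {w : α → Word} (hI : Primrec I)
    (hΛ : Primrec Λ) (hw : Primrec w) : Primrec fun x => (I x).runTwist (Λ x) (w x) :=
  primrec_run (sp := fun x => (I x).twistWord) (lab := fun x => labelOf (Λ x))
    (Primrec.fst.comp (Primrec.fst.comp hI))
    (primrec_twistWord (hI.comp Primrec.fst) (Primrec.fst.comp Primrec.snd)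
      (Primrec.snd.comp Primrec.snd))
    (primrec_labelOf (hΛ.comp Primrec.fst) (Primrec.fst.comp Primrec.snd)
      (Primrec.snd.comp Primrec.snd)) hw (Primrec.const _)

end

theorem primrec_isRetractCertificate :
    PrimrecRel fun (a : PCPInstance × ℕ) (c : List Word × List ((ℕ × Word) × Word)) =>
      a.1.IsRetractCertificate a.2 c := by
  have hrun : Primrec fun x : ((PCPInstance × ℕ) × List Word × List ((ℕ × Word) × Word)) × ℕ =>
      x.1.1.1.runTwist x.1.2.2 (x.1.2.1.getD x.2 []) := by
    have hc : Primrec fun x : ((PCPInstance × ℕ) × List Word × List ((ℕ × Word) × Word)) × ℕ =>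
        x.1.2 := Primrec.snd.comp Primrec.fst
    exact primrec_runTwist (Primrec.fst.comp (Primrec.fst.comp Primrec.fst))
      (Primrec.snd.comp hc) (Word.primrec_getD (Primrec.fst.comp hc) Primrec.snd)
  refine PrimrecPred.and ?_ (PrimrecPred.ball_lt (Primrec.snd.comp Primrec.fst)
    (PrimrecPred.and ?_ ?_))
  · exact PrimrecPred.eq_comp (Primrec.list_length.comp (Primrec.fst.comp Primrec.snd))
      (Primrec.snd.comp Primrec.fst)
  · exact PrimrecPred.eq_comp (Primrec.fst.comp hrun) (Primrec.const [])
  · exact PrimrecPred.eq_comp (Word.primrec_red.comp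
      (Primrec.snd.comp (Primrec.fst.comp Primrec.fst)) (Primrec.snd.comp hrun))
      (Primrec.list_cons.comp (Primrec.snd.pair (Primrec.const true)) (Primrec.const []))

end PCPInstance

theorem BP.rp {S : Set (ℕ × ℕ)} (hS : BP S) : RP S :=
  Solvable.bind hS (Solvable.of_computable (dom := fun _ => True)
    (ans := fun x r => r = x.2.length) (f := fun x : PCPInstance × List Word => x.2.length)
    (Primrec.list_length.comp Primrec.snd).to_comp fun _ _ => rfl)
    fun _ _ _ ⟨b, _⟩ => ⟨trivial, by rintro _ rfl; exact ⟨b⟩⟩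

theorem RP.bp {S : Set (ℕ × ℕ)} (hS : RP S) : BP S :=
  Solvable.bind hS (Solvable.search
    (dom := fun a : PCPInstance × ℕ => Nonempty (FreeGroupBasis (Fin a.2) a.1.equaliser))
    (ans := fun a B => IsBasisList a.1.equaliser B)
    PCPInstance.primrec_isRetractCertificate
    (out := fun _ c => c.1) (Primrec.fst.comp Primrec.snd) fun a ⟨b⟩ =>
      ⟨a.1.exists_isRetractCertificate b, fun _ hc => hc.isBasisList a.1 b⟩)
    fun _ _ _ hr => ⟨hr, fun _ hB => hB⟩

/-! ### Certificates for the injectivity of a homomorphism -/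

namespace Transducer

open FreeGroup

/-- The value of `swapProd s`, computed on words. -/
def swapApply (s : List (Word × Word)) (u : Word) : Word :=
  s.foldr (fun e v => if v = e.1 then e.2 else if v = e.2 then e.1 else v) u

theorem swapApply_eq (s : List (Word × Word)) (u : Word) : swapApply s u = swapProd s u := by
  induction s with
  | nil => rfl
  | cons e s ih =>
    have h : swapApply (e :: s) u = Equiv.swap e.1 e.2 (swapApply s u) := by
      rw [Equiv.swap_apply_def]; rfl
    rw [h, ih]
    simp [swapProd]

theorem swapApply_reverse (s : List (Word × Word)) (u : Word) :
    swapApply s.reverse u = (swapProd s).symm u := by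
  rw [swapApply_eq]
  have : swapProd s.reverse = (swapProd s)⁻¹ := by
    simp [swapProd, List.prod_inv_reverse, List.map_reverse, Function.comp_def]
  rw [this]; rfl

/-- The permutations of words given by a list of lists of transpositions. -/
def swapWord (s : List (List (Word × Word))) (p : ℕ × Bool) (u : Word) : Word :=
  if p.2 = true then swapApply (s.getD p.1 []) u else swapApply (s.getD p.1 []).reverse u

/-- A list of transpositions for each letter, a list of labels and an initial state. -/
abbrev SwapTransducer := List (List (Word × Word)) × List ((ℕ × Word) × Word) × Word

/-- The computation of a transducer whose permutations are given by transpositions. -/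
def runSwap (m : ℕ) (c : SwapTransducer) (w : Word) : Word × Word :=
  run m (swapWord c.1) (labelOf c.2.1) w (c.2.2, [])

/-- The transducer computes a left inverse of a homomorphism. -/
def IsInjCertificate (n m : ℕ) (L : List Word) (c : SwapTransducer) : Prop :=
  ∀ j < n, (runSwap m c (L.getD j [])).1 = c.2.2 ∧
    Word.red n (runSwap m c (L.getD j [])).2 = [(j, true)]

theorem runSwap_spec (n m : ℕ) (c : SwapTransducer) (w : Word) :
    act (fun a : Fin m => swapProd (c.1.getD a []))
      (fun a u => Word.toFree n (labelOf c.2.1 a u)) (Word.toFree m w) (c.2.2, 1) =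
      ((runSwap m c w).1, Word.toFree n (runSwap m c w).2) := by
  have := run_spec (k := m) (σ := fun a : Fin m => swapProd (c.1.getD a [])) (enc := id)
    (sp := swapWord c.1) (lab := labelOf c.2.1)
    (l := fun a u => Word.toFree n (labelOf c.2.1 a u)) (fun a s => by simp [swapWord, swapApply_eq])
    (fun a s => by simp [swapWord, swapApply_reverse]) (fun _ _ => rfl) w c.2.2 []
  exact Prod.ext this.1.symm this.2.symm

theorem homOfWords_of {n m : ℕ} (L : List Word) (i : Fin n) :
    homOfWords n m L (of i) = Word.toFree m (L.getD i []) := by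
  simp [homOfWords]

/-- Whatever the permutations are, the images of the generators fix the initial state and output the
generators. Hence `f(x)` outputs `x`, which recovers `x` from `f(x)`. -/
theorem IsInjCertificate.injective {n m : ℕ} {L : List Word} {c : SwapTransducer}
    (hc : IsInjCertificate n m L c) : Function.Injective (homOfWords n m L) := by
  set σ : Fin m → Equiv.Perm Word := fun a => swapProd (c.1.getD a []) with hσ
  set l : Fin m → Word → FreeGroup (Fin n) := fun a u => Word.toFree n (labelOf c.2.1 a u) with hl
  have key : ∀ x : FreeGroup (Fin n),
      act σ l (homOfWords n m L x) (c.2.2, 1) = (c.2.2, x) := by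
    intro x
    induction x using FreeGroup.induction_on with
    | C1 => simp
    | of i =>
      obtain ⟨h1, h2⟩ := hc i i.2
      rw [homOfWords_of, runSwap_spec, h1]
      rw [← Word.canon_toFree, ← PCPInstance.canon_of] at h2
      rw [Word.canon_injective h2]
    | inv_of i ih =>
      rw [_root_.map_inv, _root_.map_inv, Equiv.Perm.inv_eq_iff_eq]
      have h2 := act_mul_right σ l (homOfWords n m L (of i)) c.2.2 (of i)⁻¹ 1
      rw [one_mul, ih] at h2
      rw [h2]
      simp
    | mul x y ihx ihy =>
      rw [_root_.map_mul, _root_.map_mul, Equiv.Perm.mul_apply, ihy]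
      have := act_mul_right σ l (homOfWords n m L x) c.2.2 y 1
      rw [one_mul, ihx] at this
      exact this
  refine (injective_iff_map_eq_one _).2 fun x hx => ?_
  have := key x
  rw [hx] at this
  simpa using (congrArg Prod.snd this).symm

/-- The range of the map is the stabiliser of the base coset, and the inverse of the map on its
range is labelled by `exists_labels`. -/
theorem exists_isInjCertificate {n m : ℕ} {L : List Word}
    (hL : Function.Injective (homOfWords n m L)) : ∃ c, IsInjCertificate n m L c := by
  classical
  let f := homOfWords n m L
  let σ : Fin m → Equiv.Perm (FreeGroup (Fin m) ⧸ f.range) := fun a => MulAction.toPerm (of a)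
  have hlift : ∀ x, FreeGroup.lift σ x = MulAction.toPermHom _ _ x := by
    intro x
    congr 1
    ext a : 1
    rw [lift_apply_of]; rfl
  let s₀ : FreeGroup (Fin m) ⧸ f.range := ((1 : FreeGroup (Fin m)) : FreeGroup (Fin m) ⧸ f.range)
  have hstab : ∀ x, x ∈ f.range ↔ FreeGroup.lift σ x s₀ = s₀ := by
    intro x
    rw [hlift]
    change _ ↔ ((x * 1 : FreeGroup (Fin m)) : FreeGroup (Fin m) ⧸ f.range) = _
    rw [mul_one, eq_comm, QuotientGroup.eq]
    simp
  let e : FreeGroup (Fin n) ≃* f.range := MonoidHom.ofInjective hL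
  obtain ⟨l, hl⟩ := exists_labels σ s₀ f.range hstab e.symm.toMonoidHom
  choose V hV using fun w : List (Fin m × Bool) => exists_finite_support (S' := Word) σ l w s₀ 1
  -- Cosets are coded by arbitrary representatives; the code need not be computable, since only
  -- finitely many values enter the certificate.
  let enc : FreeGroup (Fin m) ⧸ f.range → Word := fun s => Word.canon s.out
  have henc : Function.Injective enc := fun s t h => Quotient.out_injective (Word.canon_injective h)
  let W := (List.ofFn fun j : Fin n => V (f (of j)).toWord).flatten
  obtain ⟨Λ, -, hΛ⟩ := exists_labelOf henc l W
  -- The coset action is replaced by finite products of transpositions that agree with it on the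
  -- edges in use.
  have hsw : ∀ a : Fin m, ∃ s : List (Word × Word),
      ∀ p ∈ W, p.1 = a → swapProd s (enc p.2) = enc (σ p.1 p.2) := by
    intro a
    obtain ⟨s, hs⟩ := exists_swapProd ((W.filter fun p => p.1 = a).map fun p =>
      (enc p.2, enc (σ p.1 p.2))) (by
        simp only [List.mem_map, List.mem_filter, decide_eq_true_eq]
        rintro _ ⟨p, ⟨-, hp⟩, rfl⟩ _ ⟨q, ⟨-, hq⟩, rfl⟩
        rw [hp, hq]
        simp [henc.eq_iff])
    refine ⟨s, fun p hp hpa => hs _ (List.mem_map.2 ⟨p, List.mem_filter.2 ⟨hp, by simpa⟩, rfl⟩)⟩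
  choose s hs using hsw
  have hget : ∀ a : Fin m, (List.ofFn s).getD a [] = s a := fun a => by simp
  refine ⟨(List.ofFn s, Λ, enc s₀), fun j hj => ?_⟩
  have hrun := runSwap_spec n m (List.ofFn s, Λ, enc s₀) (L.getD j [])
  have hact := hV (f (of ⟨j, hj⟩)).toWord enc (fun a : Fin m => swapProd ((List.ofFn s).getD a []))
    (fun a u => Word.toFree n (labelOf Λ a u)) (fun p hp => by
      have hp' : p ∈ W := List.mem_flatten.2 ⟨_, (List.mem_ofFn' _ _).2 ⟨⟨j, hj⟩, rfl⟩, hp⟩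
      simp only [hget]
      exact ⟨hs _ p hp' rfl, hΛ p hp'⟩)
  have hout := hl ⟨f (of ⟨j, hj⟩), _, rfl⟩
  have hsymm : e.symm.toMonoidHom ⟨f (of ⟨j, hj⟩), _, rfl⟩ = of ⟨j, hj⟩ :=
    e.symm_apply_eq.2 rfl
  rw [hsymm] at hout
  simp only at hout
  rw [mk_toWord, hout, homOfWords_of, hrun] at hact
  simp only [Prod.mk.injEq] at hact
  refine ⟨hact.1, ?_⟩
  rw [← Word.canon_toFree, hact.2, PCPInstance.canon_of]

section

variable {α : Type} [Primcodable α]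

theorem primrec_swapApply : Primrec₂ swapApply := by
  have he : Primrec fun x : (List (Word × Word) × Word) × (Word × Word) × Word => x.2.1 :=
    Primrec.fst.comp Primrec.snd
  have hv : Primrec fun x : (List (Word × Word) × Word) × (Word × Word) × Word => x.2.2 :=
    Primrec.snd.comp Primrec.snd
  refine Primrec.list_foldr (f := fun x : List (Word × Word) × Word => x.1) (g := fun x => x.2)
    (h := fun _ y => if y.2 = y.1.1 then y.1.2 else if y.2 = y.1.2 then y.1.1 else y.2)
    Primrec.fst Primrec.snd (Primrec.ite ?_ (Primrec.snd.comp he) (Primrec.ite ?_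
      (Primrec.fst.comp he) hv))
  · exact PrimrecPred.eq_comp hv (Primrec.fst.comp he)
  · exact PrimrecPred.eq_comp hv (Primrec.snd.comp he)

theorem primrec_swapWord {s : α → List (List (Word × Word))} {p : α → ℕ × Bool} {u : α → Word}
    (hs : Primrec s) (hp : Primrec p) (hu : Primrec u) :
    Primrec fun x => swapWord (s x) (p x) (u x) := by
  have hget : Primrec fun x => (s x).getD (p x).1 [] :=
    (Primrec.list_getD ([] : List (Word × Word))).comp hs (Primrec.fst.comp hp)
  exact Primrec.ite (PrimrecPred.eq_comp (Primrec.snd.comp hp) (Primrec.const true))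
    (primrec_swapApply.comp hget hu) (primrec_swapApply.comp (Primrec.list_reverse.comp hget) hu)

theorem primrec_runSwap {m : α → ℕ} {c : α → SwapTransducer} {w : α → Word} (hm : Primrec m)
    (hc : Primrec c) (hw : Primrec w) : Primrec fun x => runSwap (m x) (c x) (w x) :=
  primrec_run (sp := fun x => swapWord (c x).1) (lab := fun x => labelOf (c x).2.1) hm
    (primrec_swapWord (Primrec.fst.comp (hc.comp Primrec.fst)) (Primrec.fst.comp Primrec.snd)
      (Primrec.snd.comp Primrec.snd))
    (primrec_labelOf (Primrec.fst.comp (Primrec.snd.comp (hc.comp Primrec.fst)))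
      (Primrec.fst.comp Primrec.snd) (Primrec.snd.comp Primrec.snd)) hw
    ((Primrec.snd.comp (Primrec.snd.comp hc)).pair (Primrec.const []))

theorem primrec_isInjCertificate {n m : α → ℕ} {L : α → List Word} {c : α → SwapTransducer}
    (hn : Primrec n) (hm : Primrec m) (hL : Primrec L) (hc : Primrec c) :
    PrimrecPred fun x => IsInjCertificate (n x) (m x) (L x) (c x) := by
  have hrun : Primrec fun y : α × ℕ => runSwap (m y.1) (c y.1) ((L y.1).getD y.2 []) :=
    primrec_runSwap (hm.comp Primrec.fst) (hc.comp Primrec.fst)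
      (Word.primrec_getD (hL.comp Primrec.fst) Primrec.snd)
  refine PrimrecPred.ball_lt hn (PrimrecPred.and ?_ ?_)
  · exact PrimrecPred.eq_comp (Primrec.fst.comp hrun)
      (Primrec.snd.comp (Primrec.snd.comp (hc.comp Primrec.fst)))
  · exact PrimrecPred.eq_comp (Word.primrec_red.comp (hn.comp Primrec.fst) (Primrec.snd.comp hrun))
      (Primrec.list_cons.comp (Primrec.snd.pair (Primrec.const true)) (Primrec.const []))

end

end Transducer

/-! ### The generalised problem and the Post correspondence problem -/

namespace FreeGroup

open scoped commutatorElement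

/-- Commuting elements generate an abelian subgroup, which is free by Nielsen–Schreier, hence has at
most one free generator and is cyclic. -/
theorem exists_ne_one_mem_of_commute {α : Type} {x y : FreeGroup α} (hx : x ≠ 1) (hy : y ≠ 1)
    (hxy : Commute x y) : ∃ z ≠ 1, z ∈ Subgroup.zpowers x ∧ z ∈ Subgroup.zpowers y := by
  let H := Subgroup.closure {x, y}
  have hcomm : ∀ a ∈ H, ∀ b ∈ H, a * b = b * a := by
    have := Subgroup.closure_le_centralizer_centralizer ({x, y} : Set (FreeGroup α))
    intro a ha b hb
    have hle : H ≤ Subgroup.centralizer (H : Set (FreeGroup α)) := by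
      rw [Subgroup.centralizer_closure, Subgroup.closure_le]
      rintro u hu
      rw [SetLike.mem_coe, Subgroup.mem_centralizer_iff]
      rintro v hv
      rcases hu with rfl | rfl <;> rcases hv with rfl | rfl
      exacts [rfl, hxy.eq.symm, hxy.eq, rfl]
    exact ((Subgroup.mem_centralizer_iff.1 (hle ha)) b hb).symm
  have hsub : Subsingleton (IsFreeGroup.Generators H) := by
    refine ⟨fun i j => ?_⟩
    have h : ∀ u v : H, u * v = v * u := fun u v => Subtype.ext (hcomm _ u.2 _ v.2)
    classical
    have h' : (of i : FreeGroup (IsFreeGroup.Generators H)) * of j = of j * of i := by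
      apply (IsFreeGroup.mulEquiv H).injective
      rw [_root_.map_mul, _root_.map_mul, h]
    by_contra hij
    have := congrArg toWord h'
    simp [of, mul_mk, toWord_mk, reduce.cons, hij, Ne.symm hij] at this
  have hcyc : ∃ t : H, ∀ u : H, u ∈ Subgroup.zpowers t := by
    rcases isEmpty_or_nonempty (IsFreeGroup.Generators H) with he | ⟨⟨i⟩⟩
    · refine ⟨1, fun u => ?_⟩
      have : Subsingleton H := (IsFreeGroup.mulEquiv H).symm.toEquiv.subsingleton
      rw [Subsingleton.elim u 1]
      exact Subgroup.one_mem _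
    · have : Unique (IsFreeGroup.Generators H) := ⟨⟨i⟩, fun _ => Subsingleton.elim _ _⟩
      have : IsCyclic H := isCyclic_of_surjective (IsFreeGroup.mulEquiv H)
        (IsFreeGroup.mulEquiv H).surjective
      exact IsCyclic.exists_generator
  obtain ⟨t, ht⟩ := hcyc
  obtain ⟨a, ha⟩ := ht ⟨x, Subgroup.subset_closure (by simp)⟩
  obtain ⟨b, hb⟩ := ht ⟨y, Subgroup.subset_closure (by simp)⟩
  have ha' : (t : FreeGroup α) ^ a = x := congrArg Subtype.val ha
  have hb' : (t : FreeGroup α) ^ b = y := congrArg Subtype.val hb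
  have hb0 : b ≠ 0 := by rintro rfl; exact hy (by rw [← hb', zpow_zero])
  -- With `x = t ^ a` and `y = t ^ b`, the common element is `x ^ b = y ^ a`; it is nontrivial
  -- because there is no torsion.
  refine ⟨x ^ b, fun h => hx ((IsMulTorsionFree.zpow_eq_one_iff_left hb0).1 h), ⟨b, rfl⟩, ⟨a, ?_⟩⟩
  change y ^ a = x ^ b
  rw [← ha', ← hb', ← zpow_mul, ← zpow_mul, mul_comm]

/-- The commutator of elements of two normal subgroups lies in both; if it is trivial, the two
elements have a common nontrivial power. -/
theorem exists_ne_one_mem_inf_of_normal {α : Type} (K₁ K₂ : Subgroup (FreeGroup α)) [K₁.Normal]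
    [K₂.Normal] (h₁ : ∃ x ∈ K₁, x ≠ 1) (h₂ : ∃ x ∈ K₂, x ≠ 1) : ∃ x ≠ 1, x ∈ K₁ ∧ x ∈ K₂ := by
  obtain ⟨x, hx, hx1⟩ := h₁
  obtain ⟨y, hy, hy1⟩ := h₂
  by_cases hxy : Commute x y
  · obtain ⟨z, hz, hzx, hzy⟩ := exists_ne_one_mem_of_commute hx1 hy1 hxy
    exact ⟨z, hz, (Subgroup.zpowers_le.2 hx) hzx, (Subgroup.zpowers_le.2 hy) hzy⟩
  · refine ⟨⁅x, y⁆, fun h => hxy (commutatorElement_eq_one_iff_commute.1 h), ?_, ?_⟩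
    · exact Subgroup.commutator_le_left K₁ K₂ (Subgroup.commutator_mem_commutator hx hy)
    · exact Subgroup.commutator_le_right K₁ K₂ (Subgroup.commutator_mem_commutator hx hy)

end FreeGroup

namespace PCPInstance

open Transducer

theorem exists_solution_of_not_isInj {I : PCPInstance} (hI : ¬ I.IsInj) :
    ∃ x : FreeGroup (Fin I.src), x ≠ 1 ∧ I.g x = I.h x := by
  rw [IsInj, not_or, injective_iff_map_eq_one, injective_iff_map_eq_one] at hI
  simp only [not_forall] at hI
  obtain ⟨⟨x, hx, hx1⟩, y, hy, hy1⟩ := hI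
  obtain ⟨z, hz, h1, h2⟩ := FreeGroup.exists_ne_one_mem_inf_of_normal I.g.ker I.h.ker
    ⟨x, hx, hx1⟩ ⟨y, hy, hy1⟩
  exact ⟨z, hz, by rw [MonoidHom.mem_ker.1 h1, MonoidHom.mem_ker.1 h2]⟩

/-- The word represents a nontrivial element of the equaliser. -/
def IsSolution (I : PCPInstance) (w : Word) : Prop :=
  Word.red I.src w ≠ [] ∧
    Word.red I.tgt (Word.subst I.src I.2.1 w) = Word.red I.tgt (Word.subst I.src I.2.2 w)

theorem red_eq_nil_iff {k : ℕ} {w : Word} : Word.red k w = [] ↔ Word.toFree k w = 1 := by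
  rw [← Word.canon_toFree, ← canon_one k]
  exact Word.canon_injective.eq_iff

theorem isSolution_iff {I : PCPInstance} {w : Word} : I.IsSolution w ↔
    Word.toFree I.src w ≠ 1 ∧ I.g (Word.toFree I.src w) = I.h (Word.toFree I.src w) := by
  rw [IsSolution, Ne, red_eq_nil_iff, Word.red_eq_iff, Word.toFree_subst, Word.toFree_subst]
  rfl

theorem primrec_isSolution : PrimrecRel IsSolution := by
  have hn : Primrec fun x : PCPInstance × Word => x.1.src :=
    Primrec.fst.comp (Primrec.fst.comp Primrec.fst)
  have hm : Primrec fun x : PCPInstance × Word => x.1.tgt :=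
    Primrec.snd.comp (Primrec.fst.comp Primrec.fst)
  have hL := Primrec.snd.comp (Primrec.fst (α := PCPInstance) (β := Word))
  refine PrimrecPred.and (PrimrecPred.not ?_) ?_
  · exact PrimrecPred.eq_comp (Word.primrec_red.comp hn Primrec.snd) (Primrec.const [])
  · exact PrimrecPred.eq_comp
      (Word.primrec_red.comp hm (Word.primrec_subst hn (Primrec.fst.comp hL) Primrec.snd))
      (Word.primrec_red.comp hm (Word.primrec_subst hn (Primrec.snd.comp hL) Primrec.snd))

/-- Find a solution or a proof that one of the maps is injective. -/
theorem solvable_solution_or_isInj : Solvable (α := PCPInstance) (β := Bool) (fun _ => True)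
    fun I b => (b = true → ∃ x : FreeGroup (Fin I.src), x ≠ 1 ∧ I.g x = I.h x) ∧
      (b = false → I.IsInj) := by
  have hout : Primrec₂ fun (_ : PCPInstance) (c : ℕ × Word × SwapTransducer) => c.1 == 0 :=
    Primrec.beq.comp (Primrec.fst.comp Primrec.snd) (Primrec.const 0)
  refine Solvable.search (γ := ℕ × Word × SwapTransducer)
    -- The tag says what is certified: `0` a solution, `1` injectivity of `g`, `2` injectivity of
    -- `h`.
    (check := fun I c => (c.1 = 0 ∧ I.IsSolution c.2.1) ∨
      (c.1 = 1 ∧ IsInjCertificate I.src I.tgt I.2.1 c.2.2) ∨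
      (c.1 = 2 ∧ IsInjCertificate I.src I.tgt I.2.2 c.2.2)) ?_ hout ?_
  · have ht : Primrec fun x : PCPInstance × ℕ × Word × SwapTransducer => x.2.1 :=
      Primrec.fst.comp Primrec.snd
    have hc : Primrec fun x : PCPInstance × ℕ × Word × SwapTransducer => x.2.2.2 :=
      Primrec.snd.comp (Primrec.snd.comp Primrec.snd)
    have hn : Primrec fun x : PCPInstance × ℕ × Word × SwapTransducer => x.1.src :=
      Primrec.fst.comp (Primrec.fst.comp Primrec.fst)
    have hm : Primrec fun x : PCPInstance × ℕ × Word × SwapTransducer => x.1.tgt :=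
      Primrec.snd.comp (Primrec.fst.comp Primrec.fst)
    have hL : Primrec fun x : PCPInstance × ℕ × Word × SwapTransducer => x.1.2 :=
      Primrec.snd.comp Primrec.fst
    refine PrimrecPred.or (PrimrecPred.and ?_ ?_) (PrimrecPred.or (PrimrecPred.and ?_ ?_)
      (PrimrecPred.and ?_ ?_))
    · exact PrimrecPred.eq_comp ht (Primrec.const 0)
    · exact primrec_isSolution.comp Primrec.fst (Primrec.fst.comp (Primrec.snd.comp Primrec.snd))
    · exact PrimrecPred.eq_comp ht (Primrec.const 1)
    · exact primrec_isInjCertificate hn hm (Primrec.fst.comp hL) hc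
    · exact PrimrecPred.eq_comp ht (Primrec.const 2)
    · exact primrec_isInjCertificate hn hm (Primrec.snd.comp hL) hc
  · intro I _
    constructor
    · by_cases hI : I.IsInj
      · rcases hI with hI | hI
        · obtain ⟨c, hc⟩ := exists_isInjCertificate hI
          exact ⟨(1, [], c), Or.inr (Or.inl ⟨rfl, hc⟩)⟩
        · obtain ⟨c, hc⟩ := exists_isInjCertificate hI
          exact ⟨(2, [], c), Or.inr (Or.inr ⟨rfl, hc⟩)⟩
      · obtain ⟨x, hx⟩ := exists_solution_of_not_isInj hI
        obtain ⟨w, rfl⟩ := Word.toFree_surjective _ x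
        exact ⟨(0, w, [], [], []), Or.inl ⟨rfl, isSolution_iff.2 hx⟩⟩
    · rintro ⟨t, w, c⟩ (⟨h1, h2⟩ | ⟨h1, h2⟩ | ⟨h1, h2⟩)
      · simp only at h1 h2
        subst h1
        exact ⟨fun _ => ⟨_, isSolution_iff.1 h2⟩, by simp⟩
      · simp only at h1
        subst h1
        exact ⟨by simp, fun _ => Or.inl h2.injective⟩
      · simp only at h1
        subst h1
        exact ⟨by simp, fun _ => Or.inr h2.injective⟩

end PCPInstance

/-- The algorithm for injective instances may diverge on other inputs, so it is run only after
injectivity has been certified; otherwise the search has already found a solution. -/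
theorem GPCPinj.pcp {S : Set (ℕ × ℕ)} (hS : GPCPinj S) : PCP S := by
  refine Solvable.bind (dom := fun I : PCPInstance => I.size ∈ S)
    (PCPInstance.solvable_solution_or_isInj.comp Computable.id fun a _ =>
      ⟨trivial, fun c hc => hc⟩)
    (dom' := fun x => x.1.size ∈ S ∧ (x.2 = false → x.1.IsInj))
    (ans' := fun x b => if x.2 = true then b = true else
      (b = true ↔ ∃ y : FreeGroup (Fin x.1.src), y ≠ 1 ∧ x.1.g y = x.1.h y)) ?_ ?_
  · obtain ⟨f, hf, hf'⟩ := hS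
    refine ⟨fun x => bif x.2 then Part.some true else f (x.1, [], [], [], []), ?_, ?_⟩
    · refine Partrec.cond Computable.snd (Computable.const true).partrec (hf.comp ?_)
      exact Computable.fst.pair (Computable.const _)
    · rintro ⟨I, b⟩ ⟨hI, hb⟩
      cases b
      · obtain ⟨b, hb, hb'⟩ := hf' (I, [], [], [], []) ⟨hI, hb rfl⟩
        refine ⟨b, hb, ?_⟩
        simp only [Bool.false_eq_true, if_false]
        rw [hb']
        simp [GPCPInstance.HasSolution]
      · exact ⟨true, by simp, by simp⟩
  · intro I hI b hb
    refine ⟨⟨hI, hb.2⟩, fun c hc => ?_⟩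
    cases b
    · simpa using hc
    · rw [if_pos rfl] at hc
      exact iff_of_true hc (hb.1 rfl)

/-! ### Paths with trivial label -/

namespace FreeGroup

variable {α : Type*} [DecidableEq α]

theorem exists_common_prefix (a b : List (α × Bool)) : ∃ p a' b', a = p ++ a' ∧ b = p ++ b' ∧
    ∀ x y, a'.head? = some x → b'.head? = some y → x ≠ y := by
  induction a generalizing b with
  | nil => exact ⟨[], [], b, rfl, rfl, by simp⟩
  | cons x a ih =>
    cases b with
    | nil => exact ⟨[], x :: a, [], rfl, rfl, by simp⟩
    | cons y b =>
      by_cases h : x = y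
      · obtain ⟨p, a', b', rfl, rfl, h'⟩ := ih b
        exact ⟨x :: p, a', b', rfl, by simp [h], h'⟩
      · exact ⟨[], x :: a, y :: b, rfl, rfl, by simp [h]⟩

theorem isReduced_invRev_append {a b : List (α × Bool)} (ha : IsReduced a) (hb : IsReduced b)
    (h : ∀ x y, a.head? = some x → b.head? = some y → x ≠ y) : IsReduced (invRev a ++ b) := by
  have ha' : IsReduced (invRev a) := by
    rw [isReduced_iff_reduce_eq, reduce_invRev, ha.reduce_eq]
  refine List.IsChain.append ha' hb ?_
  rintro ⟨x, bx⟩ hx ⟨y, by'⟩ hy hxy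
  simp only at hxy
  subst hxy
  cases a with
  | nil => simp at hx
  | cons z a =>
    have hz : (invRev (z :: a)).getLast? = some (z.1, !z.2) := by simp [invRev]
    rw [hz, Option.mem_def, Option.some.injEq] at hx
    obtain ⟨rfl, rfl⟩ := Prod.mk.inj hx
    have := h z (z.1, by') rfl hy
    obtain ⟨z1, z2⟩ := z
    cases z2 <;> cases by' <;> simp_all

/-- Distance in the Cayley tree: removing the longest common prefix leaves no cancellation. -/
theorem norm_inv_mul_eq (x y : FreeGroup α) : ∃ p x' y', x.toWord = p ++ x' ∧
    y.toWord = p ++ y' ∧ norm (x⁻¹ * y) = x'.length + y'.length := by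
  obtain ⟨p, x', y', hx, hy, h⟩ := exists_common_prefix x.toWord y.toWord
  refine ⟨p, x', y', hx, hy, ?_⟩
  have hx' : IsReduced x' := (isReduced_toWord (x := x)).infix ⟨p, [], by simp [hx]⟩
  have hy' : IsReduced y' := (isReduced_toWord (x := y)).infix ⟨p, [], by simp [hy]⟩
  have hxy : x⁻¹ * y = mk (invRev x' ++ y') := by
    rw [← mk_toWord (x := x), ← mk_toWord (x := y), hx, hy, ← mul_mk, ← mul_mk, ← mul_mk,
      ← inv_mk]
    group
  rw [hxy, norm, toWord_mk, (isReduced_invRev_append hx' hy' h).reduce_eq]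
  simp

/-- As `b` is no farther from `a` than `1` is, the part of `b` beyond its common prefix with `a` is
at most as long as that prefix; the same holds for `c`. One of the two prefixes extends the other,
so going from `b` to `c` through the shorter one costs at most the length of the element with the
longer prefix. -/
theorem norm_inv_mul_le {a b c : FreeGroup α} {L : ℕ} (hb : norm b ≤ L) (hc : norm c ≤ L)
    (hab : norm (a⁻¹ * b) ≤ norm a) (hac : norm (a⁻¹ * c) ≤ norm a) : norm (b⁻¹ * c) ≤ L := by
  obtain ⟨p, a₁, b', ha₁, hb', h₁⟩ := norm_inv_mul_eq a b
  obtain ⟨q, a₂, c', ha₂, hc', h₂⟩ := norm_inv_mul_eq a c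
  rw [h₁, norm, ha₁] at hab
  rw [h₂, norm, ha₂] at hac
  rw [norm, hb'] at hb
  rw [norm, hc'] at hc
  simp only [List.length_append] at hab hac hb hc
  have hpq : p ++ a₁ = q ++ a₂ := by rw [← ha₁, ha₂]
  rcases List.append_eq_append_iff.1 hpq with ⟨r, rfl, -⟩ | ⟨r, rfl, -⟩
  · have : b⁻¹ * c = mk (invRev b' ++ (r ++ c')) := by
      rw [← mk_toWord (x := b), ← mk_toWord (x := c), hb', hc']
      simp only [← mul_mk, ← inv_mk]
      group
    rw [this]
    refine norm_mk_le.trans ?_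
    simp only [List.length_append, invRev_length] at *
    omega
  · have : b⁻¹ * c = mk (invRev b' ++ (invRev r ++ c')) := by
      rw [← mk_toWord (x := b), ← mk_toWord (x := c), hb', hc']
      simp only [← mul_mk, ← inv_mk]
      group
    rw [this]
    refine norm_mk_le.trans ?_
    simp only [List.length_append, invRev_length] at *
    omega

/-- Two consecutive steps around a farthest point of a path compose to a step that is not longer. -/
theorem norm_mul_le_of_farthest {x y z : FreeGroup α} {L : ℕ} (h₁ : norm (x⁻¹ * y) ≤ L)
    (h₂ : norm (y⁻¹ * z) ≤ L) (hx : norm x ≤ norm y) (hz : norm z ≤ norm y) :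
    norm (x⁻¹ * z) ≤ L := by
  have := norm_inv_mul_le (a := y⁻¹) (b := (x⁻¹ * y)⁻¹) (c := y⁻¹ * z) (L := L)
    (by rwa [norm_inv_eq]) h₂ (by
      have : y⁻¹⁻¹ * (x⁻¹ * y)⁻¹ = x := by group
      rw [this, norm_inv_eq]; exact hx) (by
      have : y⁻¹⁻¹ * (y⁻¹ * z) = z := by group
      rw [this, norm_inv_eq]; exact hz)
  have h' : (x⁻¹ * y)⁻¹⁻¹ * (y⁻¹ * z) = x⁻¹ * z := by group
  rwa [h'] at this

end FreeGroup

namespace LabelledGraph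

open FreeGroup

/-- A list of edges labelled by words. -/
abbrev EdgeList (σ : Type) := List (σ × Word × σ)

section

variable {σ : Type}

/-- There is a nonempty path from `p` to `q` whose label represents `x`. -/
inductive HasPath (T : EdgeList σ) (p : σ) : FreeGroup ℕ → σ → Prop
  | edge {w q} : (p, w, q) ∈ T → HasPath T p (FreeGroup.mk w) q
  | snoc {x q w r} : HasPath T p x q → (q, w, r) ∈ T → HasPath T p (x * FreeGroup.mk w) r

theorem HasPath.trans {T : EdgeList σ} {p q r : σ} {x y : FreeGroup ℕ} (h : HasPath T p x q)
    (h' : HasPath T q y r) : HasPath T p (x * y) r := by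
  induction h' with
  | edge he => exact h.snoc he
  | snoc _ he ih => rw [← mul_assoc]; exact ih.snoc he

/-- The list contains the edges, and the compositions of its elements with short labels. -/
def IsClosed (T : EdgeList σ) (L : ℕ) (K : EdgeList σ) : Prop :=
  (∀ e ∈ T, (e.1, reduce e.2.1, e.2.2) ∈ K) ∧ (∀ e ∈ K, e.2.1.length ≤ L) ∧
    ∀ e ∈ K, ∀ e' ∈ K, e.2.2 = e'.1 → (reduce (e.2.1 ++ e'.2.1)).length ≤ L →
      (e.1, reduce (e.2.1 ++ e'.2.1), e'.2.2) ∈ K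

/-- Peak reduction, by induction on the number of steps: an intermediate vertex is removed whose two
adjacent steps compose to a step of length at most `L`. Here `X i` is the label of the path up to
vertex `i`. -/
theorem IsClosed.mem_of_sequence {T K : EdgeList σ} {L : ℕ} (hK : IsClosed T L K) (k : ℕ) :
    ∀ (s : ℕ → σ) (X : ℕ → FreeGroup ℕ), X 0 = 1 →
      (∀ i ≤ k, (s i, ((X i)⁻¹ * X (i + 1)).toWord, s (i + 1)) ∈ K) → norm (X (k + 1)) ≤ L →
      (s 0, (X (k + 1)).toWord, s (k + 1)) ∈ K := by
  induction k with
  | zero =>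
    intro s X h0 h _
    simpa [h0] using h 0 le_rfl
  | succ k ih =>
    intro s X h0 h hL
    have hnorm : ∀ i ≤ k + 1, norm ((X i)⁻¹ * X (i + 1)) ≤ L := fun i hi => hK.2.1 _ (h i hi)
    suffices ∃ i ≤ k, norm ((X i)⁻¹ * X (i + 2)) ≤ L by
      obtain ⟨i, hi, hiL⟩ := this
      -- The enumeration that omits the vertex `i + 1`.
      let d : ℕ → ℕ := fun j => if j ≤ i then j else j + 1
      have hd0 : d 0 = 0 := by simp [d]
      have hdk : d (k + 1) = k + 2 := by simp only [d]; split_ifs <;> omega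
      have := ih (s ∘ d) (X ∘ d) (by simp [hd0, h0]) (fun j hj => ?_) (by simpa [hdk] using hL)
      · simpa [hd0, hdk] using this
      · simp only [Function.comp_apply, d]
        rcases lt_trichotomy j i with hji | rfl | hji
        · rw [if_pos hji.le, if_pos (by omega)]
          exact h j (by omega)
        · rw [if_pos le_rfl, if_neg (by omega)]
          have h1 := h j (by omega)
          have h2 := h (j + 1) (by omega)
          have h3 : (X j)⁻¹ * X (j + 2) =
              (X j)⁻¹ * X (j + 1) * ((X (j + 1))⁻¹ * X (j + 1 + 1)) := by group
          have := hK.2.2 _ h1 _ h2 rfl (by rw [← toWord_mul, ← h3]; exact hiL)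
          simp only [← toWord_mul, ← h3] at this
          exact this
        · rw [if_neg (by omega), if_neg (by omega)]
          exact h (j + 1) (by omega)
    -- If `X 2` is short, the first two steps compose. Otherwise the farthest interior vertex has
    -- norm above `L`, so it is also farther out than both ends of the path.
    by_cases h2 : norm (X 2) ≤ L
    · exact ⟨0, Nat.zero_le _, by simpa [h0] using h2⟩
    · obtain ⟨i, hi, hmax⟩ := Finset.exists_max_image (Finset.range (k + 1))
        (fun i => norm (X (i + 1))) ⟨0, by simp⟩
      rw [Finset.mem_range] at hi
      have hk : 1 < k + 1 := by
        by_contra hk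
        obtain rfl : k = 0 := by omega
        exact h2 hL
      have h2' := hmax 1 (Finset.mem_range.2 hk)
      refine ⟨i, by omega, norm_mul_le_of_farthest (hnorm i (by omega)) (hnorm (i + 1) (by omega))
        ?_ ?_⟩
      · cases i with
        | zero => simp [h0]
        | succ i => exact hmax i (Finset.mem_range.2 (by omega))
      · rcases Nat.lt_or_ge i k with hik | hik
        · exact hmax (i + 1) (Finset.mem_range.2 (by omega))
        · obtain rfl : i = k := by omega
          simp only [Nat.reduceAdd] at h2'
          exact hL.trans (by omega)

theorem IsClosed.mem_of_hasPath {T K : EdgeList σ} {L : ℕ} (hK : IsClosed T L K) {p q : σ}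
    {x : FreeGroup ℕ} (h : HasPath T p x q) (hx : norm x ≤ L) : (p, x.toWord, q) ∈ K := by
  have hex : ∃ (k : ℕ) (s : ℕ → σ) (X : ℕ → FreeGroup ℕ), s 0 = p ∧ s (k + 1) = q ∧ X 0 = 1 ∧
      X (k + 1) = x ∧ ∀ i ≤ k, (s i, ((X i)⁻¹ * X (i + 1)).toWord, s (i + 1)) ∈ K := by
    clear hx
    induction h with
    | @edge w q he =>
      refine ⟨0, fun i => if i = 0 then p else q, fun i => if i = 0 then 1 else FreeGroup.mk w,
        by simp, by simp, by simp, by simp, fun i hi => ?_⟩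
      obtain rfl : i = 0 := by omega
      simpa using hK.1 _ he
    | @snoc x q w r _ he ih =>
      obtain ⟨k, s, X, h0, hk, hX0, hXk, hs⟩ := ih
      refine ⟨k + 1, fun i => if i ≤ k + 1 then s i else r,
        fun i => if i ≤ k + 1 then X i else x * FreeGroup.mk w, by simp [h0], by simp,
        by simp [hX0], by simp, fun i hi => ?_⟩
      rcases Nat.lt_or_ge i (k + 1) with hik | hik
      · simp only [if_pos (show i ≤ k + 1 by omega), if_pos (show i + 1 ≤ k + 1 by omega)]
        exact hs i (by omega)
      · obtain rfl : i = k + 1 := by omega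
        simpa [hk, hXk] using hK.1 _ he
  obtain ⟨k, s, X, rfl, rfl, h0, rfl, hs⟩ := hex
  exact hK.mem_of_sequence k s X h0 hs hx

theorem finite_words (N L : ℕ) : {v : Word | (∀ p ∈ v, p.1 < N) ∧ v.length ≤ L}.Finite := by
  refine ((List.finite_length_le (Fin N × Bool) L).image
    (List.map fun p => ((p.1 : ℕ), p.2))).subset ?_
  rintro v ⟨hv, hL⟩
  refine ⟨v.pmap (fun p hp => (⟨p.1, hp⟩, p.2)) hv, by simpa using hL, ?_⟩
  simp [List.map_pmap]

/-- For `L` bounding the labels of the edges, `K` consists of all reduced path labels of length at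
most `L`. It is finite because paths use only the vertices and letters that occur in `T`. -/
theorem exists_isClosed (T : EdgeList σ) : ∃ L K, IsClosed T L K ∧
    ∀ e ∈ K, HasPath T e.1 (FreeGroup.mk e.2.1) e.2.2 := by
  classical
  obtain ⟨L, hL⟩ : ∃ L, ∀ e ∈ T, e.2.1.length ≤ L :=
    ⟨(T.map fun e => e.2.1.length).sum, fun e he => List.le_sum_of_mem (List.mem_map.2 ⟨e, he, rfl⟩)⟩
  obtain ⟨N, hN⟩ : ∃ N, ∀ e ∈ T, ∀ p ∈ e.2.1, p.1 < N := by
    refine ⟨((T.flatMap fun e => e.2.1).map fun p => p.1 + 1).sum, fun e he p hp => ?_⟩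
    exact Nat.lt_of_succ_le (List.le_sum_of_mem (List.mem_map.2
      ⟨p, List.mem_flatMap.2 ⟨e, he, hp⟩, rfl⟩))
  let St : Set σ := {p | ∃ e ∈ T, p = e.1 ∨ p = e.2.2}
  have hSt : St.Finite := by
    have : St ⊆ (fun e => e.1) '' {e | e ∈ T} ∪ (fun e => e.2.2) '' {e | e ∈ T} := by
      rintro p ⟨e, he, rfl | rfl⟩
      exacts [Or.inl ⟨e, he, rfl⟩, Or.inr ⟨e, he, rfl⟩]
    exact ((T.finite_toSet.image _).union (T.finite_toSet.image _)).subset this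
  have hpath : ∀ {p q x}, HasPath T p x q → p ∈ St ∧ q ∈ St ∧ ∀ c ∈ x.toWord, c.1 < N := by
    intro p q x h
    induction h with
    | @edge w q he =>
      refine ⟨⟨_, he, Or.inl rfl⟩, ⟨_, he, Or.inr rfl⟩, fun c hc => hN _ he c ?_⟩
      rw [toWord_mk] at hc
      exact reduce.red.sublist.subset hc
    | @snoc x q w r _ he ih =>
      refine ⟨ih.1, ⟨_, he, Or.inr rfl⟩, fun c hc => ?_⟩
      rcases List.mem_append.1 ((toWord_mul_sublist _ _).subset hc) with hc | hc
      · exact ih.2.2 c hc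
      · rw [toWord_mk] at hc
        exact hN _ he c (reduce.red.sublist.subset hc)
  let Kset : Set (σ × Word × σ) :=
    {e | HasPath T e.1 (FreeGroup.mk e.2.1) e.2.2 ∧ reduce e.2.1 = e.2.1 ∧ e.2.1.length ≤ L}
  have hKfin : Kset.Finite := by
    refine (hSt.prod ((finite_words N L).prod hSt)).subset ?_
    rintro ⟨p, v, q⟩ ⟨h1, h2, h3⟩
    obtain ⟨hp, hq, hv⟩ := hpath h1
    simp only at h2
    rw [toWord_mk, h2] at hv
    exact ⟨hp, ⟨hv, h3⟩, hq⟩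
  refine ⟨L, hKfin.toFinset.toList, ⟨fun e he => ?_, fun e he => ?_, fun e he e' he' h hL' => ?_⟩,
    fun e he => ?_⟩
  · simp only [Finset.mem_toList, Set.Finite.mem_toFinset]
    exact ⟨by simpa only [reduce.self] using HasPath.edge he, reduce.idem,
      reduce.red.length_le.trans (hL e he)⟩
  all_goals simp only [Finset.mem_toList, Set.Finite.mem_toFinset] at *
  · exact he.2.2
  · refine ⟨?_, reduce.idem, hL'⟩
    simp only [reduce.self, ← mul_mk]
    exact he.1.trans (h ▸ he'.1)
  · exact he.1

end

variable {σ : Type}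

/-- The end of the path that starts at `p` and consists of the given edges. -/
def pathEnd [DecidableEq σ] (p : σ) (es : EdgeList σ) : Option σ :=
  es.foldl (fun a e => if a = some e.1 then some e.2.2 else none) (some p)

theorem hasPath_iff [DecidableEq σ] {T : EdgeList σ} {p q : σ} {x : FreeGroup ℕ} :
    HasPath T p x q ↔ ∃ es : EdgeList σ, es ≠ [] ∧ (∀ e ∈ es, e ∈ T) ∧ pathEnd p es = some q ∧
      FreeGroup.mk (es.flatMap fun e => e.2.1) = x := by
  constructor
  · intro h
    induction h with
    | @edge w q he => exact ⟨[(p, w, q)], by simp, by simpa, by simp [pathEnd], by simp⟩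
    | @snoc x q w r _ he ih =>
      obtain ⟨es, h1, h2, h3, h4⟩ := ih
      refine ⟨es ++ [(q, w, r)], by simp, ?_, ?_, ?_⟩
      · intro e he'
        rcases List.mem_append.1 he' with he' | he'
        · exact h2 e he'
        · rw [List.mem_singleton.1 he']; exact he
      · rw [pathEnd] at h3 ⊢
        simp [List.foldl_append, h3]
      · simp [List.flatMap_append, ← mul_mk, h4]
  · rintro ⟨es, h1, h2, h3, rfl⟩
    induction es using List.reverseRecOn generalizing q with
    | nil => exact absurd rfl h1
    | append_singleton es e ih =>
      simp only [pathEnd, List.foldl_append, List.foldl_cons, List.foldl_nil] at h3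
      split_ifs at h3 with h
      obtain ⟨e1, w, e2⟩ := e
      simp only [Option.some.injEq] at h3
      subst h3
      have he := h2 (e1, w, e2) (by simp)
      by_cases hes : es = []
      · subst hes
        simp only [List.foldl_nil, Option.some.injEq] at h
        subst h
        simpa using HasPath.edge he
      · have := (ih hes (fun e he => h2 e (by simp [he])) h).snoc he
        simpa [List.flatMap_append, ← mul_mk] using this

variable [Primcodable σ]

theorem primrec_pathEnd [DecidableEq σ] : Primrec₂ (pathEnd : σ → EdgeList σ → Option σ) := by
  have he : Primrec fun x : (σ × EdgeList σ) × Option σ × σ × Word × σ => x.2.2 :=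
    Primrec.snd.comp Primrec.snd
  refine Primrec.list_foldl (f := fun x : σ × EdgeList σ => x.2) (g := fun x => some x.1)
    (h := fun _ (y : Option σ × σ × Word × σ) => if y.1 = some y.2.1 then some y.2.2.2 else none)
    Primrec.snd (Primrec.option_some.comp Primrec.fst) (Primrec.ite ?_
      (Primrec.option_some.comp (Primrec.snd.comp (Primrec.snd.comp he))) (Primrec.const none))
  exact PrimrecPred.eq_comp (Primrec.fst.comp Primrec.snd)
    (Primrec.option_some.comp (Primrec.fst.comp he))

/-- It is decidable whether a finite graph with edges labelled by words has a nonempty path between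
given sets of vertices with trivial label. -/
theorem decidableOn_hasPath_one :
    DecidableOn (α := EdgeList σ × List σ × List σ) (fun _ => True)
      fun a => ∃ p ∈ a.2.1, ∃ q ∈ a.2.2, HasPath a.1 p 1 q := by
  classical
  refine DecidableOn.of_certificates
    -- A positive answer is certified by an explicit path, a negative one by a closed list without
    -- the relevant triples with empty label.
    (yes := fun (a : EdgeList σ × List σ × List σ) (c : (σ × σ) × EdgeList σ) =>
      c.1.1 ∈ a.2.1 ∧ c.1.2 ∈ a.2.2 ∧ c.2 ≠ [] ∧ (∀ e ∈ c.2, e ∈ a.1) ∧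
        pathEnd c.1.1 c.2 = some c.1.2 ∧ reduce (c.2.flatMap fun e => e.2.1) = [])
    (no := fun (a : EdgeList σ × List σ × List σ) (c : ℕ × EdgeList σ) =>
      IsClosed a.1 c.1 c.2 ∧ ∀ p ∈ a.2.1, ∀ q ∈ a.2.2, (p, [], q) ∉ c.2) ?_ ?_ ?_ ?_ ?_ ?_
  · have hP := Primrec.fst.comp (Primrec.snd.comp (Primrec.fst
      (α := EdgeList σ × List σ × List σ) (β := (σ × σ) × EdgeList σ)))
    have hQ := Primrec.snd.comp (Primrec.snd.comp (Primrec.fst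
      (α := EdgeList σ × List σ × List σ) (β := (σ × σ) × EdgeList σ)))
    have hp := Primrec.fst.comp (Primrec.fst.comp (Primrec.snd
      (α := EdgeList σ × List σ × List σ) (β := (σ × σ) × EdgeList σ)))
    have hq := Primrec.snd.comp (Primrec.fst.comp (Primrec.snd
      (α := EdgeList σ × List σ × List σ) (β := (σ × σ) × EdgeList σ)))
    have hes := Primrec.snd.comp (Primrec.snd
      (α := EdgeList σ × List σ × List σ) (β := (σ × σ) × EdgeList σ))
    refine PrimrecPred.and (PrimrecPred.mem_list hP hp) (PrimrecPred.and
      (PrimrecPred.mem_list hQ hq) (PrimrecPred.and (PrimrecPred.not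
        (PrimrecPred.eq_comp hes (Primrec.const []))) (PrimrecPred.and ?_ (PrimrecPred.and ?_ ?_))))
    · exact PrimrecPred.ball_list hes (PrimrecPred.mem_list
        (Primrec.fst.comp (Primrec.fst.comp Primrec.fst)) Primrec.snd)
    · exact PrimrecPred.eq_comp (primrec_pathEnd.comp hp hes) (Primrec.option_some.comp hq)
    · exact PrimrecPred.eq_comp (Word.primrec_reduce.comp (Primrec.list_flatMap hes
        (Primrec.fst.comp (Primrec.snd.comp Primrec.snd)))) (Primrec.const [])
  · have hT := Primrec.fst.comp (Primrec.fst
      (α := EdgeList σ × List σ × List σ) (β := ℕ × EdgeList σ))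
    have hP := Primrec.fst.comp (Primrec.snd.comp (Primrec.fst
      (α := EdgeList σ × List σ × List σ) (β := ℕ × EdgeList σ)))
    have hQ := Primrec.snd.comp (Primrec.snd.comp (Primrec.fst
      (α := EdgeList σ × List σ × List σ) (β := ℕ × EdgeList σ)))
    have hL := Primrec.fst.comp (Primrec.snd
      (α := EdgeList σ × List σ × List σ) (β := ℕ × EdgeList σ))
    have hK := Primrec.snd.comp (Primrec.snd
      (α := EdgeList σ × List σ × List σ) (β := ℕ × EdgeList σ))
    refine PrimrecPred.and (PrimrecPred.and ?_ (PrimrecPred.and ?_ ?_)) ?_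
    · refine PrimrecPred.ball_list hT (PrimrecPred.mem_list (hK.comp Primrec.fst) ?_)
      exact (Primrec.fst.comp Primrec.snd).pair ((Word.primrec_reduce.comp
        (Primrec.fst.comp (Primrec.snd.comp Primrec.snd))).pair
        (Primrec.snd.comp (Primrec.snd.comp Primrec.snd)))
    · exact PrimrecPred.ball_list hK (Primrec.nat_le.comp (Primrec.list_length.comp
        (Primrec.fst.comp (Primrec.snd.comp Primrec.snd))) (hL.comp Primrec.fst))
    · refine PrimrecPred.ball_list hK (PrimrecPred.ball_list (hK.comp Primrec.fst) ?_)
      have he : Primrec fun x : (((EdgeList σ × List σ × List σ) × ℕ × EdgeList σ) ×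
          σ × Word × σ) × σ × Word × σ => x.1.2 := Primrec.snd.comp Primrec.fst
      have he' : Primrec fun x : (((EdgeList σ × List σ × List σ) × ℕ × EdgeList σ) ×
          σ × Word × σ) × σ × Word × σ => x.2 := Primrec.snd
      have hr := Word.primrec_reduce.comp (Primrec.list_append.comp
        (Primrec.fst.comp (Primrec.snd.comp he)) (Primrec.fst.comp (Primrec.snd.comp he')))
      refine PrimrecPred.imp ?_ (PrimrecPred.imp ?_ ?_)
      · exact PrimrecPred.eq_comp (Primrec.snd.comp (Primrec.snd.comp he)) (Primrec.fst.comp he')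
      · exact Primrec.nat_le.comp (Primrec.list_length.comp hr)
          (hL.comp (Primrec.fst.comp Primrec.fst))
      · exact PrimrecPred.mem_list (hK.comp (Primrec.fst.comp Primrec.fst))
          ((Primrec.fst.comp he).pair (hr.pair (Primrec.snd.comp (Primrec.snd.comp he'))))
    · refine PrimrecPred.ball_list hP (PrimrecPred.ball_list (hQ.comp Primrec.fst)
        (PrimrecPred.not (PrimrecPred.mem_list (hK.comp (Primrec.fst.comp Primrec.fst)) ?_)))
      exact (Primrec.snd.comp Primrec.fst).pair ((Primrec.const []).pair Primrec.snd)
  · rintro ⟨T, P, Q⟩ - ⟨⟨p, q⟩, es⟩ ⟨hp, hq, h1, h2, h3, h4⟩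
    exact ⟨p, hp, q, hq, hasPath_iff.2 ⟨es, h1, h2, h3, by rw [← reduce.self, h4]; rfl⟩⟩
  · rintro ⟨T, P, Q⟩ - ⟨p, hp, q, hq, h⟩
    obtain ⟨es, h1, h2, h3, h4⟩ := hasPath_iff.1 h
    exact ⟨((p, q), es), hp, hq, h1, h2, h3, by rw [← toWord_mk, h4, toWord_one]⟩
  · rintro ⟨T, P, Q⟩ - ⟨L, K⟩ ⟨hK, hno⟩ ⟨p, hp, q, hq, h⟩
    exact hno p hp q hq (hK.mem_of_hasPath h (by simp))
  · rintro ⟨T, P, Q⟩ - h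
    obtain ⟨L, K, hK, hpath⟩ := exists_isClosed T
    exact ⟨(L, K), hK, fun p hp q hq hmem => h ⟨p, hp, q, hq, hpath _ hmem⟩⟩

end LabelledGraph

/-! ### Rational sets and the basis problem -/

namespace LabelledGraph

open FreeGroup

/-- The letters of the alphabet with `r` letters and their inverses. -/
def signedLetters (r : ℕ) : Word := (List.range r).flatMap fun j => [(j, true), (j, false)]

/-- The word of a basis element or of its inverse. -/
def petal (n : ℕ) (B : List Word) (s : ℕ × Bool) : Word :=
  Word.clip n (if s.2 = true then B.getD s.1 [] else invRev (B.getD s.1 []))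

/-- The graph whose paths from an initial vertex read a word accepted by the automaton and then a
nonempty reduced word in the given words. The vertices are the states `(0, q, true)` of the
automaton, and the letters `(1, s)` that remember the last word that has been read. -/
def productGraph (n : ℕ) (A : AutomatonCode) (B : List Word) : EdgeList (ℕ × ℕ × Bool) :=
  ((A.2.1.filter fun e => e.1 < A.1 ∧ e.2.2 < A.1 ∧ e.2.1.1 < n).map fun e =>
    ((0, e.1, true), [e.2.1], (0, e.2.2, true))) ++
  (((A.2.2.2.filter fun q => q < A.1).flatMap fun q => (signedLetters B.length).map fun s =>
    ((0, q, true), petal n B s, (1, s))) ++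
  ((signedLetters B.length).flatMap fun s =>
    ((signedLetters B.length).filter fun s' => ¬ s' = (s.1, !s.2)).map fun s' =>
      ((1, s), petal n B s', (1, s'))))

theorem mem_signedLetters {r : ℕ} {s : ℕ × Bool} : s ∈ signedLetters r ↔ s.1 < r := by
  obtain ⟨j, b⟩ := s
  cases b <;> simp [signedLetters]

variable {n : ℕ} {A : AutomatonCode} {B : List Word}

theorem mem_productGraph {a b : ℕ × ℕ × Bool} {w : Word} : (a, w, b) ∈ productGraph n A B ↔
    (∃ e ∈ A.2.1, (e.1 < A.1 ∧ e.2.2 < A.1 ∧ e.2.1.1 < n) ∧ a = (0, e.1, true) ∧ w = [e.2.1] ∧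
      b = (0, e.2.2, true)) ∨
    (∃ q ∈ A.2.2.2, q < A.1 ∧ ∃ s : ℕ × Bool, s.1 < B.length ∧ a = (0, q, true) ∧
      w = petal n B s ∧ b = (1, s)) ∨
    (∃ s s' : ℕ × Bool, s.1 < B.length ∧ s'.1 < B.length ∧ s' ≠ (s.1, !s.2) ∧ a = (1, s) ∧
      w = petal n B s' ∧ b = (1, s')) := by
  rw [productGraph, List.mem_append, List.mem_append]
  refine or_congr ?_ (or_congr ?_ ?_)
  · simp only [List.mem_map, List.mem_filter, decide_eq_true_eq, Prod.mk.injEq]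
    constructor
    · rintro ⟨e, ⟨h1, h2⟩, rfl, rfl, rfl⟩; exact ⟨e, h1, h2, rfl, rfl, rfl⟩
    · rintro ⟨e, h1, h2, rfl, rfl, rfl⟩; exact ⟨e, ⟨h1, h2⟩, rfl, rfl, rfl⟩
  · simp only [List.mem_flatMap, List.mem_map, List.mem_filter, decide_eq_true_eq, Prod.mk.injEq,
      mem_signedLetters]
    constructor
    · rintro ⟨q, ⟨h1, h2⟩, s, hs, rfl, rfl, rfl⟩; exact ⟨q, h1, h2, s, hs, rfl, rfl, rfl⟩
    · rintro ⟨q, h1, h2, s, hs, rfl, rfl, rfl⟩; exact ⟨q, ⟨h1, h2⟩, s, hs, rfl, rfl, rfl⟩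
  · simp only [List.mem_flatMap, List.mem_map, List.mem_filter, decide_eq_true_eq, Prod.mk.injEq,
      mem_signedLetters]
    constructor
    · rintro ⟨s, hs, s', ⟨hs', h⟩, rfl, rfl, rfl⟩; exact ⟨s, s', hs, hs', h, rfl, rfl, rfl⟩
    · rintro ⟨s, s', hs, hs', h, rfl, rfl, rfl⟩; exact ⟨s, hs, s', ⟨hs', h⟩, rfl, rfl, rfl⟩

theorem mk_petal (s : Fin B.length × Bool) : FreeGroup.mk (petal n B (s.1, s.2)) =
    FreeGroup.map Fin.val (homOfWords B.length n B (FreeGroup.mk [s])) := by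
  obtain ⟨j, b⟩ := s
  rw [petal, ← Word.map_val_toFree]
  congr 1
  cases b
  · have : (FreeGroup.mk [(j, false)] : FreeGroup (Fin B.length)) = (of j)⁻¹ := rfl
    rw [this, _root_.map_inv, Transducer.homOfWords_of]
    simp
  · have : (FreeGroup.mk [(j, true)] : FreeGroup (Fin B.length)) = of j := rfl
    rw [this, Transducer.homOfWords_of]
    simp

theorem mk_snoc {α : Type*} (l : List (α × Bool)) (s : α × Bool) :
    (FreeGroup.mk (l ++ [s]) : FreeGroup α) = FreeGroup.mk l * FreeGroup.mk [s] := mul_mk.symm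

theorem isReduced_snoc_snoc {α : Type*} {l : List (α × Bool)} {s s' : α × Bool} :
    IsReduced (l ++ [s] ++ [s']) ↔ IsReduced (l ++ [s]) ∧ (s.1 = s'.1 → s.2 = s'.2) := by
  simp [FreeGroup.IsReduced, List.isChain_append]
  tauto

/-- A path stays among the automaton states and then moves for good to the letter vertices.
Remembering the last letter there is what keeps the second word reduced. -/
theorem HasPath.productGraph_cases {p : ℕ} (hp : p ∈ A.2.2.1) (hpA : p < A.1) {x : FreeGroup ℕ}
    {q : ℕ × ℕ × Bool} (h : HasPath (productGraph n A B) (0, p, true) x q) :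
    (∃ w, ∃ q' ∈ (A.toNFA n).eval w, q = (0, (q' : ℕ), true) ∧
      x = FreeGroup.map Fin.val (FreeGroup.mk w)) ∨
    (∃ y ∈ A.rationalSet n, ∃ (l : List (Fin B.length × Bool)) (s : Fin B.length × Bool),
      IsReduced (l ++ [s]) ∧ q = (1, (s.1 : ℕ), s.2) ∧
      x = FreeGroup.map Fin.val (y * homOfWords B.length n B (FreeGroup.mk (l ++ [s])))) := by
  have hword : ∀ c (hc : c.1 < n), FreeGroup.mk [c] =
      FreeGroup.map Fin.val (FreeGroup.mk [((⟨c.1, hc⟩ : Fin n), c.2)]) := by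
    intro c hc; rw [map.mk]; rfl
  -- Edges leaving an automaton state, needed both for the first edge of a path and for later ones.
  have hstep : ∀ w, ∀ q' ∈ (A.toNFA n).eval w, ∀ v b,
      ((0, (q' : ℕ), true), v, b) ∈ productGraph n A B →
      (∃ w', ∃ q'' ∈ (A.toNFA n).eval w', b = (0, (q'' : ℕ), true) ∧
        FreeGroup.map Fin.val (FreeGroup.mk w) * FreeGroup.mk v =
          FreeGroup.map Fin.val (FreeGroup.mk w')) ∨
      (∃ y ∈ A.rationalSet n, ∃ (l : List (Fin B.length × Bool)) (s : Fin B.length × Bool),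
        IsReduced (l ++ [s]) ∧ b = (1, (s.1 : ℕ), s.2) ∧
        FreeGroup.map Fin.val (FreeGroup.mk w) * FreeGroup.mk v =
          FreeGroup.map Fin.val (y * homOfWords B.length n B (FreeGroup.mk (l ++ [s])))) := by
    intro w q' hq' v b he
    rcases mem_productGraph.1 he with ⟨e, he', ⟨h1, h2, h3⟩, h4, rfl, rfl⟩ |
      ⟨f, hf, hfA, s, hs, h4, rfl, rfl⟩ | ⟨s, s', hs, hs', hss, h4, rfl, rfl⟩
    · simp only [Prod.mk.injEq, true_and, and_true] at h4
      refine Or.inl ⟨w ++ [(⟨e.2.1.1, h3⟩, e.2.1.2)], ⟨e.2.2, h2⟩, ?_, rfl, ?_⟩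
      · rw [NFA.eval_append_singleton, NFA.mem_stepSet]
        refine ⟨q', hq', ?_⟩
        change ((q' : ℕ), (e.2.1.1, e.2.1.2), e.2.2) ∈ A.2.1
        rw [h4]; exact he'
      · rw [mk_snoc, _root_.map_mul, hword _ h3]
    · simp only [Prod.mk.injEq, true_and, and_true] at h4
      refine Or.inr ⟨FreeGroup.mk w, ⟨w, ⟨q', ?_, hq'⟩, rfl⟩, [], (⟨s.1, hs⟩, s.2),
        IsReduced.singleton, rfl, ?_⟩
      · change (q' : ℕ) ∈ A.2.2.2
        rw [h4]; exact hf
      · rw [_root_.map_mul, List.nil_append, ← mk_petal]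
    · simp at h4
  generalize hp' : ((0, p, true) : ℕ × ℕ × Bool) = p' at h
  induction h with
  | @edge w q he =>
    subst hp'
    have := hstep [] ⟨p, hpA⟩ hp _ _ he
    simpa [← one_eq_mk] using this
  | @snoc x q w r _ he ih =>
    rcases ih with ⟨v, q', hq', rfl, rfl⟩ | ⟨y, hy, l, s, hl, rfl, rfl⟩
    · exact hstep v q' hq' _ _ he
    · rcases mem_productGraph.1 he with ⟨e, he, -, h4, -⟩ | ⟨f, hf, -, t, -, h4, -⟩ |
        ⟨t, t', ht, ht', htt, h4, rfl, rfl⟩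
      · simp at h4
      · simp at h4
      · simp only [Prod.mk.injEq, true_and] at h4
        refine Or.inr ⟨y, hy, l ++ [s], (⟨t'.1, ht'⟩, t'.2), ?_, rfl, ?_⟩
        · refine isReduced_snoc_snoc.2 ⟨hl, fun h => ?_⟩
          by_contra h'
          refine htt (Prod.ext ?_ ?_)
          · rw [← h4]; exact (congrArg Fin.val h).symm
          · rw [← h4]
            exact Bool.eq_not.2 fun h => h' h.symm
        · have := mk_petal (n := n) ((⟨t'.1, ht'⟩, t'.2) : Fin B.length × Bool)
          simp only [Prod.mk.eta] at this
          rw [this, mk_snoc (l ++ [s]), _root_.map_mul (homOfWords _ _ _), ← mul_assoc, ← _root_.map_mul]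

/-- Paths are nonempty, so the empty word has to be listed apart; it represents `1` and is discarded
later. -/
theorem hasPath_of_mem_eval {w : List (Fin n × Bool)} :
    ∀ {q : Fin A.1}, q ∈ (A.toNFA n).eval w → (w = [] ∧ (q : ℕ) ∈ A.2.2.1) ∨
      ∃ p ∈ A.2.2.1, p < A.1 ∧ HasPath (productGraph n A B) (0, p, true)
        (FreeGroup.map Fin.val (FreeGroup.mk w)) (0, (q : ℕ), true) := by
  induction w using List.reverseRecOn with
  | nil => intro q hq; exact Or.inl ⟨rfl, hq⟩
  | append_singleton w a ih =>
    intro q hq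
    rw [NFA.eval_append_singleton, NFA.mem_stepSet] at hq
    obtain ⟨t, ht, hq⟩ := hq
    have he : ((0, (t : ℕ), true), [((a.1 : ℕ), a.2)], (0, (q : ℕ), true)) ∈ productGraph n A B :=
      mem_productGraph.2 (Or.inl ⟨_, hq, ⟨t.2, q.2, a.1.2⟩, rfl, rfl, rfl⟩)
    rcases ih ht with ⟨rfl, hs⟩ | ⟨p, hp, hpA, h⟩
    · exact Or.inr ⟨t, hs, t.2, HasPath.edge he⟩
    · refine Or.inr ⟨p, hp, hpA, ?_⟩
      rw [mk_snoc, _root_.map_mul]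
      exact h.snoc he

theorem hasPath_of_isReduced {q : ℕ} (hq : q ∈ A.2.2.2) (hqA : q < A.1)
    (l : List (Fin B.length × Bool)) : ∀ s : Fin B.length × Bool, IsReduced (l ++ [s]) →
      HasPath (productGraph n A B) (0, q, true)
        (FreeGroup.map Fin.val (homOfWords B.length n B (FreeGroup.mk (l ++ [s]))))
        (1, (s.1 : ℕ), s.2) := by
  induction l using List.reverseRecOn with
  | nil =>
    intro s _
    rw [List.nil_append, ← mk_petal]
    exact HasPath.edge (mem_productGraph.2 (Or.inr (Or.inl ⟨q, hq, hqA, (s.1, s.2), s.1.2, rfl, rfl, rfl⟩)))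
  | append_singleton l t ih =>
    intro s hs
    obtain ⟨h1, h2⟩ := isReduced_snoc_snoc.1 hs
    rw [mk_snoc, _root_.map_mul, _root_.map_mul, ← mk_petal]
    refine (ih t h1).snoc (mem_productGraph.2 (Or.inr (Or.inr
      ⟨(t.1, t.2), (s.1, s.2), t.1.2, s.1.2, fun h => ?_, rfl, rfl, rfl⟩)))
    have h3 : (s.1 : ℕ) = t.1 := congrArg Prod.fst h
    have h4 : s.2 = !t.2 := congrArg Prod.snd h
    have := h2 (Fin.ext h3.symm)
    rw [h4] at this
    simp at this

/-- The rational set meets nontrivially the subgroup freely generated by the words in `B`. -/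
theorem exists_hasPath_one_iff (hB : Function.Injective (homOfWords B.length n B)) :
    (∃ p ∈ (A.2.2.1.filter fun p => p < A.1).map fun p => (0, p, true),
      ∃ q ∈ (signedLetters B.length).map fun s => (1, s), HasPath (productGraph n A B) p 1 q) ↔
    ∃ x ∈ A.rationalSet n, x ≠ 1 ∧ x ∈ (homOfWords B.length n B).range := by
  constructor
  · rintro ⟨p, hp, q, hq, h⟩
    obtain ⟨p₁, hp₁, rfl⟩ := List.mem_map.1 hp
    simp only [List.mem_filter, decide_eq_true_eq] at hp₁
    obtain ⟨s, -, rfl⟩ := List.mem_map.1 hq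
    rcases h.productGraph_cases hp₁.1 hp₁.2 with ⟨w, q', _, h', _⟩ | ⟨y, hy, l, s', hl, h', h1⟩
    · simp at h'
    · have h2 : y * homOfWords B.length n B (FreeGroup.mk (l ++ [s'])) = 1 :=
        Word.map_val_injective n (by rw [← h1, _root_.map_one])
      have h3 := eq_inv_of_mul_eq_one_left h2
      refine ⟨y, hy, fun hy1 => ?_, ?_⟩
      -- If `y` were trivial, a nonempty reduced word in the basis would represent `1`.
      · rw [hy1, one_mul, ← _root_.map_one (homOfWords B.length n B)] at h2
        have := congrArg toWord (hB h2)
        rw [toWord_mk, hl.reduce_eq] at this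
        simp at this
      · rw [h3]
        exact Subgroup.inv_mem _ ⟨_, rfl⟩
  -- The path reads an accepted word `w` for `x` and then the reduced word of `z⁻¹`, where `z`
  -- expresses `x` in the basis.
  · rintro ⟨_, ⟨w, ⟨q, hq, hw⟩, rfl⟩, hx, z, hz⟩
    have hz1 : z⁻¹.toWord ≠ [] := fun h => by
      rw [toWord_eq_nil_iff, inv_eq_one] at h
      exact hx (by rw [← hz, h, _root_.map_one])
    have hred : IsReduced z⁻¹.toWord := isReduced_toWord
    obtain ⟨l, s, hls⟩ : ∃ l s, z⁻¹.toWord = l ++ [s] :=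
      ⟨_, _, (List.dropLast_append_getLast hz1).symm⟩
    rw [hls] at hred
    have h2 := hasPath_of_isReduced (n := n) (A := A) (B := B) hq q.2 l s hred
    rw [← hls, mk_toWord, _root_.map_inv, hz] at h2
    have hs : ((1, (s.1 : ℕ), s.2) : ℕ × ℕ × Bool) ∈
        (signedLetters B.length).map fun s => (1, s) :=
      List.mem_map.2 ⟨(s.1, s.2), mem_signedLetters.2 s.1.2, rfl⟩
    rcases hasPath_of_mem_eval (B := B) hw with ⟨rfl, hq'⟩ | ⟨p, hp, hpA, h1⟩
    · exact absurd rfl hx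
    · refine ⟨_, List.mem_map.2 ⟨p, List.mem_filter.2 ⟨hp, by simpa using hpA⟩, rfl⟩, _, hs, ?_⟩
      have := h1.trans h2
      rwa [← _root_.map_mul, mul_inv_cancel, _root_.map_one] at this

section

variable {α : Type} [Primcodable α]

theorem primrec_signedLetters : Primrec signedLetters := by
  refine Primrec.list_flatMap Primrec.list_range ?_
  exact Primrec.list_cons.comp (Primrec.snd.pair (Primrec.const true))
    (Primrec.list_cons.comp (Primrec.snd.pair (Primrec.const false)) (Primrec.const []))

theorem primrec_petal {n : α → ℕ} {B : α → List Word} {s : α → ℕ × Bool} (hn : Primrec n)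
    (hB : Primrec B) (hs : Primrec s) : Primrec fun x => petal (n x) (B x) (s x) := by
  have hget := Word.primrec_getD hB (Primrec.fst.comp hs)
  exact Word.primrec_clip.comp hn (Primrec.ite (PrimrecPred.eq_comp (Primrec.snd.comp hs)
    (Primrec.const true)) hget (Word.primrec_invRev.comp hget))

theorem primrec_productGraph {n : α → ℕ} {A : α → AutomatonCode} {B : α → List Word}
    (hn : Primrec n) (hA : Primrec A) (hB : Primrec B) :
    Primrec fun x => productGraph (n x) (A x) (B x) := by
  have hk : Primrec fun x => (A x).1 := Primrec.fst.comp hA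
  have hsl : Primrec fun x => signedLetters (B x).length :=
    primrec_signedLetters.comp (Primrec.list_length.comp hB)
  refine Primrec.list_append.comp ?_ (Primrec.list_append.comp ?_ ?_)
  · refine Primrec.list_map (g := fun _ (e : ℕ × (ℕ × Bool) × ℕ) =>
        (((0, e.1, true), [e.2.1], (0, e.2.2, true)) : (ℕ × ℕ × Bool) × Word × ℕ × ℕ × Bool))
      (Primrec.list_filter (p := fun x (e : ℕ × (ℕ × Bool) × ℕ) =>
        e.1 < (A x).1 ∧ e.2.2 < (A x).1 ∧ e.2.1.1 < n x)
        (Primrec.fst.comp (Primrec.snd.comp hA)) ?_) ?_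
    · refine PrimrecPred.and ?_ (PrimrecPred.and ?_ ?_)
      · exact Primrec.nat_lt.comp (Primrec.fst.comp Primrec.snd) (hk.comp Primrec.fst)
      · exact Primrec.nat_lt.comp (Primrec.snd.comp (Primrec.snd.comp Primrec.snd))
          (hk.comp Primrec.fst)
      · exact Primrec.nat_lt.comp (Primrec.fst.comp (Primrec.fst.comp (Primrec.snd.comp
          Primrec.snd))) (hn.comp Primrec.fst)
    · exact Primrec.pair ((Primrec.const 0).pair ((Primrec.fst.comp Primrec.snd).pair
        (Primrec.const true))) (Primrec.pair (Primrec.list_cons.comp (Primrec.fst.comp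
        (Primrec.snd.comp Primrec.snd)) (Primrec.const [])) ((Primrec.const 0).pair
        ((Primrec.snd.comp (Primrec.snd.comp Primrec.snd)).pair (Primrec.const true))))
  · refine Primrec.list_flatMap (g := fun x (q : ℕ) => (signedLetters (B x).length).map fun s =>
        (((0, q, true), petal (n x) (B x) s, (1, s)) : (ℕ × ℕ × Bool) × Word × ℕ × ℕ × Bool))
      (Primrec.list_filter (p := fun x (q : ℕ) => q < (A x).1)
        (Primrec.snd.comp (Primrec.snd.comp (Primrec.snd.comp hA))) ?_) ?_
    · exact Primrec.nat_lt.comp Primrec.snd (hk.comp Primrec.fst)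
    · refine Primrec.list_map (hsl.comp Primrec.fst) ?_
      exact ((Primrec.const 0).pair ((Primrec.snd.comp Primrec.fst).pair (Primrec.const true))).pair
        ((primrec_petal (hn.comp (Primrec.fst.comp Primrec.fst))
          (hB.comp (Primrec.fst.comp Primrec.fst)) Primrec.snd).pair
          ((Primrec.const 1).pair Primrec.snd))
  · refine Primrec.list_flatMap hsl ?_
    refine Primrec.list_map (f := fun y : α × ℕ × Bool =>
        (signedLetters (B y.1).length).filter fun s' => ¬ s' = (y.2.1, !y.2.2))
      (g := fun y s' => (((1, y.2), petal (n y.1) (B y.1) s', (1, s')) :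
        (ℕ × ℕ × Bool) × Word × ℕ × ℕ × Bool))
      (Primrec.list_filter (p := fun (y : α × ℕ × Bool) (s' : ℕ × Bool) =>
        ¬ s' = (y.2.1, !y.2.2)) (hsl.comp Primrec.fst) (PrimrecPred.not ?_)) ?_
    · exact PrimrecPred.eq_comp Primrec.snd ((Primrec.fst.comp (Primrec.snd.comp Primrec.fst)).pair
        (Primrec.not.comp (Primrec.snd.comp (Primrec.snd.comp Primrec.fst))))
    · exact ((Primrec.const 1).pair (Primrec.snd.comp Primrec.fst)).pair
        ((primrec_petal (hn.comp (Primrec.fst.comp Primrec.fst))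
          (hB.comp (Primrec.fst.comp Primrec.fst)) Primrec.snd).pair
          ((Primrec.const 1).pair Primrec.snd))

end

end LabelledGraph

theorem IsBasisList.injective_and_range {n : ℕ} {H : Subgroup (FreeGroup (Fin n))} {B : List Word}
    (hB : IsBasisList H B) : Function.Injective (homOfWords B.length n B) ∧
      (homOfWords B.length n B).range = H := by
  obtain ⟨b, hb⟩ := hB
  have h : homOfWords B.length n B = H.subtype.comp b.repr.symm.toMonoidHom := by
    ext i
    rw [Transducer.homOfWords_of]
    have := hb i
    simp only [List.get_eq_getElem] at this
    simp only [Fin.is_lt, List.getD_eq_getElem, ← this]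
    rfl
  rw [h]
  refine ⟨H.subtype_injective.comp b.repr.symm.injective, ?_⟩
  rw [MonoidHom.range_comp, MonoidHom.range_eq_top.2 b.repr.symm.surjective, ← MonoidHom.range_eq_map,
    Subgroup.range_subtype]

/-- A basis presents the equaliser as the injective image of a free group, so the path problem for
the product graph answers the question. Initial states are filtered because a code may list numbers
that are not states. -/
theorem BP.pcpRinj {S : Set (ℕ × ℕ)} (hS : BP S) : PCPRinj S := by
  refine Solvable.bind (dom := fun J : PCPInstance × AutomatonCode => J.1.size ∈ S ∧ J.1.IsInj)
    (ans := fun J B => IsBasisList J.1.equaliser B)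
    (hS.comp Computable.fst fun _ h => ⟨h, fun _ hB => hB⟩)
    (dom' := fun _ => True)
    (LabelledGraph.decidableOn_hasPath_one.comp (t := fun x : (PCPInstance × AutomatonCode) ×
      List Word => (LabelledGraph.productGraph x.1.1.src x.1.2 x.2,
        ((x.1.2.2.2.1.filter fun p => p < x.1.2.1).map fun p => (0, p, true)),
        (LabelledGraph.signedLetters x.2.length).map fun s => (1, s))) ?_
      fun _ _ => ⟨trivial, fun _ h => h⟩) ?_
  · refine Primrec.to_comp (Primrec.pair ?_ (Primrec.pair ?_ ?_))
    · exact LabelledGraph.primrec_productGraph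
        (Primrec.fst.comp (Primrec.fst.comp (Primrec.fst.comp Primrec.fst)))
        (Primrec.snd.comp Primrec.fst) Primrec.snd
    · refine Primrec.list_map (Primrec.list_filter
        (p := fun (x : (PCPInstance × AutomatonCode) × List Word) p => p < x.1.2.1) ?_ ?_) ?_
      · exact Primrec.fst.comp (Primrec.snd.comp (Primrec.snd.comp
          (Primrec.snd.comp Primrec.fst)))
      · exact Primrec.nat_lt.comp Primrec.snd (Primrec.fst.comp (Primrec.snd.comp
          (Primrec.fst.comp Primrec.fst)))
      · exact (Primrec.const 0).pair (Primrec.snd.pair (Primrec.const true))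
    · exact Primrec.list_map (LabelledGraph.primrec_signedLetters.comp
        (Primrec.list_length.comp Primrec.snd)) ((Primrec.const 1).pair Primrec.snd)
  · rintro ⟨I, A⟩ hI B hB
    refine ⟨trivial, fun b hb => hb.trans ?_⟩
    obtain ⟨h1, h2⟩ := hB.injective_and_range
    refine (LabelledGraph.exists_hasPath_one_iff h1).trans ?_
    rw [h2]
    rfl

/-! ### Adjoining a letter -/

namespace LetterExtension

open HNNExtension

/-- The free product of a group and an infinite cyclic group. -/
abbrev FreeStable (K : Type) [Group K] : Type :=
  HNNExtension K ⊥ ⊥ (MulEquiv.refl (⊥ : Subgroup K))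

/-! ### Normal forms in the free product with an infinite cyclic group -/

section

variable {N K X : Type} [Group N] [Group K] [Group X]

/-- No syllable of the list cancels with the next one. -/
def NoPinch (l : List (ℤˣ × K)) : Prop := l.IsChain fun a b => a.2 = 1 → a.1 = b.1

/-- The product of the syllables `t ^ e * j x`. -/
def syllableProd (j : N →* X) (t : X) (l : List (ℤˣ × N)) : X :=
  (l.map fun a => t ^ (a.1 : ℤ) * j a.2).prod

theorem syllableProd_cons (j : N →* X) (t : X) (a : ℤˣ × N) (l : List (ℤˣ × N)) :
    syllableProd j t (a :: l) = t ^ (a.1 : ℤ) * j a.2 * syllableProd j t l := by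
  simp [syllableProd]

/-- Cancelling a pinch removes two syllables. The last clause records that the length drops unless
nothing changed, so that words of minimal length can be recognised as pinch-free. -/
theorem exists_noPinch (j : N →* X) (t : X) (x : N) (l : List (ℤˣ × N)) :
    ∃ x' l', NoPinch l' ∧ j x' * syllableProd j t l' = j x * syllableProd j t l ∧
      (l' = l ∧ x' = x ∨ l'.length < l.length) := by
  induction l generalizing x with
  | nil => exact ⟨x, [], List.isChain_nil, rfl, Or.inl ⟨rfl, rfl⟩⟩
  | cons a l ih =>
    obtain ⟨y, l', hl', hp, h⟩ := ih a.2
    have hlen : l'.length ≤ l.length := by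
      rcases h with ⟨rfl, -⟩ | h
      · exact le_rfl
      · exact h.le
    have hcons : j x * syllableProd j t ((a.1, y) :: l') = j x * syllableProd j t (a :: l) := by
      rw [syllableProd_cons, syllableProd_cons, mul_assoc _ _ (syllableProd j t l), ← hp]
      simp only [mul_assoc]
    by_cases hc : NoPinch ((a.1, y) :: l')
    · refine ⟨x, (a.1, y) :: l', hc, hcons, ?_⟩
      rcases h with ⟨rfl, rfl⟩ | h
      · exact Or.inl ⟨rfl, rfl⟩
      · exact Or.inr (by simpa using h)
    · cases l' with
      | nil => exact absurd (List.isChain_singleton _) hc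
      | cons b l'' =>
        have hb : y = 1 ∧ a.1 ≠ b.1 := by
          by_contra hb
          refine hc (List.isChain_cons_cons.2 ⟨fun h1 => ?_, hl'⟩)
          by_contra h2
          exact hb ⟨h1, h2⟩
        have hb' : b.1 = -a.1 := by
          rcases Int.units_eq_one_or a.1 with h1 | h1 <;>
            rcases Int.units_eq_one_or b.1 with h2 | h2 <;> simp_all
        refine ⟨x * b.2, l'', (List.isChain_cons.1 hl').2, ?_, Or.inr ?_⟩
        · rw [← hcons, syllableProd_cons, syllableProd_cons, hb.1, hb']
          simp [mul_assoc]
        · simp only [List.length_cons] at hlen ⊢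
          omega

theorem NoPinch.chain {l : List (ℤˣ × K)} (hl : NoPinch l) :
    l.IsChain fun a b => a.2 ∈ toSubgroup (⊥ : Subgroup K) ⊥ a.1 → a.1 = b.1 := by
  refine hl.imp fun a b h h1 => h ?_
  rcases Int.units_eq_one_or a.1 with h2 | h2 <;> rw [h2] at h1 <;>
    exact Subgroup.mem_bot.1 h1

theorem mem_toSubgroup_bot {u : ℤˣ} {x : K} :
    x ∈ toSubgroup (⊥ : Subgroup K) ⊥ u ↔ x = 1 := by
  rcases Int.units_eq_one_or u with h | h <;> rw [h] <;> exact Subgroup.mem_bot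

/-- The product of the syllables in the free product with an infinite cyclic group. -/
abbrev stableProd (l : List (ℤˣ × K)) : FreeStable K := syllableProd of HNNExtension.t l

/-- Britton's lemma with trivial associated subgroups: cosets of the trivial group are points, so
the leading factors agree exactly. -/
theorem NoPinch.head_eq {x y : K} {l l' : List (ℤˣ × K)} (hl : NoPinch l) (hl' : NoPinch l')
    (h : (of x : FreeStable K) * stableProd l = of y * stableProd l') :
    l.map Prod.fst = l'.map Prod.fst ∧ x = y := by
  have := ReducedWord.map_fst_eq_and_of_prod_eq (MulEquiv.refl (⊥ : Subgroup K))
    (w₁ := ⟨x, l, hl.chain⟩) (w₂ := ⟨y, l', hl'.chain⟩) h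
  refine ⟨this.1, ?_⟩
  cases l with
  | nil =>
    cases l' with
    | nil =>
      apply of_injective (φ := MulEquiv.refl (⊥ : Subgroup K))
      simpa [stableProd, syllableProd] using h
    | cons b l' => simp at this
  | cons a l =>
    have h2 := mem_toSubgroup_bot.1 (this.2 a.1 (by simp))
    exact inv_mul_eq_one.1 h2

/-- A pinch in `l'` could be cancelled, giving a pinch-free form shorter than `l`, against
uniqueness of the exponents. This transfers reducedness from the injective map to the other one. -/
theorem NoPinch.of_eq {x y : K} {l l' : List (ℤˣ × K)} (hl : NoPinch l)
    (hlen : l'.length ≤ l.length)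
    (h : (of x : FreeStable K) * stableProd l = of y * stableProd l') : NoPinch l' := by
  obtain ⟨y', l'', h1, h2, h3 | h3⟩ := exists_noPinch (of : K →* FreeStable K) HNNExtension.t y l'
  · rwa [← h3.1]
  · have := congrArg List.length (hl.head_eq h1 (h.trans h2.symm)).1
    simp only [List.length_map] at this
    omega

theorem NoPinch.second_eq {x x' : K} {a b : ℤˣ × K} {l l' : List (ℤˣ × K)}
    (hl : NoPinch (a :: l)) (hl' : NoPinch (b :: l'))
    (h : (of x : FreeStable K) * stableProd (a :: l) = of x' * stableProd (b :: l')) :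
    a.2 = b.2 := by
  obtain ⟨h1, h2⟩ := hl.head_eq hl' h
  have h3 : a.1 = b.1 := (List.cons.inj h1).1
  rw [h2, mul_right_inj, stableProd, stableProd, syllableProd_cons, syllableProd_cons, h3,
    mul_assoc, mul_assoc, mul_right_inj] at h
  exact (NoPinch.head_eq (List.isChain_cons.1 hl).2 (List.isChain_cons.1 hl').2 h).2

/-- The factor in front of `t ^ e` in the image of `T ^ e` under `T ↦ p * t`. -/
def before (p : K) (e : ℤˣ) : K := if e = 1 then p else 1

/-- The factor in front of a list of syllables after the substitution `T ↦ p * t`. -/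
def lead (p : K) (l : List (ℤˣ × N)) : K := (l.head?.map fun a => before p a.1).getD 1

/-- The syllables of the image of a list of syllables under `T ↦ p * t`, without the leading
factor. -/
def transform (g : N →* K) (p : K) : List (ℤˣ × N) → List (ℤˣ × K)
  | [] => []
  | a :: l => (a.1, (before p (-a.1))⁻¹ * g a.2 * lead p l) :: transform g p l

theorem map_fst_transform (g : N →* K) (p : K) (l : List (ℤˣ × N)) :
    (transform g p l).map Prod.fst = l.map Prod.fst := by
  induction l with
  | nil => rfl
  | cons a l ih => rw [transform, List.map_cons, ih, List.map_cons]

theorem length_transform (g : N →* K) (p : K) (l : List (ℤˣ × N)) :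
    (transform g p l).length = l.length := by
  simpa using congrArg List.length (map_fst_transform g p l)

/-- Between opposite powers of `t`, the new syllable is a conjugate of `g a.2`, which is trivial
only if `a.2` is. -/
theorem NoPinch.transform {g : N →* K} (hg : Function.Injective g) (p : K) {l : List (ℤˣ × N)}
    (hl : NoPinch l) : NoPinch (transform g p l) := by
  induction l with
  | nil => exact List.isChain_nil
  | cons a l ih =>
    cases l with
    | nil => exact List.isChain_singleton _
    | cons b l =>
      obtain ⟨h1, h2⟩ := List.isChain_cons_cons.1 hl
      refine List.isChain_cons_cons.2 ⟨fun h3 => ?_, ih h2⟩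
      by_contra hab
      have hb : b.1 = -a.1 := by
        rcases Int.units_eq_one_or a.1 with h1 | h1 <;>
          rcases Int.units_eq_one_or b.1 with h2 | h2 <;> simp_all
      simp only [lead, List.head?_cons, Option.map_some, Option.getD_some, hb] at h3
      have h4 : g a.2 = 1 := by
        rw [mul_assoc, inv_mul_eq_one, eq_comm, mul_eq_right] at h3
        exact h3
      exact hab (h1 (hg (by rw [h4, map_one])))

variable {ι : N →* X} {T : X} {γ : X →* FreeStable K} {g : N →* K} {p : K}

theorem map_syllableProd (hι : ∀ x, γ (ι x) = of (g x)) (hT : γ T = of p * HNNExtension.t)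
    (l : List (ℤˣ × N)) :
    γ (syllableProd ι T l) = of (lead p l) * stableProd (transform g p l) := by
  induction l with
  | nil => simp [syllableProd, lead, transform]
  | cons a l ih =>
    rw [syllableProd_cons, map_mul, map_mul, ih, hι, transform, stableProd, stableProd,
      syllableProd_cons, map_zpow, hT]
    rcases Int.units_eq_one_or a.1 with h | h <;> simp [lead, before, h, mul_assoc]

theorem map_mul_syllableProd (hι : ∀ x, γ (ι x) = of (g x)) (hT : γ T = of p * HNNExtension.t)
    (x : N) (l : List (ℤˣ × N)) :
    γ (ι x * syllableProd ι T l) = of (g x * lead p l) * stableProd (transform g p l) := by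
  rw [map_mul, hι, map_syllableProd hι hT, map_mul, mul_assoc]

theorem injective (hX : ∀ w : X, ∃ x l, w = ι x * syllableProd ι T l)
    (hι : ∀ x, γ (ι x) = of (g x)) (hT : γ T = of p * HNNExtension.t)
    (hg : Function.Injective g) : Function.Injective γ := by
  rw [injective_iff_map_eq_one]
  intro w hw
  obtain ⟨x₀, l₀, rfl⟩ := hX w
  obtain ⟨x, l, hl, h, -⟩ := exists_noPinch ι T x₀ l₀
  rw [← h] at hw ⊢
  rw [map_mul_syllableProd hι hT] at hw
  have := (hl.transform hg p).head_eq (x := g x * lead p l) (y := 1) (l' := []) List.isChain_nil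
    (by simpa [stableProd, syllableProd] using hw)
  rw [map_fst_transform] at this
  have hl0 : l = [] := by simpa using this.1
  subst hl0
  have hx : x = 1 := hg (by simpa [lead] using this.2)
  simp [hx, syllableProd]

variable {η : X →* FreeStable K} {h : N →* K} {q : K}

/-- Both images of a reduced `w` have normal forms with the same exponents, so their first factors
can be compared. If `w` starts with `x T`, this reads `g(x) p = h(x) q`. If it starts with `x T⁻¹
y`, the next factor gives `p⁻¹ g(y) = q⁻¹ h(y)`, solved by `y⁻¹`, unless `T` follows. The solutions
found are nontrivial because `p ≠ q`. -/
theorem exists_solution_of_injective (hX : ∀ w : X, ∃ x l, w = ι x * syllableProd ι T l)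
    (hγι : ∀ x, γ (ι x) = of (g x)) (hγT : γ T = of p * HNNExtension.t)
    (hηι : ∀ x, η (ι x) = of (h x)) (hηT : η T = of q * HNNExtension.t)
    (hg : Function.Injective g) (hci : ∀ u x, x ≠ 1 → g x ≠ u⁻¹ * h x * u) (hpq : p ≠ q) {w : X}
    (hw : w ≠ 1) (hwe : γ w = η w) : ∃ x, x ≠ 1 ∧ g x * p = h x * q := by
  obtain ⟨x₀, l₀, rfl⟩ := hX w
  obtain ⟨x, l, hl, hx, -⟩ := exists_noPinch ι T x₀ l₀
  rw [← hx] at hw hwe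
  rw [map_mul_syllableProd hγι hγT, map_mul_syllableProd hηι hηT] at hwe
  have h1 := hl.transform hg p
  have h2 := h1.of_eq (by rw [length_transform, length_transform]) hwe
  have h3 := (h1.head_eq h2 hwe).2
  have hci1 : ∀ x, g x = h x → x = 1 := fun x hx => by
    by_contra hx1
    exact hci 1 x hx1 (by simpa using hx)
  cases l with
  | nil =>
    refine absurd ?_ hw
    simp only [lead, List.head?_nil, Option.map_none, Option.getD_none, mul_one] at h3
    simp [hci1 x h3, syllableProd]
  | cons a l =>
    simp only [lead, List.head?_cons, Option.map_some, Option.getD_some] at h3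
    rcases Int.units_eq_one_or a.1 with ha | ha
    · simp only [before, ha, if_true] at h3
      refine ⟨x, fun hx1 => hpq ?_, h3⟩
      simpa [hx1] using h3
    · have hne : ¬ (-1 : ℤˣ) = 1 := by decide
      simp only [before, ha, hne, if_false, mul_one] at h3
      have h4 := h1.second_eq h2 hwe
      simp only [ha, before, neg_neg, if_true] at h4
      cases l with
      | nil =>
        simp only [lead, List.head?_nil, Option.map_none, Option.getD_none, mul_one] at h4
        refine ⟨a.2⁻¹, fun ha2 => hpq ?_, ?_⟩
        · simpa [inv_eq_one.1 ha2] using h4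
        · rw [map_inv, map_inv]
          simpa [mul_inv_rev] using congrArg Inv.inv h4
      | cons b l =>
        simp only [lead, List.head?_cons, Option.map_some, Option.getD_some, before] at h4
        have h5 := (List.isChain_cons_cons.1 hl).1
        rcases Int.units_eq_one_or b.1 with hb | hb
        -- In `T⁻¹ y T` the comparison says that `g(y)` and `h(y)` are conjugate, so `y = 1`, which
        -- is a pinch.
        · have ha2 : a.2 = 1 := by
            by_contra ha2
            refine hci (q * p⁻¹) a.2 ha2 ?_
            rw [hb, if_pos rfl, if_pos rfl] at h4
            have h6 := congrArg (fun z => p * z * p⁻¹) h4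
            simp only [mul_assoc, mul_inv_cancel_left, mul_inv_cancel, mul_one] at h6
            simp only [h6, mul_inv_rev, inv_inv, mul_assoc]
          have := h5 ha2
          rw [ha, hb] at this
          exact absurd this hne
        · simp only [hb, hne, if_false, mul_one] at h4
          refine ⟨a.2⁻¹, fun ha2 => hpq ?_, ?_⟩
          · simpa [inv_eq_one.1 ha2] using h4
          · rw [map_inv, map_inv]
            simpa [mul_inv_rev] using congrArg Inv.inv h4

end

end LetterExtension

open FreeGroup LetterExtension in
/-- The homomorphism `g'` extends `g` to one more letter, whose image is an element of the target of
`g` followed by a new letter. -/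
structure IsLetterExtension {n m m' : ℕ} (hm : m ≤ m') (g : FreeGroup (Fin n) →* FreeGroup (Fin m))
    (p : FreeGroup (Fin m)) (τ : Fin m') (g' : FreeGroup (Fin (n + 1)) →* FreeGroup (Fin m')) :
    Prop where
  map_incl : ∀ x, g' (FreeGroup.map Fin.castSucc x) = FreeGroup.map (Fin.castLE hm) (g x)
  map_last : g' (of (Fin.last n)) = FreeGroup.map (Fin.castLE hm) p * of τ
  le : m ≤ τ

namespace IsLetterExtension

open FreeGroup LetterExtension

theorem exists_syllables {n : ℕ} (w : FreeGroup (Fin (n + 1))) :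
    ∃ x l, w = FreeGroup.map Fin.castSucc x *
      syllableProd (FreeGroup.map Fin.castSucc) (of (Fin.last n)) l := by
  have h : ∀ L : List (Fin (n + 1) × Bool), ∃ x l, FreeGroup.mk L = FreeGroup.map Fin.castSucc x *
      syllableProd (FreeGroup.map Fin.castSucc) (of (Fin.last n)) l := by
    intro L
    induction L with
    | nil => exact ⟨1, [], by simp [syllableProd, one_eq_mk]⟩
    | cons s L ih =>
      obtain ⟨x, l, hxl⟩ := ih
      obtain ⟨i, b⟩ := s
      have hs : FreeGroup.mk ((i, b) :: L) = FreeGroup.mk [(i, b)] * FreeGroup.mk L := by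
        rw [mul_mk]; rfl
      rw [hs, hxl]
      induction i using Fin.lastCases with
      | last =>
        refine ⟨1, (if b = true then 1 else -1, x) :: l, ?_⟩
        rw [syllableProd_cons, _root_.map_one, one_mul, ← mul_assoc]
        congr 2
        cases b
        · simp [of, inv_mk, invRev]
        · simp [of]
      | cast i =>
        refine ⟨FreeGroup.mk [(i, b)] * x, l, ?_⟩
        rw [_root_.map_mul, map.mk, mul_assoc]
        rfl
  rw [← mk_toWord (x := w)]
  exact h _

/-- Identify all the letters `≥ m` with the stable letter. -/
def collapse (m m' : ℕ) : FreeGroup (Fin m') →* FreeStable (FreeGroup (Fin m)) :=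
  FreeGroup.lift fun i => if h : (i : ℕ) < m then HNNExtension.of (of ⟨i, h⟩) else HNNExtension.t

/-- `collapse` reduces targets with any number of new letters to the case of a single stable letter;
injectivity can be tested after it, and equalities persist under it. -/
theorem collapse_map {m m' : ℕ} (hm : m ≤ m') (x : FreeGroup (Fin m)) :
    collapse m m' (FreeGroup.map (Fin.castLE hm) x) = HNNExtension.of x := by
  have : (collapse m m').comp (FreeGroup.map (Fin.castLE hm)) = HNNExtension.of := by
    ext i
    simp [collapse]
  exact DFunLike.congr_fun this x

theorem collapse_of {m m' : ℕ} {τ : Fin m'} (h : m ≤ τ) : collapse m m' (of τ) = HNNExtension.t := by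
  simp [collapse, Nat.not_lt.2 h]

variable {n m m' : ℕ} {hm : m ≤ m'} {g h : FreeGroup (Fin n) →* FreeGroup (Fin m)}
  {p q : FreeGroup (Fin m)} {σ τ : Fin m'} {g' h' : FreeGroup (Fin (n + 1)) →* FreeGroup (Fin m')}

theorem collapse_incl (hg : IsLetterExtension hm g p σ g') (x : FreeGroup (Fin n)) :
    (collapse m m').comp g' (FreeGroup.map Fin.castSucc x) = HNNExtension.of (g x) := by
  rw [MonoidHom.comp_apply, hg.map_incl, collapse_map]

theorem collapse_last (hg : IsLetterExtension hm g p σ g') :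
    (collapse m m').comp g' (of (Fin.last n)) = HNNExtension.of p * HNNExtension.t := by
  rw [MonoidHom.comp_apply, hg.map_last, _root_.map_mul, collapse_map, collapse_of hg.le]

theorem injective (hg : IsLetterExtension hm g p σ g') (hinj : Function.Injective g) :
    Function.Injective g' :=
  Function.Injective.of_comp (f := collapse m m')
    (LetterExtension.injective exists_syllables hg.collapse_incl hg.collapse_last hinj)

theorem exists_solution (hg : IsLetterExtension hm g p σ g') (hh : IsLetterExtension hm h q τ h')
    (hinj : Function.Injective g ∨ Function.Injective h)
    (hci : ∀ u x, x ≠ 1 → g x ≠ u⁻¹ * h x * u) (hpq : p ≠ q) {w : FreeGroup (Fin (n + 1))}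
    (hw : w ≠ 1) (hwe : g' w = h' w) : ∃ x, x ≠ 1 ∧ g x * p = h x * q := by
  have he : (collapse m m').comp g' w = (collapse m m').comp h' w := congrArg (collapse m m') hwe
  rcases hinj with hinj | hinj
  · exact exists_solution_of_injective exists_syllables hg.collapse_incl hg.collapse_last
      hh.collapse_incl hh.collapse_last hinj hci hpq hw he
  -- The hypotheses are symmetric in the two maps, the conjugator being replaced by its inverse.
  · obtain ⟨x, hx, hx'⟩ := exists_solution_of_injective exists_syllables hh.collapse_incl
      hh.collapse_last hg.collapse_incl hg.collapse_last hinj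
      (fun u x hx hx' => hci u⁻¹ x hx (by rw [hx']; group)) hpq.symm hw he.symm
    exact ⟨x, hx, hx'.symm⟩

/-- The word is `x T`; it is nontrivial because its exponent sum in `T` is one, even when `x = 1`.
-/
theorem map_solution (hg : IsLetterExtension hm g p σ g') (hh : IsLetterExtension hm h q σ h')
    {x : FreeGroup (Fin n)} (hx : g x * p = h x * q) :
    ∃ w, w ≠ 1 ∧ g' w = h' w := by
  refine ⟨FreeGroup.map Fin.castSucc x * of (Fin.last n), fun h1 => ?_, ?_⟩
  · have := congrArg (FreeGroup.lift fun i => if i = Fin.last n then Multiplicative.ofAdd (1 : ℤ)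
      else 1) h1
    rw [_root_.map_mul, ← MonoidHom.comp_apply, show (FreeGroup.lift fun i => if i = Fin.last n then
      Multiplicative.ofAdd (1 : ℤ) else 1).comp (FreeGroup.map Fin.castSucc) = 1 by
        ext i; simp [Fin.castSucc_ne_last]] at this
    simp at this
  · rw [_root_.map_mul, _root_.map_mul, hg.map_incl, hg.map_last, hh.map_incl, hh.map_last,
      ← mul_assoc, ← mul_assoc, ← _root_.map_mul, ← _root_.map_mul, hx]

/-- Kill a generator. -/
def kill {k : ℕ} (i : Fin k) : FreeGroup (Fin k) →* FreeGroup (Fin k) :=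
  FreeGroup.lift fun j => if j = i then 1 else of j

theorem kill_map {σ : Fin m'} (hσ : m ≤ σ) (x : FreeGroup (Fin m)) :
    kill σ (FreeGroup.map (Fin.castLE hm) x) = FreeGroup.map (Fin.castLE hm) x := by
  have : (kill σ).comp (FreeGroup.map (Fin.castLE hm)) = FreeGroup.map (Fin.castLE hm) := by
    ext i
    have : Fin.castLE hm i ≠ σ := fun h => by
      have := congrArg Fin.val h
      simp only [Fin.val_castLE] at this
      omega
    simp [kill, this]
  exact DFunLike.congr_fun this x

theorem kill_last_castSucc (x : FreeGroup (Fin n)) :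
    kill (Fin.last n) (FreeGroup.map Fin.castSucc x) = FreeGroup.map Fin.castSucc x := by
  have : (kill (Fin.last n)).comp (FreeGroup.map Fin.castSucc) = FreeGroup.map Fin.castSucc := by
    ext i
    simp [kill, Fin.castSucc_ne_last]
  exact DFunLike.congr_fun this x

theorem exists_kill_last (w : FreeGroup (Fin (n + 1))) :
    ∃ x, kill (Fin.last n) w = FreeGroup.map Fin.castSucc x := by
  refine ⟨FreeGroup.lift (fun i => Fin.lastCases (motive := fun _ => FreeGroup (Fin n)) 1 of i) w, ?_⟩
  rw [← MonoidHom.comp_apply]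
  refine DFunLike.congr_fun ?_ w
  ext i
  induction i using Fin.lastCases <;> simp [kill, Fin.castSucc_ne_last]

theorem hom_ext {H : Type*} [Group H] {f₁ f₂ : FreeGroup (Fin (n + 1)) →* H}
    (h1 : ∀ x, f₁ (FreeGroup.map Fin.castSucc x) = f₂ (FreeGroup.map Fin.castSucc x))
    (h2 : f₁ (of (Fin.last n)) = f₂ (of (Fin.last n))) : f₁ = f₂ := by
  ext i
  induction i using Fin.lastCases with
  | last => exact h2
  | cast i => simpa using h1 (of i)

theorem kill_self (hg : IsLetterExtension hm g 1 σ g') (w : FreeGroup (Fin (n + 1))) :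
    kill σ (g' w) = g' (kill (Fin.last n) w) := by
  rw [← MonoidHom.comp_apply, ← MonoidHom.comp_apply]
  refine DFunLike.congr_fun (hom_ext (fun x => ?_) ?_) w
  · rw [MonoidHom.comp_apply, MonoidHom.comp_apply, kill_last_castSucc, hg.map_incl, kill_map hg.le]
  · rw [MonoidHom.comp_apply, MonoidHom.comp_apply, hg.map_last]
    simp [kill]

theorem kill_of_ne (hg : IsLetterExtension hm g 1 σ g') (hτ : m ≤ τ) (hστ : σ ≠ τ)
    (w : FreeGroup (Fin (n + 1))) : kill τ (g' w) = g' w := by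
  rw [← MonoidHom.comp_apply]
  refine DFunLike.congr_fun (hom_ext (fun x => ?_) ?_) w
  · rw [MonoidHom.comp_apply, hg.map_incl, kill_map hτ]
  · rw [MonoidHom.comp_apply, hg.map_last]
    simp [kill, hστ]

/-- If the new letter has different new letters as images, the equaliser does not change. -/
theorem exists_incl_of_ne (hg : IsLetterExtension hm g 1 σ g') (hh : IsLetterExtension hm h 1 τ h')
    (hinj : Function.Injective g ∨ Function.Injective h) (hστ : σ ≠ τ)
    {w : FreeGroup (Fin (n + 1))} (hwe : g' w = h' w) :
    ∃ x, g x = h x ∧ FreeGroup.map Fin.castSucc x = w := by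
  -- Killing `σ` in the target amounts to killing the new letter for `g'` and does nothing for `h'`;
  -- killing `τ` does the reverse. Injectivity of either map then shows that the new letter is
  -- absent from `w`.
  have h1 : g' (kill (Fin.last n) w) = h' w := by
    rw [← hg.kill_self, hwe, hh.kill_of_ne hg.le hστ.symm]
  have h2 : g' w = h' (kill (Fin.last n) w) := by
    rw [← hh.kill_self, ← hwe, hg.kill_of_ne hh.le hστ]
  have h3 : kill (Fin.last n) w = w := by
    rcases hinj with hinj | hinj
    · exact hg.injective hinj (h1.trans hwe.symm)
    · exact hh.injective hinj (h2.symm.trans hwe)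
  obtain ⟨x, hx⟩ := exists_kill_last w
  rw [h3] at hx
  refine ⟨x, ?_, hx.symm⟩
  rw [hx, hg.map_incl, hh.map_incl] at hwe
  exact FreeGroup.map_injective (Fin.castLE_injective hm) hwe

end IsLetterExtension

/-- Letters `≥ m` are ignored over `Fin m` but some become genuine letters over `Fin m'`; words have
to be clipped before the alphabet is enlarged. -/
theorem Word.toFree_clip {m m' : ℕ} (hm : m ≤ m') (w : Word) :
    Word.toFree m' (Word.clip m w) = FreeGroup.map (Fin.castLE hm) (Word.toFree m w) := by
  apply Word.map_val_injective
  rw [Word.map_val_toFree, FreeGroup.map.comp]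
  have : Fin.val ∘ Fin.castLE hm = Fin.val := rfl
  rw [this, Word.map_val_toFree]
  congr 1
  refine List.filter_eq_self.2 fun p hp => ?_
  have := (List.mem_filter.1 hp).2
  simp only [decide_eq_true_eq] at this ⊢
  omega

/-- Cancelling `u₁` and conjugating `h` by `k = u₁⁻¹ v₁` gives `g(x) u₂ = (k h(x) k⁻¹) (k v₂)`. The
first extension encodes this equation; the second, with distinct new images, only pads the source.
-/
theorem IsLetterExtension.exists_eq_iff {n m m₁ m₂ : ℕ} {hm₁ : m ≤ m₁} {hm₂ : m₁ ≤ m₂}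
    {g h : FreeGroup (Fin n) →* FreeGroup (Fin m)} {u₁ u₂ v₁ v₂ : FreeGroup (Fin m)}
    {τ₁ : Fin m₁} {g₁ h₁ : FreeGroup (Fin (n + 1)) →* FreeGroup (Fin m₁)}
    {σ τ : Fin m₂} {g₂ h₂ : FreeGroup (Fin (n + 1 + 1)) →* FreeGroup (Fin m₂)}
    (hg₁ : IsLetterExtension hm₁ g u₂ τ₁ g₁)
    (hh₁ : IsLetterExtension hm₁ ((MulAut.conj (u₁⁻¹ * v₁)).toMonoidHom.comp h)
      (u₁⁻¹ * v₁ * v₂) τ₁ h₁)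
    (hg₂ : IsLetterExtension hm₂ g₁ 1 σ g₂) (hh₂ : IsLetterExtension hm₂ h₁ 1 τ h₂) (hστ : σ ≠ τ)
    (hinj : Function.Injective g ∨ Function.Injective h)
    (hci : ∀ u, ¬ ∃ x, x ≠ 1 ∧ g x = u⁻¹ * h x * u) (huv : u₁ * u₂ ≠ v₁ * v₂) :
    (∃ w, w ≠ 1 ∧ g₂ w = h₂ w) ↔ ∃ x, x ≠ 1 ∧ u₁ * g x * u₂ = v₁ * h x * v₂ := by
  have hsol : ∀ x, g x * u₂ = (MulAut.conj (u₁⁻¹ * v₁)).toMonoidHom.comp h x * (u₁⁻¹ * v₁ * v₂) ↔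
      u₁ * g x * u₂ = v₁ * h x * v₂ := fun x => by
    rw [← mul_right_inj u₁]
    refine Eq.congr (mul_assoc _ _ _).symm ?_
    simp [mul_assoc]
  have hinj' : Function.Injective g ∨
      Function.Injective ((MulAut.conj (u₁⁻¹ * v₁)).toMonoidHom.comp h) :=
    hinj.imp id (MulAut.conj (u₁⁻¹ * v₁)).injective.comp
  constructor
  · rintro ⟨w, hw, hwe⟩
    obtain ⟨y, hy, rfl⟩ := hg₂.exists_incl_of_ne hh₂ (hinj'.imp hg₁.injective hh₁.injective) hστ hwe
    have hy1 : y ≠ 1 := fun h => hw (by rw [h, map_one])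
    have hpq : u₂ ≠ u₁⁻¹ * v₁ * v₂ := fun h => huv (by rw [h]; group)
    -- Conjugacy inequivalence is insensitive to the conjugation of `h`, the conjugator `u` becoming
    -- `k⁻¹ u`.
    obtain ⟨x, hx, hxe⟩ := hg₁.exists_solution hh₁ hinj' (fun u x hx hxe =>
      hci ((u₁⁻¹ * v₁)⁻¹ * u) ⟨x, hx, hxe.trans (by simp [mul_assoc])⟩) hpq hy1 hy
    exact ⟨x, hx, (hsol x).1 hxe⟩
  · rintro ⟨x, hx, hxe⟩
    obtain ⟨y, hy, hye⟩ := hg₁.map_solution hh₁ ((hsol x).2 hxe)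
    refine ⟨FreeGroup.map Fin.castSucc y, fun h => hy ?_, ?_⟩
    · exact FreeGroup.map_injective (Fin.castSucc_injective _) (h.trans (map_one _).symm)
    · rw [hg₂.map_incl, hh₂.map_incl, hye]

/-! ### Letter extensions of coded instances -/

namespace PCPInstance

open FreeGroup

/-- The images of the letters under the extension of a homomorphism which sends a new letter to
`p` followed by the letter `τ`. -/
def adjoinWord (n m : ℕ) (L : List Word) (p : Word) (τ : ℕ) : List Word :=
  (List.range n).map (fun i => Word.clip m (L.getD i [])) ++ [Word.clip m p ++ [(τ, true)]]

theorem isLetterExtension_adjoinWord {n m m' : ℕ} (hm : m ≤ m') (L : List Word) (p : Word)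
    {τ : Fin m'} (hτ : m ≤ τ) : IsLetterExtension hm (homOfWords n m L) (Word.toFree m p) τ
      (homOfWords (n + 1) m' (adjoinWord n m L p τ)) where
  map_incl x := by
    rw [← MonoidHom.comp_apply, ← MonoidHom.comp_apply]
    refine DFunLike.congr_fun ?_ x
    ext i
    rw [MonoidHom.comp_apply, MonoidHom.comp_apply, map.of, Transducer.homOfWords_of,
      Transducer.homOfWords_of, ← Word.toFree_clip hm]
    congr 1
    simp [adjoinWord, List.getD_eq_getElem?_getD]
  map_last := by
    rw [Transducer.homOfWords_of, ← Word.toFree_clip hm, ← Word.toFree_singleton_true,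
      ← Word.toFree_append]
    congr 1
    simp [adjoinWord, List.getD_eq_getElem?_getD]
  le := hτ

/-- Adjoin a letter to the source, sent to `p σ` and to `q τ`. -/
def adjoin (I : PCPInstance) (m : ℕ) (p q : Word) (σ τ : ℕ) : PCPInstance :=
  ((I.src + 1, m), adjoinWord I.src I.tgt I.2.1 p σ, adjoinWord I.src I.tgt I.2.2 q τ)

/-- Conjugate the second homomorphism. -/
def conjRight (I : PCPInstance) (k : Word) : PCPInstance :=
  (I.1, I.2.1, I.2.2.map fun w => k ++ (w ++ invRev k))

theorem homOfWords_map_conj {n m : ℕ} (L : List Word) (k : Word) :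
    homOfWords n m (L.map fun w => k ++ (w ++ invRev k)) =
      (MulAut.conj (Word.toFree m k)).toMonoidHom.comp (homOfWords n m L) := by
  ext i
  rw [MonoidHom.comp_apply, Transducer.homOfWords_of, Transducer.homOfWords_of,
    List.getD_eq_getElem?_getD, List.getD_eq_getElem?_getD, List.getElem?_map]
  cases L[(i : ℕ)]? <;> simp [mul_assoc]

section

variable {α : Type} [Primcodable α]

theorem primrec_adjoinWord {n m τ : α → ℕ} {L : α → List Word} {p : α → Word} (hn : Primrec n)
    (hm : Primrec m) (hL : Primrec L) (hp : Primrec p) (hτ : Primrec τ) :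
    Primrec fun a => adjoinWord (n a) (m a) (L a) (p a) (τ a) := by
  refine Primrec.list_append.comp (Primrec.list_map (Primrec.list_range.comp hn) ?_)
    (Primrec.list_cons.comp (Primrec.list_append.comp (Word.primrec_clip.comp hm hp)
      (Primrec.list_cons.comp (hτ.pair (Primrec.const true)) (Primrec.const [])))
      (Primrec.const []))
  exact Word.primrec_clip.comp (hm.comp Primrec.fst)
    (Word.primrec_getD (hL.comp Primrec.fst) Primrec.snd)

theorem primrec_adjoin {I : α → PCPInstance} {m σ τ : α → ℕ} {p q : α → Word} (hI : Primrec I)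
    (hm : Primrec m) (hp : Primrec p) (hq : Primrec q) (hσ : Primrec σ) (hτ : Primrec τ) :
    Primrec fun a => (I a).adjoin (m a) (p a) (q a) (σ a) (τ a) := by
  have hs : Primrec fun a => (I a).src := Primrec.fst.comp (Primrec.fst.comp hI)
  have ht : Primrec fun a => (I a).tgt := Primrec.snd.comp (Primrec.fst.comp hI)
  exact ((Primrec.succ.comp hs).pair hm).pair
    ((primrec_adjoinWord hs ht (Primrec.fst.comp (Primrec.snd.comp hI)) hp hσ).pair
      (primrec_adjoinWord hs ht (Primrec.snd.comp (Primrec.snd.comp hI)) hq hτ))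

theorem primrec_conjRight {I : α → PCPInstance} {k : α → Word} (hI : Primrec I) (hk : Primrec k) :
    Primrec fun a => (I a).conjRight (k a) := by
  refine (Primrec.fst.comp hI).pair ((Primrec.fst.comp (Primrec.snd.comp hI)).pair
    (Primrec.list_map (Primrec.snd.comp (Primrec.snd.comp hI)) ?_))
  exact Primrec.list_append.comp (hk.comp Primrec.fst) (Primrec.list_append.comp Primrec.snd
    (Word.primrec_invRev.comp (hk.comp Primrec.fst)))

end

end PCPInstance

/-! ### From conjugacy inequivalent generalised instances to the Post correspondence problem -/

namespace GPCPInstance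

open FreeGroup PCPInstance

/-- The solutions are those of `g(x) u₂ = k h(x) k⁻¹ k v₂`, where `k = u₁⁻¹ v₁`; a letter with
images `u₂ τ` and `k v₂ τ`, and a letter whose images are two further letters, are adjoined. -/
def toPCP (J : GPCPInstance) : PCPInstance :=
  ((J.1.conjRight (invRev J.2.1 ++ J.2.2.2.1)).adjoin (J.1.tgt + 1) J.2.2.1
    (invRev J.2.1 ++ J.2.2.2.1 ++ J.2.2.2.2) J.1.tgt J.1.tgt).adjoin (J.1.tgt + 3) [] []
      (J.1.tgt + 1) (J.1.tgt + 2)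

/-- `u₁ u₂ = v₁ v₂`. -/
def IsBalanced (J : GPCPInstance) : Prop :=
  Word.toFree J.1.tgt (J.2.1 ++ J.2.2.1) = Word.toFree J.1.tgt (J.2.2.2.1 ++ J.2.2.2.2)

theorem exists_toPCP_iff {J : GPCPInstance} (hinj : J.1.IsInj) (hci : J.1.IsCI)
    (hJ : ¬ J.IsBalanced) : (∃ w : FreeGroup (Fin J.toPCP.src), w ≠ 1 ∧ J.toPCP.g w = J.toPCP.h w) ↔
      J.HasSolution := by
  obtain ⟨⟨⟨n, m⟩, Lg, Lh⟩, u₁, u₂, v₁, v₂⟩ := J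
  have hg₁ := isLetterExtension_adjoinWord (n := n) (Nat.le_succ m) Lg u₂ (τ := Fin.last m) le_rfl
  have hh₁ := isLetterExtension_adjoinWord (n := n) (Nat.le_succ m)
    (Lh.map fun w => invRev u₁ ++ v₁ ++ (w ++ invRev (invRev u₁ ++ v₁)))
    (invRev u₁ ++ v₁ ++ v₂) (τ := Fin.last m) le_rfl
  have hg₂ := isLetterExtension_adjoinWord (n := n + 1) (Nat.le_add_right (m + 1) 2)
    (adjoinWord n m Lg u₂ m) [] (τ := ⟨m + 1, by omega⟩) le_rfl
  have hh₂ := isLetterExtension_adjoinWord (n := n + 1) (Nat.le_add_right (m + 1) 2)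
    (adjoinWord n m (Lh.map fun w => invRev u₁ ++ v₁ ++ (w ++ invRev (invRev u₁ ++ v₁)))
      (invRev u₁ ++ v₁ ++ v₂) m) [] (τ := ⟨m + 2, by omega⟩) (Nat.le_succ (m + 1))
  rw [homOfWords_map_conj] at hh₁
  simp only [Word.toFree_append, Word.toFree_invRev] at hh₁
  have hne : (⟨m + 1, by omega⟩ : Fin (m + 1 + 2)) ≠ ⟨m + 2, by omega⟩ := by simp
  exact IsLetterExtension.exists_eq_iff hg₁ hh₁ hg₂ hh₂ hne hinj hci
    (fun h => hJ (by simpa [IsBalanced] using h))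

/-- If `u₁ u₂ = v₁ v₂`, the equation says that `g(x)` is a conjugate of `h(x)`. -/
theorem not_hasSolution_of_isBalanced {J : GPCPInstance} (hci : J.1.IsCI) (hJ : J.IsBalanced) :
    ¬ J.HasSolution := by
  rintro ⟨x, hx, hxe⟩
  obtain ⟨I, u₁, u₂, v₁, v₂⟩ := J
  simp only [IsBalanced, Word.toFree_append] at hJ
  simp only at hxe
  refine hci ((Word.toFree I.tgt v₁)⁻¹ * Word.toFree I.tgt u₁) ⟨x, hx, ?_⟩
  have h1 : Word.toFree I.tgt u₂ = (Word.toFree I.tgt u₁)⁻¹ * (Word.toFree I.tgt v₁ *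
      Word.toFree I.tgt v₂) := by rw [← hJ]; group
  rw [h1] at hxe
  simp only [mul_inv_rev, inv_inv, mul_assoc] at hxe ⊢
  have h2 := congrArg (fun z => (Word.toFree I.tgt u₁)⁻¹ * z * (Word.toFree I.tgt v₂)⁻¹ *
    (Word.toFree I.tgt v₁)⁻¹ * Word.toFree I.tgt u₁) hxe
  simpa [mul_assoc] using h2

theorem primrec_toPCP : Primrec toPCP := by
  have hI : Primrec fun J : GPCPInstance => J.1 := Primrec.fst
  have ht : Primrec fun J : GPCPInstance => J.1.tgt := Primrec.snd.comp (Primrec.fst.comp hI)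
  have h2 : Primrec fun J : GPCPInstance => J.2.2.1 :=
    Primrec.fst.comp (Primrec.snd.comp Primrec.snd)
  have h4 : Primrec fun J : GPCPInstance => J.2.2.2.2 :=
    Primrec.snd.comp (Primrec.snd.comp (Primrec.snd.comp Primrec.snd))
  have hk : Primrec fun J : GPCPInstance => invRev J.2.1 ++ J.2.2.2.1 :=
    Primrec.list_append.comp (Word.primrec_invRev.comp (Primrec.fst.comp Primrec.snd))
      (Primrec.fst.comp (Primrec.snd.comp (Primrec.snd.comp Primrec.snd)))
  exact primrec_adjoin (primrec_adjoin (primrec_conjRight hI hk) (Primrec.succ.comp ht) h2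
    (Primrec.list_append.comp hk h4) ht ht) (Primrec.nat_add.comp ht (Primrec.const 3))
    (Primrec.const []) (Primrec.const []) (Primrec.succ.comp ht)
    (Primrec.nat_add.comp ht (Primrec.const 2))

theorem primrecPred_isBalanced : PrimrecPred IsBalanced := by
  have ht : Primrec fun J : GPCPInstance => J.1.tgt := Primrec.snd.comp (Primrec.fst.comp Primrec.fst)
  refine PrimrecPred.of_iff (p := fun J : GPCPInstance => Word.red J.1.tgt (J.2.1 ++ J.2.2.1) =
    Word.red J.1.tgt (J.2.2.2.1 ++ J.2.2.2.2)) (PrimrecPred.eq_comp ?_ ?_)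
    fun J => Word.red_eq_iff.symm
  · exact Word.primrec_red.comp ht (Primrec.list_append.comp (Primrec.fst.comp Primrec.snd)
      (Primrec.fst.comp (Primrec.snd.comp Primrec.snd)))
  · exact Word.primrec_red.comp ht (Primrec.list_append.comp
      (Primrec.fst.comp (Primrec.snd.comp (Primrec.snd.comp Primrec.snd)))
      (Primrec.snd.comp (Primrec.snd.comp (Primrec.snd.comp Primrec.snd))))

end GPCPInstance

/-- Balanced inputs are answered negatively at once, the others through `toPCP`. The target gains
three letters: the stable letter and the two images of the padding letter. -/
theorem PCP.gpcpInjCI {S S' : Set (ℕ × ℕ)} (hS' : PCP S')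
    (h : ∀ n m, (n, m) ∈ S → (n + 2, m + 3) ∈ S') : GPCPinjCI S := by
  classical
  refine Solvable.bind (dom := fun J : GPCPInstance => J.1.size ∈ S ∧ J.1.IsInj ∧ J.1.IsCI)
    (hS'.comp GPCPInstance.primrec_toPCP.to_comp fun J hJ => ⟨h _ _ hJ.1, fun _ hb => hb⟩)
    (dom' := fun _ => True) (ans' := fun x c => c = (x.2 && decide (¬ x.1.IsBalanced)))
    (Solvable.of_computable (f := fun x : GPCPInstance × Bool => x.2 && decide (¬ x.1.IsBalanced))
      (Primrec.to_comp (Primrec.and.comp Primrec.snd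
        (GPCPInstance.primrecPred_isBalanced.not.comp Primrec.fst).decide)) fun _ _ => rfl)
    fun J hJ b hb => ⟨trivial, ?_⟩
  rintro c rfl
  by_cases hbal : J.IsBalanced
  · simpa [hbal] using GPCPInstance.not_hasSolution_of_isBalanced hJ.2.2 hbal
  · simpa [hbal] using hb.trans (GPCPInstance.exists_toPCP_iff hJ.2.1 hJ.2.2 hbal)

/-! ### The rational sets of words `B⁻¹ x c` -/

namespace AutomatonCode

open FreeGroup

/-- The automaton reading `B⁻¹ x c`, where `x` is a word in the first `n` letters, `B` is the next
letter and `c` is a given letter. -/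
def bracket (n : ℕ) (c : ℕ × Bool) : AutomatonCode :=
  (3, (0, (n, false), 1) :: (1, c, 2) ::
    (LabelledGraph.signedLetters n).map fun s => (1, s, 1), [0], [2])

/-- The inclusion of the free group on `n` letters. -/
abbrev inclTwo (n : ℕ) : FreeGroup (Fin n) →* FreeGroup (Fin (n + 2)) :=
  (FreeGroup.map Fin.castSucc).comp (FreeGroup.map Fin.castSucc)

variable {n : ℕ} {c : Fin (n + 2) × Bool}

theorem mem_bracket_transitions {t : ℕ × (ℕ × Bool) × ℕ} {c : ℕ × Bool} :
    t ∈ (bracket n c).2.1 ↔ t = (0, (n, false), 1) ∨ t = (1, c, 2) ∨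
      t.1 = 1 ∧ t.2.1.1 < n ∧ t.2.2 = 1 := by
  obtain ⟨p, s, q⟩ := t
  simp only [bracket, List.mem_cons, List.mem_map, LabelledGraph.mem_signedLetters]
  refine or_congr_right (or_congr_right ⟨?_, ?_⟩)
  · rintro ⟨s', hs, h⟩
    simp only [Prod.mk.injEq] at h
    obtain ⟨rfl, rfl, rfl⟩ := h
    exact ⟨rfl, hs, rfl⟩
  · rintro ⟨h1, hs, h2⟩
    exact ⟨s, hs, by simp_all⟩

/-- The automaton over the alphabet with two more letters. -/
abbrev bracketNFA (n : ℕ) (c : Fin (n + 2) × Bool) : NFA (Fin (n + 2) × Bool) (Fin 3) :=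
  (bracket n ((c.1 : ℕ), c.2)).toNFA (n + 2)

theorem mem_step_bracket {p q : Fin 3} {a : Fin (n + 2) × Bool} :
    q ∈ (bracketNFA n c).step p a ↔
      p = 0 ∧ a = ((Fin.last n).castSucc, false) ∧ q = 1 ∨ p = 1 ∧ a = c ∧ q = 2 ∨
      p = 1 ∧ (a.1 : ℕ) < n ∧ q = 1 := by
  refine mem_bracket_transitions.trans ?_
  simp only [Fin.ext_iff, Prod.ext_iff]
  rfl

/-- The three states say how much of `B⁻¹ x c` has been read: nothing, `B⁻¹` and a part of `x`,
everything. -/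
theorem eval_bracket {w : List (Fin (n + 2) × Bool)} {q : Fin 3}
    (hq : q ∈ (bracketNFA n c).eval w) :
    q = 0 ∧ w = [] ∨
    q = 1 ∧ (∃ y, FreeGroup.mk w = (of (Fin.last n).castSucc)⁻¹ * inclTwo n y) ∨
    q = 2 ∧ ∃ y, FreeGroup.mk w = (of (Fin.last n).castSucc)⁻¹ * inclTwo n y * FreeGroup.mk [c] := by
  induction w using List.reverseRecOn generalizing q with
  | nil =>
    have : (q : ℕ) ∈ [0] := hq
    exact Or.inl ⟨Fin.ext (List.mem_singleton.1 this), rfl⟩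
  | append_singleton w a ih =>
    rw [NFA.eval_append_singleton, NFA.mem_stepSet] at hq
    obtain ⟨p, hp, hpq⟩ := hq
    rw [LabelledGraph.mk_snoc]
    rcases mem_step_bracket.1 hpq with ⟨rfl, rfl, rfl⟩ | ⟨rfl, rfl, rfl⟩ | ⟨rfl, ha, rfl⟩
    · rcases ih hp with ⟨-, rfl⟩ | ⟨h, -⟩ | ⟨h, -⟩
      · exact Or.inr (Or.inl ⟨rfl, 1, by rw [_root_.map_one, mul_one]; rfl⟩)
      · exact absurd h (by decide)
      · exact absurd h (by decide)
    · rcases ih hp with ⟨h, -⟩ | ⟨-, y, hy⟩ | ⟨h, -⟩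
      · exact absurd h (by decide)
      · exact Or.inr (Or.inr ⟨rfl, y, by rw [hy]⟩)
      · exact absurd h (by decide)
    · rcases ih hp with ⟨h, -⟩ | ⟨-, y, hy⟩ | ⟨h, -⟩
      · exact absurd h (by decide)
      · refine Or.inr (Or.inl ⟨rfl, y * FreeGroup.mk [(⟨a.1, ha⟩, a.2)], ?_⟩)
        rw [hy, _root_.map_mul, mul_assoc]
        rfl
      · exact absurd h (by decide)

theorem one_mem_eval_bracket (l : List (Fin n × Bool)) :
    1 ∈ (bracketNFA n c).eval
      (((Fin.last n).castSucc, false) :: l.map fun s => (s.1.castSucc.castSucc, s.2)) := by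
  induction l using List.reverseRecOn with
  | nil =>
    rw [List.map_nil, ← List.nil_append [_], NFA.eval_append_singleton, NFA.mem_stepSet]
    exact ⟨0, List.mem_singleton_self 0, mem_step_bracket.2 (Or.inl ⟨rfl, rfl, rfl⟩)⟩
  | append_singleton l s ih =>
    rw [List.map_append, List.map_singleton, ← List.cons_append, NFA.eval_append_singleton,
      NFA.mem_stepSet]
    exact ⟨1, ih, mem_step_bracket.2 (Or.inr (Or.inr ⟨rfl, s.1.2, rfl⟩))⟩

theorem rationalSet_bracket (n : ℕ) (c : Fin (n + 2) × Bool) :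
    (bracket n ((c.1 : ℕ), c.2)).rationalSet (n + 2) =
      {x | ∃ y, x = (of (Fin.last n).castSucc)⁻¹ * inclTwo n y * FreeGroup.mk [c]} := by
  ext x
  constructor
  · rintro ⟨w, ⟨(q : Fin 3), hq, hw⟩, rfl⟩
    change (q : ℕ) ∈ [2] at hq
    have hq2 : q = 2 := Fin.ext (List.mem_singleton.1 hq)
    subst hq2
    rcases eval_bracket hw with ⟨h, -⟩ | ⟨h, -⟩ | ⟨-, h⟩
    · exact absurd h (by decide)
    · exact absurd h (by decide)
    · exact h
  · rintro ⟨y, rfl⟩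
    refine ⟨(((Fin.last n).castSucc, false) ::
      y.toWord.map fun s => (s.1.castSucc.castSucc, s.2)) ++ [c],
      ⟨(2 : Fin 3), List.mem_singleton_self 2, ?_⟩, ?_⟩
    · have : (2 : Fin 3) ∈ (bracketNFA n c).eval ((((Fin.last n).castSucc, false) ::
          y.toWord.map fun s => (s.1.castSucc.castSucc, s.2)) ++ [c]) := by
        rw [NFA.eval_append_singleton, NFA.mem_stepSet]
        exact ⟨1, one_mem_eval_bracket _, mem_step_bracket.2 (Or.inr (Or.inl ⟨rfl, rfl, rfl⟩))⟩
      exact this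
    · rw [LabelledGraph.mk_snoc]
      congr 1
      conv_rhs => rw [← mk_toWord (x := y)]
      rw [MonoidHom.comp_apply, map.mk, map.mk, of, inv_mk, mul_mk]
      simp [invRev, Function.comp_def]

theorem primrec_bracket {α : Type} [Primcodable α] {n : α → ℕ} {c : α → ℕ × Bool} (hn : Primrec n)
    (hc : Primrec c) : Primrec fun a => bracket (n a) (c a) := by
  refine (Primrec.const 3).pair (Primrec.pair (Primrec.list_cons.comp
    ((Primrec.const 0).pair ((hn.pair (Primrec.const false)).pair (Primrec.const 1)))
    (Primrec.list_cons.comp ((Primrec.const 1).pair (hc.pair (Primrec.const 2)))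
      (Primrec.list_map (LabelledGraph.primrec_signedLetters.comp hn)
        ((Primrec.const 1).pair (Primrec.snd.pair (Primrec.const 1)))))) ?_)
  exact (Primrec.const [0]).pair (Primrec.const [2])

end AutomatonCode

namespace IsLetterExtension

open FreeGroup AutomatonCode

variable {n m m₁ m₂ : ℕ} {hm₁ : m ≤ m₁} {hm₂ : m₁ ≤ m₂}
  {g h : FreeGroup (Fin n) →* FreeGroup (Fin m)} {u₁ u₂ v₁ v₂ : FreeGroup (Fin m)}
  {τ₁ : Fin m₁} {g₁ h₁ : FreeGroup (Fin (n + 1)) →* FreeGroup (Fin m₁)}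
  {τ : Fin m₂} {g₂ h₂ : FreeGroup (Fin (n + 2)) →* FreeGroup (Fin m₂)}

/-- The prefix `B⁻¹` contributes `β⁻¹ u₁` and the suffix `E` contributes `u₂ ε`; the outer letters
are shared by the two maps and cancel in an equation. -/
theorem map_bracket_last (hg₁ : IsLetterExtension hm₁ g u₁⁻¹ τ₁ g₁)
    (hg₂ : IsLetterExtension hm₂ g₁ (FreeGroup.map (Fin.castLE hm₁) u₂) τ g₂)
    (x : FreeGroup (Fin n)) :
    g₂ ((of (Fin.last n).castSucc)⁻¹ * inclTwo n x * of (Fin.last (n + 1))) =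
      (FreeGroup.map (Fin.castLE hm₂) (of τ₁))⁻¹ *
        FreeGroup.map (Fin.castLE hm₂) (FreeGroup.map (Fin.castLE hm₁) (u₁ * g x * u₂)) * of τ := by
  rw [_root_.map_mul, _root_.map_mul, _root_.map_inv, ← map.of, hg₂.map_incl, hg₁.map_last,
    MonoidHom.comp_apply, hg₂.map_incl, hg₁.map_incl, hg₂.map_last]
  simp only [_root_.map_mul, _root_.map_inv, mul_inv_rev, inv_inv, mul_assoc]

theorem map_bracket_castSucc (hg₁ : IsLetterExtension hm₁ g u₁⁻¹ τ₁ g₁)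
    (hg₂ : IsLetterExtension hm₂ g₁ (FreeGroup.map (Fin.castLE hm₁) u₂) τ g₂)
    (x : FreeGroup (Fin n)) :
    g₂ ((of (Fin.last n).castSucc)⁻¹ * inclTwo n x * of (Fin.last n).castSucc) =
      (FreeGroup.map (Fin.castLE hm₂) (of τ₁))⁻¹ *
        FreeGroup.map (Fin.castLE hm₂) (FreeGroup.map (Fin.castLE hm₁) (u₁ * g x * u₁⁻¹)) *
          FreeGroup.map (Fin.castLE hm₂) (of τ₁) := by
  rw [_root_.map_mul, _root_.map_mul, _root_.map_inv, ← map.of, hg₂.map_incl, hg₁.map_last,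
    MonoidHom.comp_apply, hg₂.map_incl, hg₁.map_incl]
  simp only [_root_.map_mul, _root_.map_inv, mul_inv_rev, inv_inv, mul_assoc]

theorem map_map_castLE_inj {x y : FreeGroup (Fin m)} :
    FreeGroup.map (Fin.castLE hm₂) (FreeGroup.map (Fin.castLE hm₁) x) =
      FreeGroup.map (Fin.castLE hm₂) (FreeGroup.map (Fin.castLE hm₁) y) ↔ x = y :=
  ((FreeGroup.map_injective (Fin.castLE_injective hm₂)).comp
    (FreeGroup.map_injective (Fin.castLE_injective hm₁))).eq_iff

/-- The letter following the word `x` in the words `B⁻¹ x c` which encode the solutions. -/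
def closing (n : ℕ) (P : Prop) [Decidable P] : Fin (n + 2) :=
  if P then (Fin.last n).castSucc else Fin.last (n + 1)

/-- In the unbalanced case `x = 1` is no solution, so the nontrivial words `B⁻¹ x E` encode exactly
the solutions. In the balanced case the equation is equivalent to `u₁ g(x) u₁⁻¹ = v₁ h(x) v₁⁻¹`, and
`B⁻¹ x B` is trivial exactly when `x` is. -/
theorem exists_mem_bracket_iff (hg₁ : IsLetterExtension hm₁ g u₁⁻¹ τ₁ g₁)
    (hh₁ : IsLetterExtension hm₁ h v₁⁻¹ τ₁ h₁)
    (hg₂ : IsLetterExtension hm₂ g₁ (FreeGroup.map (Fin.castLE hm₁) u₂) τ g₂)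
    (hh₂ : IsLetterExtension hm₂ h₁ (FreeGroup.map (Fin.castLE hm₁) v₂) τ h₂) {P : Prop}
    [Decidable P] (hP : P ↔ u₁ * u₂ = v₁ * v₂) :
    (∃ w ∈ (bracket n ((closing n P : Fin (n + 2)), true)).rationalSet (n + 2),
      w ≠ 1 ∧ g₂ w = h₂ w) ↔ ∃ x, x ≠ 1 ∧ u₁ * g x * u₂ = v₁ * h x * v₂ := by
  rw [rationalSet_bracket n (closing n P, true)]
  have hincl : Function.Injective (inclTwo n) :=
    (FreeGroup.map_injective (Fin.castSucc_injective _)).comp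
      (FreeGroup.map_injective (Fin.castSucc_injective _))
  change (∃ w ∈ {x | ∃ y, x = (of (Fin.last n).castSucc)⁻¹ * inclTwo n y * of (closing n P)}, _) ↔ _
  by_cases huv : P
  · have huv' := hP.1 huv
    rw [closing, if_pos huv]
    have hu : u₂ = u₁⁻¹ * (v₁ * v₂) := by rw [← huv']; group
    constructor
    · rintro ⟨_, ⟨x, rfl⟩, hx, hxe⟩
      refine ⟨x, fun h => hx (by rw [h]; simp), ?_⟩
      rw [hg₁.map_bracket_castSucc hg₂, hh₁.map_bracket_castSucc hh₂, mul_left_inj, mul_right_inj,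
        map_map_castLE_inj] at hxe
      rw [hu, ← mul_assoc, hxe]
      group
    · rintro ⟨x, hx, hxe⟩
      refine ⟨_, ⟨x, rfl⟩, fun h => hx (hincl ?_), ?_⟩
      · rw [mul_assoc, inv_mul_eq_one, eq_comm, mul_eq_right] at h
        rw [h, _root_.map_one]
      · rw [hg₁.map_bracket_castSucc hg₂, hh₁.map_bracket_castSucc hh₂, mul_left_inj,
          mul_right_inj, map_map_castLE_inj]
        rw [hu] at hxe
        have := congrArg (fun z => z * (v₁ * v₂)⁻¹) hxe
        simpa [mul_assoc] using this
  · rw [closing, if_neg huv]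
    constructor
    · rintro ⟨_, ⟨x, rfl⟩, -, hxe⟩
      rw [hg₁.map_bracket_last hg₂, hh₁.map_bracket_last hh₂, mul_left_inj, mul_right_inj,
        map_map_castLE_inj] at hxe
      refine ⟨x, fun h => huv (hP.2 ?_), hxe⟩
      simpa [h] using hxe
    · rintro ⟨x, -, hxe⟩
      have he : g₂ ((of (Fin.last n).castSucc)⁻¹ * inclTwo n x * of (Fin.last (n + 1))) =
          h₂ ((of (Fin.last n).castSucc)⁻¹ * inclTwo n x * of (Fin.last (n + 1))) := by
        rw [hg₁.map_bracket_last hg₂, hh₁.map_bracket_last hh₂, hxe]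
      refine ⟨_, ⟨x, rfl⟩, fun h => ?_, he⟩
      -- The word `B⁻¹ x E` has exponent sum one in `E`, so it is nontrivial.
      have h1 := congrArg (FreeGroup.lift fun i => if i = Fin.last (n + 1) then
        Multiplicative.ofAdd (1 : ℤ) else 1) h
      rw [_root_.map_mul, _root_.map_mul, ← MonoidHom.comp_apply, show (FreeGroup.lift fun i =>
        if i = Fin.last (n + 1) then Multiplicative.ofAdd (1 : ℤ) else 1).comp (inclTwo n) = 1 by
          ext i; simp [Fin.castSucc_ne_last]] at h1
      simp [Fin.castSucc_ne_last] at h1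

end IsLetterExtension

/-! ### From injective generalised instances to the problem with rational constraints -/

namespace GPCPInstance

open FreeGroup PCPInstance

/-- Letters `B` and `E` are adjoined, with images `u₁⁻¹ β`, `v₁⁻¹ β` and `u₂ ε`, `v₂ ε`. -/
def withBrackets (J : GPCPInstance) : PCPInstance :=
  (J.1.adjoin (J.1.tgt + 1) (invRev J.2.1) (invRev J.2.2.2.1) J.1.tgt J.1.tgt).adjoin
    (J.1.tgt + 2) (Word.clip J.1.tgt J.2.2.1) (Word.clip J.1.tgt J.2.2.2.2)
      (J.1.tgt + 1) (J.1.tgt + 1)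

open Classical in
/-- The index of the last letter of the words which encode the solutions. -/
noncomputable def closing (J : GPCPInstance) : ℕ :=
  if J.IsBalanced then J.1.src else J.1.src + 1

theorem withBrackets_spec {J : GPCPInstance} (hinj : J.1.IsInj) : J.withBrackets.IsInj ∧
    ((∃ w ∈ (AutomatonCode.bracket J.1.src (J.closing, true)).rationalSet J.withBrackets.src, w ≠ 1 ∧
      J.withBrackets.g w = J.withBrackets.h w) ↔ J.HasSolution) := by
  classical
  obtain ⟨⟨⟨n, m⟩, Lg, Lh⟩, u₁, u₂, v₁, v₂⟩ := J
  have hg₁ := isLetterExtension_adjoinWord (n := n) (Nat.le_succ m) Lg (invRev u₁)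
    (τ := Fin.last m) le_rfl
  have hh₁ := isLetterExtension_adjoinWord (n := n) (Nat.le_succ m) Lh (invRev v₁)
    (τ := Fin.last m) le_rfl
  have hg₂ := isLetterExtension_adjoinWord (n := n + 1) (Nat.le_succ (m + 1))
    (adjoinWord n m Lg (invRev u₁) m) (Word.clip m u₂) (τ := Fin.last (m + 1)) le_rfl
  have hh₂ := isLetterExtension_adjoinWord (n := n + 1) (Nat.le_succ (m + 1))
    (adjoinWord n m Lh (invRev v₁) m) (Word.clip m v₂) (τ := Fin.last (m + 1)) le_rfl
  refine ⟨hinj.imp (fun h => hg₂.injective (hg₁.injective h))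
    fun h => hh₂.injective (hh₁.injective h), ?_⟩
  rw [Word.toFree_clip (Nat.le_succ m)] at hg₂ hh₂
  rw [Word.toFree_invRev] at hg₁ hh₁
  have hc : closing (((n, m), Lg, Lh), u₁, u₂, v₁, v₂) = (IsLetterExtension.closing n
      (IsBalanced (((n, m), Lg, Lh), u₁, u₂, v₁, v₂)) : Fin (n + 2)) := by
    unfold closing IsLetterExtension.closing
    split_ifs <;> rfl
  rw [hc]
  exact IsLetterExtension.exists_mem_bracket_iff hg₁ hh₁ hg₂ hh₂
    (by simp only [IsBalanced, Word.toFree_append])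

theorem primrec_withBrackets : Primrec withBrackets := by
  have hI : Primrec fun J : GPCPInstance => J.1 := Primrec.fst
  have ht : Primrec fun J : GPCPInstance => J.1.tgt := Primrec.snd.comp (Primrec.fst.comp hI)
  have h1 : Primrec fun J : GPCPInstance => J.2.1 := Primrec.fst.comp Primrec.snd
  have h2 : Primrec fun J : GPCPInstance => J.2.2.1 :=
    Primrec.fst.comp (Primrec.snd.comp Primrec.snd)
  have h3 : Primrec fun J : GPCPInstance => J.2.2.2.1 :=
    Primrec.fst.comp (Primrec.snd.comp (Primrec.snd.comp Primrec.snd))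
  have h4 : Primrec fun J : GPCPInstance => J.2.2.2.2 :=
    Primrec.snd.comp (Primrec.snd.comp (Primrec.snd.comp Primrec.snd))
  exact primrec_adjoin (primrec_adjoin hI (Primrec.succ.comp ht) (Word.primrec_invRev.comp h1)
    (Word.primrec_invRev.comp h3) ht ht) (Primrec.nat_add.comp ht (Primrec.const 2))
    (Word.primrec_clip.comp ht h2) (Word.primrec_clip.comp ht h4) (Primrec.succ.comp ht)
    (Primrec.succ.comp ht)

theorem primrec_closing : Primrec closing := by
  classical
  have hs : Primrec fun J : GPCPInstance => J.1.src := Primrec.fst.comp (Primrec.fst.comp Primrec.fst)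
  exact Primrec.ite primrecPred_isBalanced hs (Primrec.succ.comp hs)

end GPCPInstance

/-- Each side gains two letters, `B` and `E` in the source and `β` and `ε` in the target. -/
theorem PCPRinj.gpcpInj {S S' : Set (ℕ × ℕ)} (hS' : PCPRinj S')
    (h : ∀ n m, (n, m) ∈ S → (n + 2, m + 2) ∈ S') : GPCPinj S := by
  refine Solvable.comp hS' (t := fun J : GPCPInstance =>
    (J.withBrackets, AutomatonCode.bracket J.1.src (J.closing, true))) ?_ fun J hJ => ?_
  · exact (GPCPInstance.primrec_withBrackets.pair (AutomatonCode.primrec_bracket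
      (Primrec.fst.comp (Primrec.fst.comp Primrec.fst))
      (GPCPInstance.primrec_closing.pair (Primrec.const true)))).to_comp
  · obtain ⟨h1, h2⟩ := GPCPInstance.withBrackets_spec hJ.2
    exact ⟨⟨h _ _ hJ.1, h1⟩, fun c hc => hc.trans h2⟩

theorem theoremA :
    -- the alphabets are part of the input and unrestricted
    ((RP allSizes ↔ BP allSizes) ∧
      (BP allSizes → PCPRinj allSizes) ∧
      (BP allSizes → GPCPinj allSizes) ∧
      (GPCPinj allSizes → PCP allSizes) ∧
      (PCP allSizes → GPCPinjCI allSizes)) ∧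
    -- the size of the source alphabet is fixed, the target alphabet is part of the input
    (∀ n : ℕ,
      (RP (srcSize n) ↔ BP (srcSize n)) ∧
      (BP (srcSize n) → PCPRinj (srcSize n)) ∧
      (BP (srcSize (n + 2)) → GPCPinj (srcSize n)) ∧
      (GPCPinj (srcSize n) → PCP (srcSize n)) ∧
      (PCP (srcSize (n + 2)) → GPCPinjCI (srcSize n))) ∧
    -- both alphabets are fixed
    (∀ n : ℕ,
      ((∀ m, RP (fixedSizes n m)) ↔ ∀ m, BP (fixedSizes n m)) ∧
      ((∀ m, BP (fixedSizes n m)) → ∀ m, PCPRinj (fixedSizes n m)) ∧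
      ((∀ m, BP (fixedSizes (n + 2) m)) → ∀ m, GPCPinj (fixedSizes n m)) ∧
      ((∀ m, GPCPinj (fixedSizes n m)) → ∀ m, PCP (fixedSizes n m)) ∧
      ((∀ m, PCP (fixedSizes (n + 2) m)) → ∀ m, GPCPinjCI (fixedSizes n m))) := by
  -- With both alphabets fixed, the last reductions enlarge the target by two or three letters, so
  -- an algorithm for target size `m + 2` or `m + 3` is used.
  refine ⟨⟨⟨RP.bp, BP.rp⟩, BP.pcpRinj, fun hS => hS.pcpRinj.gpcpInj fun _ _ _ => trivial,
    GPCPinj.pcp, fun hS => hS.gpcpInjCI fun _ _ _ => trivial⟩, fun n => ⟨⟨RP.bp, BP.rp⟩,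
    BP.pcpRinj, fun hS => hS.pcpRinj.gpcpInj fun _ _ hk => congrArg (· + 2) hk, GPCPinj.pcp,
    fun hS => hS.gpcpInjCI fun _ _ hk => congrArg (· + 2) hk⟩, fun n =>
    ⟨⟨fun hS m => (hS m).bp, fun hS m => (hS m).rp⟩, fun hS m => (hS m).pcpRinj,
    fun hS m => (hS (m + 2)).pcpRinj.gpcpInj ?_, fun hS m => (hS m).pcp,
    fun hS m => (hS (m + 3)).gpcpInjCI ?_⟩⟩ <;>
  · rintro _ _ ⟨rfl, rfl⟩
    rfl
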